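/- An index $\boldsymbol{k}=(k_1,\dots,k_r)\in\mathbb{Z}_{\ge1}^r$ ($r\ge1$) is called admissible if $k_r\ge2$. Such an index can be written uniquely as $$\boldsymbol{k}=(\underbrace{1,\dots,1}_{a_1-1},b_1+1,\dots,\underbrace{1,\dots,1}_{a_l-1},b_l+1)\qquad(l\ge1,\ a_p,b_q\ge1),$$ and its dual index is $$\boldsymbol{k}^\dagger=(\underbrace{1,\dots,1}_{b_l-1},a_l+1,\dots,\underbrace{1,\dots,1}_{b_1-1},a_1+1).$$ For an admissible index $\boldsymbol{k}$ put $$I_{\boldsymbol{k}}(s)=\sum_{i=1}^{r}\ \sum_{0<n_1<\cdots<n_r}\frac{1}{n_1^{k_1}\cdots n_r^{k_r}}\cdot\frac{1}{n_i^{s}}\prod_{j\ne i}\frac{n_j}{n_j-n_i}.$$ Theorem. Let $\boldsymbol{k}$ be an admissible index. (i) For every $s\in\mathbb{C}$ with $\operatorname{Re}(s)>-1$, the series defining $I_{\boldsymbol{k}}(s)$ and $I_{\boldsymbol{k}^\dagger}(s)$ converge absolutely (the inner series for every $i$), and $I_{\boldsymbol{k}}(s)=I_{\boldsymbol{k}^\dagger}(s)$.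 (ii) Both functions can be continued meromorphically to $\mathbb{C}$, and the continuations satisfy $I_{\boldsymbol{k}}(s)=I_{\boldsymbol{k}^\dagger}(s)$ as meromorphic functions on $\mathbb{C}$. (iii) For every admissible index $\boldsymbol{k}=(k_1,\dots,k_r)$ (hence also for $\boldsymbol{k}^\dagger$) and every $m\in\mathbb{Z}_{\ge0}$, $$I_{\boldsymbol{k}}(m)=\sum_{\substack{e_1+\cdots+e_r=m\\ e_i\ge0}}\zeta(k_1+e_1,\dots,k_r+e_r),\qquad \zeta(k_1,\dots,k_r)=\sum_{0<n_1<\cdots<n_r}\frac{1}{n_1^{k_1}\cdots n_r^{k_r}},$$ where the multiple zeta series converge. Thus at $s=m$ the identity $I_{\boldsymbol{k}}(s)=I_{\boldsymbol{k}^\dagger}(s)$ is Ohno's relation. -/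

import Mathlib

namespace Ohno

/-- An index `(k_1, …, k_r)` is a list of natural numbers. It is admissible if it is non-empty,
all entries are at least `1` and the last entry is at least `2`. -/
def Admissible (k : List ℕ) : Prop :=
  (∀ x ∈ k, 1 ≤ x) ∧ ∃ h : k ≠ [], 2 ≤ k.getLast h

/-- The index `(1, …, 1, b_1 + 1, …, 1, …, 1, b_l + 1)`, with `a_p - 1` ones in front of
`b_p + 1`, that is encoded by the list of pairs `(a_1, b_1), …, (a_l, b_l)`. -/
def ofBlocks (ps : List (ℕ × ℕ)) : List ℕ :=
  ps.flatMap fun p => List.replicate (p.1 - 1) 1 ++ [p.2 + 1]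

/-- Reads off the pairs `(a_p, b_p)` from an index; the first argument is one more than the number
of ones read since the last entry that exceeds `1`. -/
def toBlocks : ℕ → List ℕ → List (ℕ × ℕ)
  | _, [] => []
  | a, x :: t => if x ≤ 1 then toBlocks (a + 1) t else (a, x - 1) :: toBlocks 1 t

/-- The dual index: the pairs `(a_1, b_1), …, (a_l, b_l)` are replaced by
`(b_l, a_l), …, (b_1, a_1)`. -/
def dual (k : List ℕ) : List ℕ :=
  ofBlocks ((toBlocks 1 k).map Prod.swap).reverse

theorem toBlocks_replicate (c a : ℕ) (t : List ℕ) :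
    toBlocks a (List.replicate c 1 ++ t) = toBlocks (a + c) t := by
  induction c generalizing a with
  | zero => simp
  | succ c ih =>
    rw [List.replicate_succ, List.cons_append, toBlocks, if_pos le_rfl, ih]
    congr 1
    omega

/-- The block decomposition of an index is unique. -/
theorem toBlocks_ofBlocks (ps : List (ℕ × ℕ)) (h : ∀ p ∈ ps, 1 ≤ p.1 ∧ 1 ≤ p.2) :
    toBlocks 1 (ofBlocks ps) = ps := by
  induction ps with
  | nil => rfl
  | cons p ps ih =>
    obtain ⟨h1, h2⟩ := h p (by simp)
    have ih' := ih fun q hq => h q (by simp [hq])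
    have e : ofBlocks (p :: ps) = List.replicate (p.1 - 1) 1 ++ ((p.2 + 1) :: ofBlocks ps) := by
      simp [ofBlocks]
    rw [e, toBlocks_replicate, toBlocks, if_neg (by omega), ih']
    congr 1
    ext
    · simp; omega
    · simp

/-- The dual of the index of a list of pairs of positive integers, as it is usually defined. -/
theorem dual_ofBlocks (ps : List (ℕ × ℕ)) (h : ∀ p ∈ ps, 1 ≤ p.1 ∧ 1 ≤ p.2) :
    dual (ofBlocks ps) = ofBlocks (ps.map Prod.swap).reverse := by
  rw [dual, toBlocks_ofBlocks ps h]

theorem toBlocks_spec (k : List ℕ) (a : ℕ) (ha : 1 ≤ a) (hk : Admissible k) :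
    ofBlocks (toBlocks a k) = List.replicate (a - 1) 1 ++ k ∧ toBlocks a k ≠ [] ∧
      ∀ p ∈ toBlocks a k, 1 ≤ p.1 ∧ 1 ≤ p.2 := by
  induction k generalizing a with
  | nil => exact absurd rfl hk.2.1
  | cons x t ih =>
    obtain ⟨hpos, hne, hlast⟩ := hk
    have hx : 1 ≤ x := hpos x (by simp)
    have hpos' : ∀ y ∈ t, 1 ≤ y := fun y hy => hpos y (by simp [hy])
    by_cases ht : t = []
    · subst ht
      have hx2 : 2 ≤ x := by simpa using hlast
      rw [toBlocks, if_neg (by omega)]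
      refine ⟨?_, by simp, ?_⟩
      · simp only [ofBlocks, toBlocks, List.flatMap_cons, List.flatMap_nil, List.append_nil]
        congr 2
        omega
      · intro p hp
        simp only [toBlocks, List.mem_singleton] at hp
        subst hp
        exact ⟨ha, by show 1 ≤ x - 1; omega⟩
    · have hadm : Admissible t := ⟨hpos', ht, by rwa [List.getLast_cons ht] at hlast⟩
      by_cases hx1 : x ≤ 1
      · obtain ⟨h1, h2, h3⟩ := ih (a + 1) (by omega) hadm
        rw [toBlocks, if_pos hx1]
        refine ⟨?_, h2, h3⟩
        have e : x = 1 := by omega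
        obtain ⟨c, rfl⟩ : ∃ c, a = c + 1 := ⟨a - 1, by omega⟩
        rw [h1, e]
        simp [List.replicate_succ']
      · obtain ⟨h1, -, h3⟩ := ih 1 le_rfl hadm
        rw [toBlocks, if_neg hx1]
        refine ⟨?_, by simp, ?_⟩
        · have e : x - 1 + 1 = x := by omega
          simp only [ofBlocks, List.flatMap_cons] at h1 ⊢
          rw [h1, e]
          simp
        · intro p hp
          rcases List.mem_cons.1 hp with rfl | hp
          · exact ⟨ha, by show 1 ≤ x - 1; omega⟩
          · exact h3 p hp

/-- Every admissible index has a block decomposition. -/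
theorem exists_blocks (k : List ℕ) (hk : Admissible k) :
    ∃ ps : List (ℕ × ℕ), ps ≠ [] ∧ (∀ p ∈ ps, 1 ≤ p.1 ∧ 1 ≤ p.2) ∧ k = ofBlocks ps := by
  obtain ⟨h1, h2, h3⟩ := toBlocks_spec k 1 le_rfl hk
  exact ⟨_, h2, h3, by simpa using h1.symm⟩

/-- The tuples `0 < n_1 < ⋯ < n_r` of natural numbers. -/
abbrev IncTuple (r : ℕ) : Type :=
  {n : Fin r → ℕ // (∀ j, 0 < n j) ∧ StrictMono n}

/-- The summand
`1 / (n_1 ^ k_1 ⋯ n_r ^ k_r) * 1 / n_i ^ s * ∏_{j ≠ i} n_j / (n_j - n_i)`. -/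
noncomputable def term {r : ℕ} (k : Fin r → ℕ) (s : ℂ) (i : Fin r) (n : IncTuple r) : ℂ :=
  (1 / ∏ j, (n.1 j : ℂ) ^ k j) * (1 / (n.1 i : ℂ) ^ s) *
    ∏ j ∈ Finset.univ.erase i, (n.1 j : ℂ) / ((n.1 j : ℂ) - (n.1 i : ℂ))

/-- For every `i`, the series over `0 < n_1 < ⋯ < n_r` in the definition of `I_k(s)` converges
absolutely. -/
def ConvergesAbsolutely (k : List ℕ) (s : ℂ) : Prop :=
  ∀ i : Fin k.length, Summable fun n : IncTuple k.length => ‖term k.get s i n‖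

/-- The function `I_k(s)`, as a series. -/
noncomputable def I (k : List ℕ) (s : ℂ) : ℂ :=
  ∑ i : Fin k.length, ∑' n : IncTuple k.length, term k.get s i n

/-- `F` is the meromorphic continuation to `ℂ` of the function `I_k(s)`, which is given by the
series for `Re s > -1`. A meromorphic function is represented by its normal form, which has its
limit as value at every point where the limit is finite, and the value `0` at the poles. -/
def IsMeromorphicContinuation (k : List ℕ) (F : ℂ → ℂ) : Prop :=
  MeromorphicNFOn F Set.univ ∧ ∀ s : ℂ, -1 < s.re → F s = I k s

/-- The summand `1 / (n_1 ^ k_1 ⋯ n_r ^ k_r)` of the multiple zeta value. -/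
noncomputable def mzvTerm {r : ℕ} (k : Fin r → ℕ) (n : IncTuple r) : ℂ :=
  1 / ∏ j, (n.1 j : ℂ) ^ k j

/-- The multiple zeta value `ζ(k_1, …, k_r)`. -/
noncomputable def mzv {r : ℕ} (k : Fin r → ℕ) : ℂ :=
  ∑' n : IncTuple r, mzvTerm k n

/-- The sum of `ζ(k_1 + e_1, …, k_r + e_r)` over all `e_1, …, e_r ≥ 0` with
`e_1 + ⋯ + e_r = m`. -/
noncomputable def ohnoSum (k : List ℕ) (m : ℕ) : ℂ :=
  ∑ e ∈ Finset.piAntidiag (Finset.univ : Finset (Fin k.length)) m, mzv (k.get + e)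

end Ohno

/-! For y > 0 let f_k(y) be the sum of ∏ 1/(n_j^(k_j-1) (n_j + y)) over 0 < n_1 < ⋯ < n_r
(`shiftedSum`). Partial fractions in y rewrite f_k(y) as ∑_i ∑_n c_i(n)/(n_i + y), and with the same
coefficients I_k(s) = ∑_i ∑_n c_i(n) n_i^(-s-1). Since ∫_0^∞ y^(w-1)/(c + y) dy = c^(w-1)
Γ(w)Γ(1-w), the Mellin transform of f_k at w is I_k(-w) Γ(w)Γ(1-w) for 0 < Re w < 1
(`Admissible.mellin_shiftedSum`). Duality and continuation of I_k thus become statements about f_k.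

Duality f_k = f_{k†} (`shiftedSum_dual`) comes from a connected sum: a gamma quotient C(m, n)
couples two nested sums so that summing over m with weight 1/(m + y) in one equals dividing by n in
the other. Moving all letters of k across yields the dual word. Hence I_k = I_{k†} on -1 < Re s < 0,
and then on Re s > -1 by the identity theorem.

The continuation rests on a complete asymptotic expansion of f_k at infinity in log(y)^b / y^a with
a ≥ 1 (`hasExpansion_shiftedSum`): subtracting finitely many of these terms, cut off to (1, ∞),
leaves a Mellin transform that is holomorphic further to the right, and the terms themselves have
rational transforms. To get the expansion, f_k is reduced to nested sums over letters in m or in m +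
z, with coefficients in 1/z. For each such sum S, the exact relation `nestedSum_shift` expresses
S(z) - S(z+1) by shorter sums with a gain of 1/z, up to a factor that is itself O(1/z). By induction
this difference has an expansion; it can be summed formally, and slow variation of S shows that what
remains is a constant (`HasExpansion.of_difference`).

Absolute convergence follows by bounding a summand by a product of powers below -1 of n_i and the
distances |n_j - n_i|, which determine the tuple (`abs_coef_mul_rpow_le`). At s = m the inner sum
over i is the complete homogeneous symmetric polynomial of degree m in the 1/n_j
(`sum_piAntidiag_prod_pow`); this and the partial fractions are two readings of Lagrange's identity
`sum_lagrange`. -/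

namespace Ohno

open scoped ENNReal

/-! ### The connected sum of Seki and Yamamoto -/

/-- The connector `Γ(m + 1 + y) Γ(n + 1 + y) / (Γ(1 + y) Γ(m + n + 1 + y))`. -/
noncomputable def connector (y : ℝ) (m n : ℕ) : ℝ :=
  Real.Gamma (m + 1 + y) * Real.Gamma (n + 1 + y) /
    (Real.Gamma (1 + y) * Real.Gamma (m + n + 1 + y))

theorem connector_comm (y : ℝ) (m n : ℕ) : connector y m n = connector y n m := by
  unfold connector
  rw [mul_comm (Real.Gamma (m + 1 + y)), add_comm (m : ℝ) n]

theorem connector_pos {y : ℝ} (hy : 0 < y) (m n : ℕ) : 0 < connector y m n := by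
  unfold connector
  have h1 : 0 < Real.Gamma (m + 1 + y) := Real.Gamma_pos_of_pos (by positivity)
  have h2 : 0 < Real.Gamma (n + 1 + y) := Real.Gamma_pos_of_pos (by positivity)
  have h3 : 0 < Real.Gamma (1 + y) := Real.Gamma_pos_of_pos (by positivity)
  have h4 : 0 < Real.Gamma (m + n + 1 + y) := Real.Gamma_pos_of_pos (by positivity)
  positivity

theorem connector_zero_right {y : ℝ} (hy : 0 < y) (m : ℕ) : connector y m 0 = 1 := by
  unfold connector
  have h1 : 0 < Real.Gamma (m + 1 + y) := Real.Gamma_pos_of_pos (by positivity)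
  have h3 : 0 < Real.Gamma (1 + y) := Real.Gamma_pos_of_pos (by positivity)
  simp only [Nat.cast_zero, add_zero, zero_add]
  field_simp

theorem connector_succ_right {y : ℝ} (hy : 0 < y) (m n : ℕ) :
    connector y m (n + 1) = connector y m n * ((n + 1 + y) / (m + n + 1 + y)) := by
  unfold connector
  have h4 : 0 < Real.Gamma (m + n + 1 + y) := Real.Gamma_pos_of_pos (by positivity)
  have h3 : 0 < Real.Gamma (1 + y) := Real.Gamma_pos_of_pos (by positivity)
  have e1 : ((n + 1 : ℕ) : ℝ) + 1 + y = (n + 1 + y) + 1 := by push_cast; ring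
  have e2 : (m : ℝ) + ((n + 1 : ℕ) : ℝ) + 1 + y = (m + n + 1 + y) + 1 := by push_cast; ring
  have p1 : (n + 1 + y : ℝ) ≠ 0 := by positivity
  have p2 : (m + n + 1 + y : ℝ) ≠ 0 := by positivity
  rw [e1, e2, Real.Gamma_add_one p1, Real.Gamma_add_one p2]
  field_simp

theorem connector_one_left {y : ℝ} (hy : 0 < y) (n : ℕ) :
    connector y 1 n = (1 + y) / (n + 1 + y) := by
  have h := connector_succ_right hy n 0
  rw [connector_zero_right hy] at h
  rw [connector_comm, h]
  simp

theorem connector_le {y : ℝ} (hy : 0 < y) (m n : ℕ) :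
    connector y (m + 1) n ≤ connector y 1 n := by
  induction m with
  | zero => simp
  | succ m ih =>
    refine le_trans ?_ ih
    rw [connector_comm, connector_succ_right hy n (m + 1), connector_comm y n]
    refine mul_le_of_le_one_right (connector_pos hy _ _).le ?_
    rw [div_le_one (by positivity)]
    have : (0 : ℝ) ≤ n := by positivity
    linarith

theorem connector_tendsto {y : ℝ} (hy : 0 < y) {m : ℕ} (hm : 1 ≤ m) :
    Filter.Tendsto (connector y m) Filter.atTop (nhds 0) := by
  obtain ⟨m, rfl⟩ := Nat.exists_eq_add_of_le' hm
  refine squeeze_zero (g := fun n => connector y 1 n) (fun n => (connector_pos hy _ _).le)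
    (connector_le hy m) ?_
  simp only [connector_one_left hy]
  refine Filter.Tendsto.div_atTop tendsto_const_nhds ?_
  refine Filter.tendsto_atTop_add_const_right _ _ ?_
  exact Filter.tendsto_atTop_add_const_right _ _ tendsto_natCast_atTop_atTop

/-- The series telescopes: C(m, n) - C(m, n+1) = m C(m, n+1)/(n+1+y), and C(m, n) → 0 as n → ∞
because m ≥ 1. -/
theorem hasSum_connector {y : ℝ} (hy : 0 < y) {m : ℕ} (hm : 1 ≤ m) (n : ℕ) :
    HasSum (fun j : ℕ => connector y m (n + 1 + j) / ((n + 1 + j : ℕ) + y))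
      (connector y m n / m) := by
  have hm0 : (0 : ℝ) < m := by exact_mod_cast hm
  rw [hasSum_iff_tendsto_nat_of_nonneg]
  · have key : ∀ N : ℕ, ∑ j ∈ Finset.range N,
        connector y m (n + 1 + j) / ((n + 1 + j : ℕ) + y) =
        connector y m n / m - connector y m (n + N) / m := by
      intro N
      induction N with
      | zero => simp
      | succ N ih =>
        rw [Finset.sum_range_succ, ih]
        have e : n + 1 + N = n + N + 1 := by ring
        rw [e, ← add_assoc, connector_succ_right hy]
        push_cast
        field_simp
        ring
    simp only [key]
    have h := ((connector_tendsto hy hm).comp (Filter.tendsto_add_atTop_nat n)).div_const (m : ℝ)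
    have h2 := h.const_sub (connector y m n / m)
    simpa [Function.comp_def, add_comm] using h2
  · intro j
    have := connector_pos hy m (n + 1 + j)
    positivity

/-- Summation over the numbers above `m` with weight `1 / (n + y)` (letter `true`), or division
by `m` (letter `false`). -/
noncomputable def letterOp (y : ℝ) : Bool → (ℕ → ℝ≥0∞) → ℕ → ℝ≥0∞
  | true, f, m => ∑' j : ℕ, f (m + 1 + j) * ENNReal.ofReal (1 / ((m + 1 + j : ℕ) + y))
  | false, f, m => f m * ENNReal.ofReal (1 / m)

/-- The composition of the operators of the letters of a word. -/
noncomputable def wordOp (y : ℝ) : List Bool → (ℕ → ℝ≥0∞) → ℕ → ℝ≥0∞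
  | [], f => f
  | b :: w, f => letterOp y b (wordOp y w f)

theorem wordOp_append (y : ℝ) (u v : List Bool) (f : ℕ → ℝ≥0∞) :
    wordOp y (u ++ v) f = wordOp y u (wordOp y v f) := by
  induction u with
  | nil => rfl
  | cons b u ih => simp [wordOp, ih]

theorem wordOp_congr (y : ℝ) (w : List Bool) {f g : ℕ → ℝ≥0∞} (h : ∀ m, 1 ≤ m → f m = g m)
    (m : ℕ) (hm : 1 ≤ m) : wordOp y w f m = wordOp y w g m := by
  induction w generalizing m with
  | nil => exact h m hm
  | cons b w ih =>
    cases b with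
    | true =>
      simp only [wordOp, letterOp]
      exact tsum_congr fun j => by rw [ih _ (by omega)]
    | false => simp only [wordOp, letterOp, ih m hm]

/-- A leading `true` evaluates the rest only at positive arguments, so the junk value of 1/m at m =
0 never enters. -/
theorem wordOp_true_congr (y : ℝ) (w : List Bool) {f g : ℕ → ℝ≥0∞}
    (h : ∀ m, 1 ≤ m → f m = g m) (m : ℕ) :
    wordOp y (true :: w) f m = wordOp y (true :: w) g m := by
  simp only [wordOp, letterOp]
  exact tsum_congr fun j => by rw [wordOp_congr y w h _ (by omega)]

/-- Letters acting on different variables commute. Working in `ℝ≥0∞` makes the interchange of sums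
free of any summability condition. -/
theorem letterOp_comm (y : ℝ) (b c : Bool) (F : ℕ → ℕ → ℝ≥0∞) (m n : ℕ) :
    letterOp y b (fun m => letterOp y c (F m) n) m =
      letterOp y c (fun n => letterOp y b (fun m => F m n) m) n := by
  cases b <;> cases c <;> simp only [letterOp, ← ENNReal.tsum_mul_right]
  · ring
  · exact tsum_congr fun i => by ring
  · exact tsum_congr fun i => by ring
  · rw [ENNReal.tsum_comm]
    exact tsum_congr fun i => tsum_congr fun j => by ring

theorem letterOp_wordOp_comm (y : ℝ) (b : Bool) (v : List Bool) (F : ℕ → ℕ → ℝ≥0∞) (m n : ℕ) :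
    letterOp y b (fun m => wordOp y v (F m) n) m =
      wordOp y v (fun n => letterOp y b (fun m => F m n) m) n := by
  induction v generalizing n with
  | nil => rfl
  | cons c v ih =>
    simp only [wordOp]
    rw [letterOp_comm]
    simp only [ih]

/-- The mechanism of transport: a letter acting on one variable of the connector equals the opposite
letter acting on the other. The variable that gets divided has to be positive. -/
theorem letterOp_connector {y : ℝ} (hy : 0 < y) (b : Bool) (m n : ℕ) (hm : b = false → 1 ≤ m)
    (hn : b = true → 1 ≤ n) :
    letterOp y b (fun m => ENNReal.ofReal (connector y m n)) m =
      letterOp y (!b) (fun n => ENNReal.ofReal (connector y m n)) n := by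
  have key : ∀ m n : ℕ, 1 ≤ m →
      ENNReal.ofReal (connector y m n) * ENNReal.ofReal (1 / m) =
      ∑' j : ℕ, ENNReal.ofReal (connector y m (n + 1 + j)) *
        ENNReal.ofReal (1 / ((n + 1 + j : ℕ) + y)) := by
    intro m n hm
    have h := hasSum_connector hy hm n
    simp only [← ENNReal.ofReal_mul (connector_pos hy _ _).le, mul_one_div]
    rw [← ENNReal.ofReal_tsum_of_nonneg _ h.summable, h.tsum_eq]
    intro j
    have := connector_pos hy m (n + 1 + j)
    positivity
  cases b with
  | true =>
    simp only [letterOp, Bool.not_true]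
    rw [connector_comm y m n, key n m (hn rfl)]
    simp only [connector_comm y n]
  | false =>
    simp only [letterOp, Bool.not_false]
    exact key m n (hm rfl)

/-- The double series that interpolates between a word and its dual. -/
noncomputable def connectedSum (y : ℝ) (u v : List Bool) : ℝ≥0∞ :=
  wordOp y u (fun m => wordOp y v (fun n => ENNReal.ofReal (connector y m n)) 0) 0

/-- Transport of one letter, where both words start with `true` unless they are empty. -/
theorem connectedSum_transport {y : ℝ} (hy : 0 < y) (u v : List Bool) (b : Bool)
    (hu : ∃ u', u ++ [b] = true :: u') (hv : ∃ v', v ++ [!b] = true :: v') :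
    connectedSum y (u ++ [b]) v = connectedSum y u (v ++ [!b]) := by
  unfold connectedSum
  simp only [wordOp_append]
  have e : ∀ m, (b = false → 1 ≤ m) →
      wordOp y [b] (fun m => wordOp y v (fun n => ENNReal.ofReal (connector y m n)) 0) m =
      wordOp y v (wordOp y [!b] fun n => ENNReal.ofReal (connector y m n)) 0 := by
    intro m hm
    simp only [wordOp]
    rw [letterOp_wordOp_comm]
    -- For empty `v` the second variable is still 0, which is allowed only if the arriving letter is
    -- a summation; that forces `b = false`.
    rcases v with _ | ⟨c, v⟩
    · obtain ⟨v', hv'⟩ := hv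
      have hb : b = false := by simp at hv'; exact hv'.1
      exact letterOp_connector hy b m 0 hm (by simp [hb])
    · obtain ⟨v', hv'⟩ := hv
      have hc : c = true := by simp at hv'; exact hv'.1
      subst hc
      refine wordOp_true_congr y v (fun n hn => ?_) 0
      exact letterOp_connector hy b m n hm fun _ => hn
  rcases u with _ | ⟨c, u⟩
  · obtain ⟨u', hu'⟩ := hu
    have hb : b = true := by simp at hu'; exact hu'.1
    exact e 0 (by simp [hb])
  · obtain ⟨u', hu'⟩ := hu
    have hc : c = true := by simp at hu'; exact hu'.1
    subst hc
    exact wordOp_true_congr y u (fun m hm => e m fun _ => hm) 0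

/-- Letters leave `u` from its end and are inverted, hence the reversal. The condition for `v = []`
makes the first letter to arrive a `true`, so that both words keep starting with `true` throughout.
-/
theorem connectedSum_transport_all {y : ℝ} (hy : 0 < y) (u v : List Bool)
    (hu : u = [] ∨ ∃ u', u = true :: u') (hv : v = [] → ∃ u', u = u' ++ [false])
    (hv' : v = [] ∨ ∃ v', v = true :: v') :
    connectedSum y u v = connectedSum y [] (v ++ (u.map not).reverse) := by
  induction u using List.reverseRecOn generalizing v with
  | nil => simp
  | append_singleton u b ih =>
    have hu2 : ∃ u', u ++ [b] = true :: u' := by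
      rcases hu with h | h
      · simp at h
      · exact h
    have hv2 : ∃ v', v ++ [!b] = true :: v' := by
      rcases hv' with h | ⟨v', h⟩
      · obtain ⟨u', hu'⟩ := hv h
        have hb : b = false := by
          have := congrArg List.getLast? hu'
          simpa using this
        subst h
        exact ⟨[], by simp [hb]⟩
      · exact ⟨v' ++ [!b], by simp [h]⟩
    rw [connectedSum_transport hy u v b hu2 hv2, ih]
    · simp
    · rcases u with _ | ⟨c, u⟩
      · simp
      · obtain ⟨u', h⟩ := hu2
        right
        exact ⟨u, by simp at h; simp [h.1]⟩
    · intro h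
      simp at h
    · exact Or.inr hv2

/-- The connector is 1 when either variable is 0, so the two extreme connected sums are ordinary
nested sums. -/
theorem wordOp_one_dual {y : ℝ} (hy : 0 < y) (u : List Bool) (h1 : ∃ u', u = true :: u')
    (h2 : ∃ u', u = u' ++ [false]) :
    wordOp y u (fun _ => 1) 0 = wordOp y (u.map not).reverse (fun _ => 1) 0 := by
  have h := connectedSum_transport_all hy u [] (Or.inr h1) (fun _ => h2) (Or.inl rfl)
  unfold connectedSum at h
  simpa [wordOp, connector_zero_right hy, connector_comm y 0] using h

/-! ### Words of indices and duality -/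

/-- The word in the letters `true` (for `dt / (1 - t)`) and `false` (for `dt / t`) of an index. -/
def indexWord (k : List ℕ) : List Bool :=
  k.flatMap fun x => true :: List.replicate (x - 1) false

theorem indexWord_append (k l : List ℕ) : indexWord (k ++ l) = indexWord k ++ indexWord l := by
  simp [indexWord]

theorem indexWord_block (a b : ℕ) (ha : 1 ≤ a) :
    indexWord (List.replicate (a - 1) 1 ++ [b + 1]) =
      List.replicate a true ++ List.replicate b false := by
  obtain ⟨a, rfl⟩ := Nat.exists_eq_add_of_le' ha
  rw [indexWord_append]
  have h : ∀ c, indexWord (List.replicate c 1) = List.replicate c true := by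
    intro c
    induction c with
    | zero => rfl
    | succ c ih =>
      rw [List.replicate_succ, List.replicate_succ]
      simp only [indexWord, List.flatMap_cons] at ih ⊢
      rw [ih]
      rfl
  rw [Nat.add_sub_cancel, h]
  simp [ indexWord, List.replicate_succ']

theorem indexWord_ofBlocks (ps : List (ℕ × ℕ)) (h : ∀ p ∈ ps, 1 ≤ p.1 ∧ 1 ≤ p.2) :
    indexWord (ofBlocks ps) =
      ps.flatMap fun p => List.replicate p.1 true ++ List.replicate p.2 false := by
  induction ps with
  | nil => rfl
  | cons p ps ih =>
    have e : ofBlocks (p :: ps) = (List.replicate (p.1 - 1) 1 ++ [p.2 + 1]) ++ ofBlocks ps := by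
      simp [ofBlocks]
    rw [e, indexWord_append, indexWord_block _ _ (h p (by simp)).1,
      ih fun q hq => h q (by simp [hq])]
    simp

theorem indexWord_dual_ofBlocks (ps : List (ℕ × ℕ)) (h : ∀ p ∈ ps, 1 ≤ p.1 ∧ 1 ≤ p.2) :
    indexWord (ofBlocks (ps.map Prod.swap).reverse) =
      ((indexWord (ofBlocks ps)).map not).reverse := by
  rw [indexWord_ofBlocks ps h, indexWord_ofBlocks]
  · induction ps with
    | nil => rfl
    | cons p ps ih =>
      have ih := ih fun q hq => h q (by simp [hq])
      simp only [List.map_cons, List.reverse_cons, List.flatMap_append, ih]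
      simp
  · intro p hp
    simp only [List.mem_reverse, List.mem_map] at hp
    obtain ⟨q, hq, rfl⟩ := hp
    exact ⟨(h q hq).2, (h q hq).1⟩

theorem admissible_ofBlocks (ps : List (ℕ × ℕ)) (hne : ps ≠ [])
    (h : ∀ p ∈ ps, 1 ≤ p.1 ∧ 1 ≤ p.2) : Admissible (ofBlocks ps) := by
  refine ⟨?_, ?_⟩
  · intro x hx
    simp only [ofBlocks, List.mem_flatMap, List.mem_append, List.mem_replicate,
      List.mem_singleton] at hx
    obtain ⟨p, -, h1 | h1⟩ := hx <;> omega
  · obtain ⟨qs, q, rfl⟩ := List.eq_nil_or_concat ps |>.resolve_left hne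
    have e : ofBlocks (qs ++ [q]) = (ofBlocks qs ++ List.replicate (q.1 - 1) 1) ++ [q.2 + 1] := by
      simp [ofBlocks]
    have := (h q (by simp)).2
    simp only [List.concat_eq_append, e]
    exact ⟨by simp, by simpa using this⟩

theorem Admissible.dual {k : List ℕ} (hk : Admissible k) : Admissible (dual k) := by
  obtain ⟨ps, hne, h, rfl⟩ := exists_blocks k hk
  rw [dual_ofBlocks ps h]
  refine admissible_ofBlocks _ (by simpa using hne) ?_
  intro p hp
  simp only [List.mem_reverse, List.mem_map] at hp
  obtain ⟨q, hq, rfl⟩ := hp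
  exact ⟨(h q hq).2, (h q hq).1⟩

theorem Admissible.exists_eq_append {k : List ℕ} (hk : Admissible k) :
    ∃ l x, k = l ++ [x + 2] := by
  obtain ⟨-, hne, h⟩ := hk
  refine ⟨k.dropLast, k.getLast hne - 2, ?_⟩
  rw [Nat.sub_add_cancel h, List.dropLast_append_getLast]

theorem wordOp_indexWord_dual {y : ℝ} (hy : 0 < y) {k : List ℕ} (hk : Admissible k) :
    wordOp y (indexWord k) (fun _ => 1) 0 = wordOp y (indexWord (dual k)) (fun _ => 1) 0 := by
  have h1 : ∃ u', indexWord k = true :: u' := by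
    obtain ⟨-, hne, -⟩ := hk
    rcases k with _ | ⟨x, k⟩
    · exact absurd rfl hne
    · exact ⟨List.replicate (x - 1) false ++ indexWord k, by simp [indexWord]⟩
  have h2 : ∃ u', indexWord k = u' ++ [false] := by
    obtain ⟨l, x, rfl⟩ := hk.exists_eq_append
    refine ⟨indexWord l ++ true :: List.replicate x false, ?_⟩
    simp [indexWord, List.replicate_succ']
  rw [wordOp_one_dual hy _ h1 h2]
  obtain ⟨ps, hne, h, rfl⟩ := exists_blocks k hk
  rw [dual_ofBlocks ps h, indexWord_dual_ofBlocks ps h]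

end Ohno

namespace Ohno

/-! ### Nested sums in two kinds of letters -/

/-- The sum of `φ` over the natural numbers above `n`. -/
noncomputable def tailSum (φ : ℕ → ℝ) (n : ℕ) : ℝ := ∑' j : ℕ, φ (n + 1 + j)

/-- `|φ m| ≤ C m ^ (-3/2)` for `m ≥ 1`. -/
def SummandBound (C : ℝ) (φ : ℕ → ℝ) : Prop :=
  ∀ m : ℕ, 1 ≤ m → |φ m| ≤ C * (1 / (m * √(m : ℝ)))

theorem inv_mul_sqrt_le {m : ℕ} (hm : 1 ≤ m) :
    1 / (m * √(m : ℝ)) ≤ 4 * (1 / √(m : ℝ) - 1 / √((m + 1 : ℕ) : ℝ)) := by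
  have hm1 : (1 : ℝ) ≤ m := by exact_mod_cast hm
  set a := √(m : ℝ) with ha
  set b := √((m + 1 : ℕ) : ℝ) with hb
  have ha2 : a ^ 2 = m := Real.sq_sqrt (by positivity)
  have hb2 : b ^ 2 = m + 1 := by rw [hb, Real.sq_sqrt (by positivity)]; push_cast; ring
  have ha1 : 1 ≤ a := by rw [ha]; exact Real.one_le_sqrt.2 hm1
  have hb0 : 0 < b := Real.sqrt_pos.2 (by positivity)
  have hab : a ≤ b := Real.sqrt_le_sqrt (by push_cast; linarith)
  -- From b² = a² + 1 ≤ 2a². Together with (b - a)(b + a) = 1 this gives ab ≤ (15/4) a³ (b - a),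
  -- whence the constant 4.
  have hba : b ≤ 3 / 2 * a := by
    refine le_of_sq_le_sq ?_ (by positivity)
    nlinarith
  rw [← ha2, div_sub_div _ _ (by positivity) (by positivity), mul_div_assoc', div_le_div_iff₀ (by positivity) (by positivity)]
  have h1 : (b - a) * (b + a) = 1 := by nlinarith
  have h2 : 0 ≤ b - a := by linarith
  have h3 : 1 ≤ (b - a) * (5 / 2 * a) := by nlinarith
  have h4 : a * b ≤ 3 / 2 * a ^ 2 := by nlinarith
  have h5 : 3 / 2 * a ^ 2 ≤ 3 / 2 * a ^ 2 * ((b - a) * (5 / 2 * a)) := by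
    exact le_mul_of_one_le_right (by positivity) h3
  have h6 : 0 ≤ (b - a) * a ^ 3 := by positivity
  nlinarith

theorem hasSum_telescope (n : ℕ) :
    HasSum (fun j : ℕ => 1 / √((n + 1 + j : ℕ) : ℝ) - 1 / √((n + 1 + j + 1 : ℕ) : ℝ))
      (1 / √((n + 1 : ℕ) : ℝ)) := by
  rw [hasSum_iff_tendsto_nat_of_nonneg]
  · have e : ∀ N : ℕ, ∑ j ∈ Finset.range N,
        (1 / √((n + 1 + j : ℕ) : ℝ) - 1 / √((n + 1 + j + 1 : ℕ) : ℝ)) =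
        1 / √((n + 1 : ℕ) : ℝ) - 1 / √((n + 1 + N : ℕ) : ℝ) := fun N => by
      induction N with
      | zero => simp
      | succ N ih => rw [Finset.sum_range_succ, ih, ← add_assoc]; ring
    simp only [e]
    have h : Filter.Tendsto (fun N : ℕ => 1 / √((n + 1 + N : ℕ) : ℝ)) Filter.atTop (nhds 0) := by
      refine Filter.Tendsto.div_atTop tendsto_const_nhds ?_
      refine Real.tendsto_sqrt_atTop.comp (tendsto_natCast_atTop_atTop.comp ?_)
      exact Filter.tendsto_atTop_mono (fun N => by simp only [id]; omega) Filter.tendsto_id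
    simpa using h.const_sub (1 / √((n + 1 : ℕ) : ℝ))
  · intro j
    rw [sub_nonneg]
    refine one_div_le_one_div_of_le (Real.sqrt_pos.2 (by positivity)) (Real.sqrt_le_sqrt ?_)
    exact_mod_cast Nat.le_succ _

theorem SummandBound.abs_le {C : ℝ} {φ : ℕ → ℝ} (h : SummandBound C φ) (hC : 0 ≤ C) (n j : ℕ) :
    |φ (n + 1 + j)| ≤
      4 * C * (1 / √((n + 1 + j : ℕ) : ℝ) - 1 / √((n + 1 + j + 1 : ℕ) : ℝ)) := by
  refine (h _ (by omega)).trans ?_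
  have := mul_le_mul_of_nonneg_left (inv_mul_sqrt_le (m := n + 1 + j) (by omega)) hC
  linarith

theorem SummandBound.summable {C : ℝ} {φ : ℕ → ℝ} (h : SummandBound C φ) (hC : 0 ≤ C) (n : ℕ) :
    Summable fun j => φ (n + 1 + j) :=
  Summable.of_norm_bounded ((hasSum_telescope n).summable.mul_left (4 * C)) (h.abs_le hC n)

theorem SummandBound.tailSum_le {C : ℝ} {φ : ℕ → ℝ} (h : SummandBound C φ) (hC : 0 ≤ C) (n : ℕ) :
    |tailSum φ n| ≤ 4 * C * (1 / √((n + 1 : ℕ) : ℝ)) := by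
  unfold tailSum
  rw [← Real.norm_eq_abs]
  exact tsum_of_norm_bounded ((hasSum_telescope n).mul_left (4 * C)) (h.abs_le hC n)

theorem SummandBound.tailSum_succ {C : ℝ} {φ : ℕ → ℝ} (h : SummandBound C φ) (hC : 0 ≤ C) (n : ℕ) :
    tailSum φ n = φ (n + 1) + tailSum φ (n + 1) := by
  unfold tailSum
  rw [(h.summable hC n).tsum_eq_zero_add]
  congr 1
  exact tsum_congr fun j => by congr 1; ring

theorem tailSum_congr {φ ψ : ℕ → ℝ} (h : ∀ m, 1 ≤ m → φ m = ψ m) (n : ℕ) :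
    tailSum φ n = tailSum ψ n :=
  tsum_congr fun _ => h _ (by omega)

theorem tailSum_const_mul (c : ℝ) (φ : ℕ → ℝ) (n : ℕ) :
    tailSum (fun m => c * φ m) n = c * tailSum φ n :=
  tsum_mul_left

theorem tailSum_add {C C' : ℝ} {φ ψ : ℕ → ℝ} (h : SummandBound C φ) (hC : 0 ≤ C)
    (h' : SummandBound C' ψ) (hC' : 0 ≤ C') (n : ℕ) :
    tailSum (fun m => φ m + ψ m) n = tailSum φ n + tailSum ψ n :=
  (h.summable hC n).tsum_add (h'.summable hC' n)

theorem tailSum_sub {C C' : ℝ} {φ ψ : ℕ → ℝ} (h : SummandBound C φ) (hC : 0 ≤ C)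
    (h' : SummandBound C' ψ) (hC' : 0 ≤ C') (n : ℕ) :
    tailSum (fun m => φ m - ψ m) n = tailSum φ n - tailSum ψ n :=
  (h.summable hC n).tsum_sub (h'.summable hC' n)

/-- `|Φ n| ≤ C (n + 1) ^ (-1/2)`. -/
def TailBound (C : ℝ) (Φ : ℕ → ℝ) : Prop :=
  ∀ n : ℕ, |Φ n| ≤ C * (1 / √((n + 1 : ℕ) : ℝ))

theorem SummandBound.tailBound {C : ℝ} {φ : ℕ → ℝ} (h : SummandBound C φ) (hC : 0 ≤ C) :
    TailBound (4 * C) (tailSum φ) :=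
  h.tailSum_le hC

/-- The two bounds reproduce each other: a tail of m^(-3/2) is of size n^(-1/2), and a further
factor 1/m restores m^(-3/2). This controls nested sums of any depth. -/
theorem TailBound.mul {C c : ℝ} {Φ ψ : ℕ → ℝ} (h : TailBound C Φ) (hC : 0 ≤ C) (hc : 0 ≤ c)
    (hψ : ∀ m : ℕ, 1 ≤ m → |ψ m| ≤ c * (1 / m)) : SummandBound (c * C) fun m => ψ m * Φ m := by
  intro m hm
  have hm0 : (0 : ℝ) < m := by exact_mod_cast hm
  have h1 : |Φ m| ≤ C * (1 / √(m : ℝ)) := by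
    refine (h m).trans (mul_le_mul_of_nonneg_left ?_ hC)
    refine one_div_le_one_div_of_le (Real.sqrt_pos.2 hm0) (Real.sqrt_le_sqrt ?_)
    exact_mod_cast Nat.le_succ _
  rw [abs_mul]
  calc |ψ m| * |Φ m| ≤ (c * (1 / m)) * (C * (1 / √(m : ℝ))) :=
        mul_le_mul (hψ m hm) h1 (abs_nonneg _) (by positivity)
    _ = c * C * (1 / (m * √(m : ℝ))) := by field_simp

theorem TailBound.tendsto {C : ℝ} {Φ : ℕ → ℝ} (h : TailBound C Φ) :
    Filter.Tendsto Φ Filter.atTop (nhds 0) := by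
  refine squeeze_zero_norm h ?_
  have h : Filter.Tendsto (fun n : ℕ => 1 / √((n + 1 : ℕ) : ℝ)) Filter.atTop (nhds 0) := by
    refine Filter.Tendsto.div_atTop tendsto_const_nhds ?_
    exact Real.tendsto_sqrt_atTop.comp
      (tendsto_natCast_atTop_atTop.comp (Filter.tendsto_add_atTop_nat 1))
  simpa using h.const_mul C

/-- The letters: `X a` and `Y b` stand for `1 / m ^ (a + 1)` and `1 / (m + z) ^ (b + 1)`,
and `D` stands for `1 / m - 1 / (m + z)`. -/
inductive Letter
  | X (a : ℕ)
  | Y (b : ℕ)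
  | D

namespace Letter

/-- The part of a letter that depends on `m` only. -/
noncomputable def xp : Letter → ℕ → ℝ
  | X a, m => 1 / (m : ℝ) ^ (a + 1)
  | Y _, _ => 0
  | D, m => 1 / m

/-- The part of a letter that depends on `m + z` only. -/
noncomputable def yp : Letter → ℝ → ℝ
  | X _, _ => 0
  | Y b, t => 1 / t ^ (b + 1)
  | D, t => -(1 / t)

/-- The value of a letter. -/
noncomputable def val (l : Letter) (z : ℝ) (m : ℕ) : ℝ := l.xp m + l.yp (m + z)

/-- The letters that may occur at the end of a word. -/
def Top : Letter → Prop
  | X a => 1 ≤ a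
  | Y b => 1 ≤ b
  | D => True

/-- The letters that may occur in the interior of a word. -/
def Inner : Letter → Prop
  | D => False
  | _ => True

end Letter

open Letter

theorem one_div_pow_le {t : ℝ} (ht : 1 ≤ t) {a b : ℕ} (h : b ≤ a) : 1 / t ^ a ≤ 1 / t ^ b :=
  one_div_le_one_div_of_le (by positivity) (pow_le_pow_right₀ ht h)

theorem abs_xp_le (l : Letter) {m : ℕ} (hm : 1 ≤ m) : |l.xp m| ≤ 1 / m := by
  have hm1 : (1 : ℝ) ≤ m := by exact_mod_cast hm
  cases l with
  | X a =>
    simp only [xp]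
    rw [abs_of_nonneg (by positivity)]
    simpa using one_div_pow_le hm1 (show 1 ≤ a + 1 by omega)
  | Y b => simp [xp]
  | D => simp only [xp]; rw [abs_of_nonneg (by positivity)]

theorem abs_yp_le (l : Letter) {t : ℝ} (ht : 1 ≤ t) : |l.yp t| ≤ 1 / t := by
  cases l with
  | X a => simp only [yp, abs_zero]; positivity
  | Y b =>
    simp only [yp]
    rw [abs_of_nonneg (by positivity)]
    simpa using one_div_pow_le ht (show 1 ≤ b + 1 by omega)
  | D => simp only [yp]; rw [abs_neg, abs_of_nonneg (by positivity)]

theorem abs_yp_le' (l : Letter) {z : ℝ} (hz : 0 < z) {m : ℕ} (hm : 1 ≤ m) :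
    |l.yp (m + z)| ≤ 1 / m := by
  have hm1 : (1 : ℝ) ≤ m := by exact_mod_cast hm
  refine (abs_yp_le l (by linarith)).trans ?_
  exact one_div_le_one_div_of_le (by positivity) (by linarith)

theorem abs_val_le_of_inner {l : Letter} (hl : l.Inner) {z : ℝ} (hz : 0 < z) {m : ℕ}
    (hm : 1 ≤ m) : |l.val z m| ≤ 1 * (1 / m) := by
  rw [one_mul]
  cases l with
  | X a => simpa [val, yp] using abs_xp_le (X a) hm
  | Y b => simpa [val, xp] using abs_yp_le' (Y b) hz hm
  | D => exact hl.elim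

theorem sqrt_le_self_of_one_le {m : ℕ} (hm : 1 ≤ m) : √(m : ℝ) ≤ m := by
  have hm1 : (1 : ℝ) ≤ m := by exact_mod_cast hm
  exact Real.sqrt_le_iff.2 ⟨by positivity, by nlinarith⟩

theorem one_div_sq_le {m : ℕ} (hm : 1 ≤ m) : 1 / (m : ℝ) ^ 2 ≤ 1 / (m * √(m : ℝ)) := by
  have hm1 : (0 : ℝ) < m := by exact_mod_cast hm
  have := Real.sqrt_pos.2 hm1
  refine one_div_le_one_div_of_le (by positivity) ?_
  rw [sq]
  exact mul_le_mul_of_nonneg_left (sqrt_le_self_of_one_le hm) hm1.le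

theorem sqrt_mul_sqrt_le_add {x z : ℝ} (hx : 0 ≤ x) (hz : 0 ≤ z) : √z * √x ≤ x + z := by
  nlinarith [Real.sq_sqrt hx, Real.sq_sqrt hz, sq_nonneg (√z - √x), Real.sqrt_nonneg x,
    Real.sqrt_nonneg z]

/-- The critical letter is D = z/(m(m + z)), where m + z ≥ √z √m. The explicit √z is what keeps
later bounds usable as z → ∞. -/
theorem abs_val_le_of_top {l : Letter} (hl : l.Top) {z : ℝ} (hz : 0 < z) {m : ℕ}
    (hm : 1 ≤ m) : |l.val z m| ≤ (1 + √z) * (1 / (m * √(m : ℝ))) := by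
  have hm1 : (1 : ℝ) ≤ m := by exact_mod_cast hm
  have hs := Real.sqrt_pos.2 hz
  have hs' := Real.sqrt_pos.2 (show (0 : ℝ) < m by linarith)
  have key : 1 / (m : ℝ) ^ 2 ≤ (1 + √z) * (1 / (m * √(m : ℝ))) := by
    refine (one_div_sq_le hm).trans (le_mul_of_one_le_left (by positivity) (by linarith))
  cases l with
  | X a =>
    refine le_trans ?_ key
    simp only [val, xp, yp, add_zero]
    rw [abs_of_nonneg (by positivity)]
    exact one_div_pow_le hm1 (by have : 1 ≤ a := hl; omega)
  | Y b =>
    refine le_trans ?_ key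
    simp only [val, xp, yp, zero_add]
    rw [abs_of_nonneg (by positivity)]
    refine (one_div_pow_le (by linarith) (show 2 ≤ b + 1 by have : 1 ≤ b := hl; omega)).trans ?_
    exact one_div_le_one_div_of_le (by positivity) (by nlinarith)
  | D =>
    simp only [val, xp, yp]
    have e : (1 / m + -(1 / (m + z)) : ℝ) = z / (m * (m + z)) := by field_simp; ring
    rw [e, abs_of_nonneg (by positivity)]
    have h1 := sqrt_mul_sqrt_le_add (show (0 : ℝ) ≤ m by linarith) hz.le
    rw [mul_one_div, div_le_div_iff₀ (by positivity) (by positivity)]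
    have h2 : z = √z * √z := (Real.mul_self_sqrt hz.le).symm
    have h3 : z * √(m : ℝ) ≤ √z * (m + z) := by
      calc z * √(m : ℝ) = √z * (√z * √(m : ℝ)) := by rw [← mul_assoc, ← h2]
        _ ≤ _ := mul_le_mul_of_nonneg_left h1 hs.le
    have h4 : 0 ≤ m * (m + z) := by positivity
    nlinarith

/-- The words with convergent nested sums. -/
def Good : List Letter → Prop
  | [] => False
  | [l] => l.Top
  | l :: l' :: w => l.Inner ∧ Good (l' :: w)

/-- The sum over `n < n_1 < n_2 < ⋯` of the product of the letters, to which the sums are added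
in which adjacent letters `l, l'` are merged to the letter `μ l l'`. -/
noncomputable def nestedSum (μ : Letter → Letter → ℝ → ℕ → ℝ) : List Letter → ℝ → ℕ → ℝ
  | [], _, _ => 1
  | [l], z, n => tailSum (l.val z) n
  | l :: l' :: w, z, n =>
    tailSum (fun m => l.val z m * nestedSum μ (l' :: w) z m + μ l l' z m * nestedSum μ w z m) n

/-- The mergers are of the order of `1 / m ^ 2`. -/
def MergeBound (μ : Letter → Letter → ℝ → ℕ → ℝ) : Prop :=
  ∀ l l' z m, 0 < z → 1 ≤ m → |μ l l' z m| ≤ 1 / (m : ℝ) ^ 2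

theorem MergeBound.le {μ : Letter → Letter → ℝ → ℕ → ℝ} (hμ : MergeBound μ) (l l' : Letter)
    {z : ℝ} (hz : 0 < z) {m : ℕ} (hm : 1 ≤ m) : |μ l l' z m| ≤ 1 * (1 / m) := by
  have hm1 : (1 : ℝ) ≤ m := by exact_mod_cast hm
  refine (hμ l l' z m hz hm).trans ?_
  simpa using one_div_pow_le hm1 (show 1 ≤ 2 by norm_num)

theorem nestedSum_bound_aux {μ : Letter → Letter → ℝ → ℕ → ℝ} (hμ : MergeBound μ) {z : ℝ}
    (hz : 0 < z) (N : ℕ) : ∀ w : List Letter, w.length ≤ N → Good w →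
      ∃ C, 0 ≤ C ∧ TailBound C (nestedSum μ w z) := by
  induction N with
  | zero =>
    intro w hw hg
    rw [List.length_eq_zero_iff.1 (Nat.le_zero.1 hw)] at hg
    exact hg.elim
  | succ N ih =>
    intro w hw hg
    match w, hw, hg with
    | [l], _, hg =>
      have hs := Real.sqrt_nonneg z
      exact ⟨4 * (1 + √z), by positivity, SummandBound.tailBound
        (fun m hm => abs_val_le_of_top hg hz hm) (by positivity)⟩
    | l :: l' :: w, hw, hg =>
      obtain ⟨C, hC, hb⟩ := ih (l' :: w) (by simp at hw ⊢; omega) hg.2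
      have h1 := hb.mul hC zero_le_one fun m hm => abs_val_le_of_inner hg.1 hz hm
      have h2 : ∃ C', 0 ≤ C' ∧ SummandBound C' fun m => μ l l' z m * nestedSum μ w z m := by
        rcases w with _ | ⟨l'', w⟩
        · refine ⟨1, zero_le_one, fun m hm => ?_⟩
          simpa [nestedSum] using (hμ l l' z m hz hm).trans (one_div_sq_le hm)
        · obtain ⟨C', hC', hb'⟩ := ih (l'' :: w) (by simp at hw ⊢; omega) hg.2.2
          exact ⟨_, by positivity, hb'.mul hC' zero_le_one fun m hm => hμ.le l l' hz hm⟩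
      obtain ⟨C', hC', h2⟩ := h2
      refine ⟨4 * (1 * C + C'), by positivity, SummandBound.tailBound (fun m hm => ?_) (by positivity)⟩
      refine (abs_add_le _ _).trans ?_
      rw [add_mul]
      exact add_le_add (h1 m hm) (h2 m hm)

theorem nestedSum_bound {μ : Letter → Letter → ℝ → ℕ → ℝ} (hμ : MergeBound μ) {z : ℝ}
    (hz : 0 < z) {w : List Letter} (hg : Good w) :
    ∃ C, 0 ≤ C ∧ TailBound C (nestedSum μ w z) :=
  nestedSum_bound_aux hμ hz w.length w le_rfl hg

theorem summandBound_head {μ : Letter → Letter → ℝ → ℕ → ℝ} (hμ : MergeBound μ) {z : ℝ}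
    (hz : 0 < z) {l l' : Letter} {w : List Letter} (hg : Good (l :: l' :: w)) :
    ∃ C, 0 ≤ C ∧ SummandBound C fun m => l.val z m * nestedSum μ (l' :: w) z m := by
  obtain ⟨C, hC, hb⟩ := nestedSum_bound hμ hz hg.2
  exact ⟨_, by positivity, hb.mul hC zero_le_one fun m hm => abs_val_le_of_inner hg.1 hz hm⟩

theorem summandBound_merge {μ : Letter → Letter → ℝ → ℕ → ℝ} (hμ : MergeBound μ) {z : ℝ}
    (hz : 0 < z) {l l' : Letter} {w : List Letter} (hg : Good (l :: l' :: w)) :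
    ∃ C, 0 ≤ C ∧ SummandBound C fun m => μ l l' z m * nestedSum μ w z m := by
  rcases w with _ | ⟨l'', w⟩
  · refine ⟨1, zero_le_one, fun m hm => ?_⟩
    simpa [nestedSum] using (hμ l l' z m hz hm).trans (one_div_sq_le hm)
  · obtain ⟨C', hC', hb'⟩ := nestedSum_bound hμ hz hg.2.2
    exact ⟨_, by positivity, hb'.mul hC' zero_le_one fun m hm => hμ.le l l' hz hm⟩

theorem nestedSum_eq {μ : Letter → Letter → ℝ → ℕ → ℝ} (hμ : MergeBound μ) {z : ℝ}
    (hz : 0 < z) {l l' : Letter} {w : List Letter} (hg : Good (l :: l' :: w)) (n : ℕ) :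
    nestedSum μ (l :: l' :: w) z n =
      tailSum (fun m => l.val z m * nestedSum μ (l' :: w) z m) n +
        tailSum (fun m => μ l l' z m * nestedSum μ w z m) n := by
  obtain ⟨C, hC, h⟩ := summandBound_head hμ hz hg
  obtain ⟨C', hC', h'⟩ := summandBound_merge hμ hz hg
  rw [nestedSum, tailSum_add h hC h' hC']

theorem nestedSum_succ {μ : Letter → Letter → ℝ → ℕ → ℝ} (hμ : MergeBound μ) {z : ℝ}
    (hz : 0 < z) {l l' : Letter} {w : List Letter} (hg : Good (l :: l' :: w)) (n : ℕ) :
    nestedSum μ (l :: l' :: w) z n =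
      l.val z (n + 1) * nestedSum μ (l' :: w) z (n + 1) +
        μ l l' z (n + 1) * nestedSum μ w z (n + 1) + nestedSum μ (l :: l' :: w) z (n + 1) := by
  obtain ⟨C, hC, h⟩ := summandBound_head hμ hz hg
  obtain ⟨C', hC', h'⟩ := summandBound_merge hμ hz hg
  rw [nestedSum_eq hμ hz hg, nestedSum_eq hμ hz hg, h.tailSum_succ hC, h'.tailSum_succ hC']
  ring

theorem nestedSum_singleton_succ {μ : Letter → Letter → ℝ → ℕ → ℝ} {z : ℝ}
    (hz : 0 < z) {l : Letter} (hg : Good [l]) (n : ℕ) :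
    nestedSum μ [l] z n = l.val z (n + 1) + nestedSum μ [l] z (n + 1) := by
  have hs := Real.sqrt_nonneg z
  rw [nestedSum, nestedSum]
  exact SummandBound.tailSum_succ (C := 1 + √z)
    (fun m hm => abs_val_le_of_top hg hz hm) (by positivity) n

/-! ### The shift z ↦ z + 1 -/

/-- Merging a part `x` and a subsequent part `y`. -/
noncomputable def mergeXY (l l' : Letter) (z : ℝ) (m : ℕ) : ℝ := l.xp m * l'.yp (m + z)

/-- Merging a part `y` and a subsequent part `x`. -/
noncomputable def mergeYX (l l' : Letter) (z : ℝ) (m : ℕ) : ℝ := l.yp (m + z) * l'.xp m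

theorem mergeBound_mergeXY : MergeBound mergeXY := by
  intro l l' z m hz hm
  rw [mergeXY, abs_mul, sq, ← one_div_mul_one_div]
  exact mul_le_mul (abs_xp_le l hm) (abs_yp_le' l' hz hm) (abs_nonneg _) (by positivity)

theorem mergeBound_mergeYX : MergeBound mergeYX := by
  intro l l' z m hz hm
  rw [mergeYX, abs_mul, sq, ← one_div_mul_one_div]
  exact mul_le_mul (abs_yp_le' l hz hm) (abs_xp_le l' hm) (abs_nonneg _) (by positivity)

/-- Identities between nested sums are proved by applying this to the difference E(n) of their two
sides: equal increments in the lower limit n, and both sides vanish as n → ∞. -/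
theorem eq_zero_of_succ_eq {E : ℕ → ℝ} (h : ∀ n, E n = E (n + 1))
    (h0 : Filter.Tendsto E Filter.atTop (nhds 0)) (n : ℕ) : E n = 0 := by
  have hc : ∀ n, E n = E 0 := fun n => by
    induction n with
    | zero => rfl
    | succ n ih => rw [← h, ih]
  have h1 : Filter.Tendsto E Filter.atTop (nhds (E 0)) := by
    rw [show E = fun _ => E 0 from funext hc]
    exact tendsto_const_nhds
  rw [hc, tendsto_nhds_unique h1 h0]

theorem nestedSum_tendsto {μ : Letter → Letter → ℝ → ℕ → ℝ} (hμ : MergeBound μ) {z : ℝ}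
    (hz : 0 < z) {w : List Letter} (hg : Good w) :
    Filter.Tendsto (nestedSum μ w z) Filter.atTop (nhds 0) := by
  obtain ⟨C, -, h⟩ := nestedSum_bound hμ hz hg
  exact h.tendsto

theorem yp_tendsto (l : Letter) (z : ℝ) (hz : 0 < z) :
    Filter.Tendsto (fun n : ℕ => l.yp ((n + 1 : ℕ) + z)) Filter.atTop (nhds 0) := by
  have h : Filter.Tendsto (fun n : ℕ => 1 / ((n + 1 : ℕ) : ℝ)) Filter.atTop (nhds 0) :=
    Filter.Tendsto.div_atTop tendsto_const_nhds
      (tendsto_natCast_atTop_atTop.comp (Filter.tendsto_add_atTop_nat 1))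
  exact squeeze_zero_norm (fun n => abs_yp_le' l hz (by omega)) h

/-- The relation between the two kinds of nested sums under the shift `z ↦ z + 1`: the sums over
`X_1, Y_1, X_2, Y_2, …` at `z + 1` differ from those over `Y_1, X_1, Y_2, X_2, …` at `z` by the
contribution of the first `Y`. -/
theorem nestedSum_shift_aux {z : ℝ} (hz : 0 < z) (N : ℕ) : ∀ (l : Letter) (w : List Letter),
    w.length ≤ N → Good (l :: w) → ∀ n : ℕ,
    nestedSum mergeYX (l :: w) z n = nestedSum mergeXY (l :: w) (z + 1) n +
      l.yp ((n + 1 : ℕ) + z) * nestedSum mergeXY w (z + 1) n := by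
  have hz1 : 0 < z + 1 := by linarith
  have hcast : ∀ n : ℕ, (n : ℝ) + (z + 1) = ((n + 1 : ℕ) : ℝ) + z := fun n => by
    push_cast; ring
  have hX := mergeBound_mergeXY
  have hY := mergeBound_mergeYX
  induction N with
  | zero =>
    intro l w hw hg n
    obtain rfl := List.length_eq_zero_iff.1 (Nat.le_zero.1 hw)
    refine sub_eq_zero.1 (eq_zero_of_succ_eq (E := fun n => nestedSum mergeYX [l] z n -
      (nestedSum mergeXY [l] (z + 1) n + l.yp ((n + 1 : ℕ) + z) * nestedSum mergeXY [] (z + 1) n))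
      (fun n => ?_) ?_ n)
    · rw [nestedSum_singleton_succ hz hg n, nestedSum_singleton_succ hz1 hg n]
      simp only [val, hcast, nestedSum]
      ring
    · have h1 := nestedSum_tendsto hY hz hg
      have h2 := nestedSum_tendsto hX hz1 hg
      have h3 := yp_tendsto l z hz
      simpa [nestedSum] using h1.sub (h2.add h3)
  | succ N ih =>
    intro l w hw hg n
    rcases w with _ | ⟨l', w⟩
    · exact ih l [] (by simp) hg n
    have ih' := ih l' w (by simpa using hw) hg.2
    refine sub_eq_zero.1 (eq_zero_of_succ_eq (E := fun n => nestedSum mergeYX (l :: l' :: w) z n -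
      (nestedSum mergeXY (l :: l' :: w) (z + 1) n +
        l.yp ((n + 1 : ℕ) + z) * nestedSum mergeXY (l' :: w) (z + 1) n))
      (fun n => ?_) ?_ n)
    -- At z + 1 the order is X_{n+1}, Y_{n+1}, X_{n+2}, …: either the first X is unused or it takes
    -- `l'`. After it, Y_{n+1} at z + 1 has the argument of Y_{n+2} at z, so what remains is a sum
    -- in the order Y, X at z.
    · have key : nestedSum mergeXY (l' :: w) (z + 1) n =
          nestedSum mergeYX (l' :: w) z (n + 1) +
            l'.xp (n + 1) * nestedSum mergeYX w z (n + 1) := by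
        have i1 := ih' (n + 1)
        rcases w with _ | ⟨l'', w⟩
        · rw [nestedSum_singleton_succ hz1 hg.2 n, i1]
          simp only [val, hcast, nestedSum]
          ring
        · have i2 := ih l'' w (by simp at hw ⊢; omega) hg.2.2 (n + 1)
          rw [nestedSum_succ hX hz1 hg.2 n, i1, i2]
          simp only [val, hcast, mergeXY]
          ring
      rw [nestedSum_succ hY hz hg n, nestedSum_succ hX hz1 hg n, key]
      have i1 := ih' (n + 1)
      simp only [val, hcast, mergeXY, mergeYX] at i1 ⊢
      rw [i1]
      ring
    · have h1 := nestedSum_tendsto hY hz hg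
      have h2 := nestedSum_tendsto hX hz1 hg
      have h3 := nestedSum_tendsto hX hz1 hg.2
      simpa [nestedSum] using h1.sub (h2.add ((yp_tendsto l z hz).mul h3))

theorem nestedSum_shift {z : ℝ} (hz : 0 < z) {l : Letter} {w : List Letter} (hg : Good (l :: w))
    (n : ℕ) :
    nestedSum mergeYX (l :: w) z n = nestedSum mergeXY (l :: w) (z + 1) n +
      l.yp ((n + 1 : ℕ) + z) * nestedSum mergeXY w (z + 1) n :=
  nestedSum_shift_aux hz w.length l w le_rfl hg n

end Ohno

/-! ### Reduction to words with coefficients in 1 / z -/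

namespace Ohno

open Letter

/-- No mergers. -/
def noMerge (_ _ : Letter) (_ : ℝ) (_ : ℕ) : ℝ := 0

theorem mergeBound_noMerge : MergeBound noMerge := by
  intro l l' z m hz hm
  simp only [noMerge, abs_zero]
  positivity

/-- The nested sum of a word. -/
noncomputable def plainSum (w : List Letter) : ℝ → ℕ → ℝ := nestedSum noMerge w

theorem plainSum_cons {l l' : Letter} {w : List Letter} (z : ℝ) (n : ℕ) :
    plainSum (l :: l' :: w) z n = tailSum (fun m => l.val z m * plainSum (l' :: w) z m) n := by
  simp [plainSum, nestedSum, noMerge]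

/-- The combinations of nested sums of words of length at most `N`, with coefficients that are
polynomials in `1 / z`. -/
inductive Comb (N : ℕ) : (ℝ → ℕ → ℝ) → Prop
  | word (w : List Letter) (hg : Good w) (hw : w.length ≤ N) : Comb N (plainSum w)
  | zero : Comb N fun _ _ => 0
  | add {φ ψ : ℝ → ℕ → ℝ} (hφ : Comb N φ) (hψ : Comb N ψ) : Comb N fun z n => φ z n + ψ z n
  | smul (c : ℝ) {φ : ℝ → ℕ → ℝ} (hφ : Comb N φ) : Comb N fun z n => c * φ z n
  | div {φ : ℝ → ℕ → ℝ} (hφ : Comb N φ) : Comb N fun z n => φ z n / z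
  | congr {φ ψ : ℝ → ℕ → ℝ} (hφ : Comb N φ) (h : ∀ z, 0 < z → ∀ n, ψ z n = φ z n) : Comb N ψ

/-- The combinations all of whose coefficients are divisible by `1 / z`. -/
def DivComb (N : ℕ) (φ : ℝ → ℕ → ℝ) : Prop :=
  ∃ ψ, Comb N ψ ∧ ∀ z, 0 < z → ∀ n, φ z n = ψ z n / z

theorem Comb.mono {N M : ℕ} (h : N ≤ M) {φ : ℝ → ℕ → ℝ} (hφ : Comb N φ) : Comb M φ := by
  induction hφ with
  | word w hg hw => exact .word w hg (hw.trans h)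
  | zero => exact .zero
  | add _ _ i1 i2 => exact i1.add i2
  | smul c _ i => exact i.smul c
  | div _ i => exact i.div
  | congr _ h i => exact i.congr h

theorem Comb.sub {N : ℕ} {φ ψ : ℝ → ℕ → ℝ} (hφ : Comb N φ) (hψ : Comb N ψ) :
    Comb N fun z n => φ z n - ψ z n :=
  (hφ.add (hψ.smul (-1))).congr fun z _ n => by ring

theorem DivComb.comb {N : ℕ} {φ : ℝ → ℕ → ℝ} (hφ : DivComb N φ) : Comb N φ := by
  obtain ⟨ψ, hψ, h⟩ := hφ
  exact hψ.div.congr h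

theorem DivComb.mono {N M : ℕ} (h : N ≤ M) {φ : ℝ → ℕ → ℝ} (hφ : DivComb N φ) : DivComb M φ := by
  obtain ⟨ψ, hψ, e⟩ := hφ
  exact ⟨ψ, hψ.mono h, e⟩

theorem DivComb.zero (N : ℕ) : DivComb N fun _ _ => 0 :=
  ⟨_, .zero, fun z _ n => by simp⟩

theorem DivComb.add {N : ℕ} {φ ψ : ℝ → ℕ → ℝ} (hφ : DivComb N φ) (hψ : DivComb N ψ) :
    DivComb N fun z n => φ z n + ψ z n := by
  obtain ⟨φ', hφ, e⟩ := hφ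
  obtain ⟨ψ', hψ, e'⟩ := hψ
  exact ⟨_, hφ.add hψ, fun z hz n => by simp only [e z hz, e' z hz]; ring⟩

theorem DivComb.congr {N : ℕ} {φ ψ : ℝ → ℕ → ℝ} (hφ : DivComb N φ)
    (h : ∀ z, 0 < z → ∀ n, ψ z n = φ z n) : DivComb N ψ := by
  obtain ⟨φ', hφ, e⟩ := hφ
  exact ⟨φ', hφ, fun z hz n => by rw [h z hz, e z hz]⟩

theorem Comb.bound {N : ℕ} {φ : ℝ → ℕ → ℝ} (hφ : Comb N φ) {z : ℝ} (hz : 0 < z) :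
    ∃ C, 0 ≤ C ∧ TailBound C (φ z) := by
  induction hφ with
  | word w hg hw => exact nestedSum_bound mergeBound_noMerge hz hg
  | zero => exact ⟨0, le_rfl, fun n => by simp⟩
  | add _ _ i1 i2 =>
    obtain ⟨C, hC, h⟩ := i1
    obtain ⟨C', hC', h'⟩ := i2
    refine ⟨C + C', by positivity, fun n => (abs_add_le _ _).trans ?_⟩
    rw [add_mul]
    exact add_le_add (h n) (h' n)
  | smul c _ i =>
    obtain ⟨C, hC, h⟩ := i
    refine ⟨|c| * C, by positivity, fun n => ?_⟩
    rw [abs_mul, mul_assoc]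
    exact mul_le_mul_of_nonneg_left (h n) (abs_nonneg _)
  | div _ i =>
    obtain ⟨C, hC, h⟩ := i
    refine ⟨C / z, by positivity, fun n => ?_⟩
    rw [abs_div, abs_of_pos hz, div_mul_eq_mul_div]
    exact div_le_div_of_nonneg_right (h n) hz.le
  | congr _ h i =>
    obtain ⟨C, hC, h'⟩ := i
    exact ⟨C, hC, fun n => by rw [h z hz]; exact h' n⟩

theorem Comb.summandBound {N : ℕ} {φ : ℝ → ℕ → ℝ} (hφ : Comb N φ) {z : ℝ} (hz : 0 < z)
    {v : ℕ → ℝ} (hv : ∀ m : ℕ, 1 ≤ m → |v m| ≤ 1 * (1 / m)) :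
    ∃ C, 0 ≤ C ∧ SummandBound C fun m => v m * φ z m := by
  obtain ⟨C, hC, h⟩ := hφ.bound hz
  exact ⟨1 * C, by positivity, h.mul hC zero_le_one hv⟩

/-- A linear operation that is compatible with words is compatible with combinations. -/
theorem Comb.step {N : ℕ} {φ : ℝ → ℕ → ℝ} (hφ : Comb N φ) {l : Letter} (hl : l.Inner) :
    Comb (N + 1) fun z n => tailSum (fun m => l.val z m * φ z m) n := by
  induction hφ with
  | word w hg hw =>
    rcases w with _ | ⟨l', w⟩
    · exact hg.elim
    · exact (Comb.word (l :: l' :: w) ⟨hl, hg⟩ (by simpa using hw)).congr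
        fun z _ n => (plainSum_cons z n).symm
  | zero => exact Comb.zero.congr fun z _ n => by simp [tailSum]
  | add h1 h2 i1 i2 =>
    refine (i1.add i2).congr fun z hz n => ?_
    obtain ⟨C, hC, h⟩ := h1.summandBound hz fun m hm => abs_val_le_of_inner hl hz hm
    obtain ⟨C', hC', h'⟩ := h2.summandBound hz fun m hm => abs_val_le_of_inner hl hz hm
    rw [← tailSum_add h hC h' hC']
    exact tailSum_congr (fun m _ => by ring) n
  | smul c _ i =>
    refine (i.smul c).congr fun z hz n => ?_
    rw [← tailSum_const_mul]
    exact tailSum_congr (fun m _ => by ring) n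
  | div _ i =>
    refine i.div.congr fun z hz n => ?_
    rw [div_eq_inv_mul, ← tailSum_const_mul]
    exact tailSum_congr (fun m _ => by ring) n
  | congr _ h i =>
    refine i.congr fun z hz n => ?_
    exact tailSum_congr (fun m _ => by rw [h z hz]) n

theorem DivComb.step {N : ℕ} {φ : ℝ → ℕ → ℝ} (hφ : DivComb N φ) {l : Letter} (hl : l.Inner) :
    DivComb (N + 1) fun z n => tailSum (fun m => l.val z m * φ z m) n := by
  obtain ⟨ψ, hψ, h⟩ := hφ
  refine ⟨_, hψ.step hl, fun z hz n => ?_⟩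
  rw [div_eq_inv_mul, ← tailSum_const_mul]
  exact tailSum_congr (fun m _ => by rw [h z hz]; ring) n

/-- The mixed letter `1 / (m ^ a (m + z) ^ b)`. -/
noncomputable def mixed (a b : ℕ) (z : ℝ) (m : ℕ) : ℝ := 1 / ((m : ℝ) ^ a * (m + z) ^ b)

/-- This is 1/(m(m + z)) = (1/m - 1/(m + z))/z. Each use separates the two kinds of factors and
gains 1/z. -/
theorem mixed_succ_succ (a b : ℕ) {z : ℝ} (hz : 0 < z) {m : ℕ} (hm : 1 ≤ m) :
    mixed (a + 1) (b + 1) z m = z⁻¹ * (mixed (a + 1) b z m - mixed a (b + 1) z m) := by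
  have hm1 : (0 : ℝ) < m := by exact_mod_cast hm
  unfold mixed
  field_simp
  ring

theorem abs_mixed_le {a b : ℕ} {z : ℝ} (hz : 0 < z) {m : ℕ} (hm : 1 ≤ m) (c : ℕ)
    (hab : c ≤ a + b) : |mixed a b z m| ≤ 1 / (m : ℝ) ^ c := by
  have hm1 : (1 : ℝ) ≤ m := by exact_mod_cast hm
  unfold mixed
  rw [abs_of_nonneg (by positivity)]
  refine one_div_le_one_div_of_le (by positivity) ?_
  calc (m : ℝ) ^ c ≤ (m : ℝ) ^ (a + b) := pow_le_pow_right₀ hm1 hab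
    _ = (m : ℝ) ^ a * (m : ℝ) ^ b := pow_add _ _ _
    _ ≤ _ := mul_le_mul_of_nonneg_left (pow_le_pow_left₀ (by positivity) (by linarith) _)
      (by positivity)

theorem Comb.tailSum_mixed_sub {N : ℕ} {φ : ℝ → ℕ → ℝ} (hφ : Comb N φ) (a b : ℕ)
    {z : ℝ} (hz : 0 < z) (n : ℕ) :
    tailSum (fun m => mixed (a + 1) (b + 1) z m * φ z m) n =
      (tailSum (fun m => mixed (a + 1) b z m * φ z m) n -
        tailSum (fun m => mixed a (b + 1) z m * φ z m) n) / z := by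
  obtain ⟨C, hC, h⟩ := hφ.summandBound (v := mixed (a + 1) b z) hz fun m hm => by
    simpa using abs_mixed_le hz hm 1 (by omega)
  obtain ⟨C', hC', h'⟩ := hφ.summandBound (v := mixed a (b + 1) z) hz fun m hm => by
    simpa using abs_mixed_le hz hm 1 (by omega)
  rw [← tailSum_sub h hC h' hC', div_eq_inv_mul, ← tailSum_const_mul]
  exact tailSum_congr (fun m hm => by rw [mixed_succ_succ a b hz hm]; ring) n

/-- Repeated partial fractions lower a + b until one exponent is 0, when the letter is pure and
`Comb.step` applies. -/
theorem Comb.mixed {N : ℕ} {φ : ℝ → ℕ → ℝ} (hφ : Comb N φ) (c : ℕ) : ∀ a b : ℕ, a + b = c + 1 →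
    Comb (N + 1) fun z n => tailSum (fun m => mixed a b z m * φ z m) n := by
  induction c with
  | zero =>
    intro a b hab
    rcases Nat.eq_zero_or_pos a with ha | ha
    · obtain rfl : a = 0 := ha
      obtain rfl : b = 1 := by omega
      refine (hφ.step (l := .Y 0) trivial).congr fun z _ n => ?_
      exact tailSum_congr (fun m _ => by simp [Ohno.mixed, val, xp, yp]) n
    · obtain rfl : a = 1 := by omega
      obtain rfl : b = 0 := by omega
      refine (hφ.step (l := .X 0) trivial).congr fun z _ n => ?_
      exact tailSum_congr (fun m _ => by simp [Ohno.mixed, val, xp, yp]) n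
  | succ c ih =>
    intro a b hab
    match a, b, hab with
    | 0, b + 1, _ =>
      refine (hφ.step (l := .Y b) trivial).congr fun z _ n => ?_
      exact tailSum_congr (fun m _ => by simp [Ohno.mixed, val, xp, yp]) n
    | a + 1, 0, _ =>
      refine (hφ.step (l := .X a) trivial).congr fun z _ n => ?_
      exact tailSum_congr (fun m _ => by simp [Ohno.mixed, val, xp, yp]) n
    | a + 1, b + 1, hab =>
      exact (((ih (a + 1) b (by omega)).sub (ih a (b + 1) (by omega))).div).congr
        fun z hz n => hφ.tailSum_mixed_sub a b hz n

theorem Comb.divComb_mixed {N : ℕ} {φ : ℝ → ℕ → ℝ} (hφ : Comb N φ) (a b : ℕ) :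
    DivComb (N + 1) fun z n => tailSum (fun m => Ohno.mixed (a + 1) (b + 1) z m * φ z m) n :=
  ⟨_, (hφ.mixed (a + b) (a + 1) b (by omega)).sub (hφ.mixed (a + b) a (b + 1) (by omega)),
    fun _ hz n => hφ.tailSum_mixed_sub a b hz n⟩

theorem summandBound_mixed {a b : ℕ} (hab : 2 ≤ a + b) {z : ℝ} (hz : 0 < z) :
    SummandBound 1 (mixed a b z) := fun m hm => by
  rw [one_mul]
  exact (abs_mixed_le hz hm 2 hab).trans (one_div_sq_le hm)

theorem tailSum_mixed_top {a b : ℕ} (hab : 1 ≤ a + b) {z : ℝ} (hz : 0 < z) (n : ℕ) :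
    tailSum (mixed (a + 1) (b + 1) z) n =
      (tailSum (mixed (a + 1) b z) n - tailSum (mixed a (b + 1) z) n) / z := by
  rw [← tailSum_sub (summandBound_mixed (by omega) hz) zero_le_one
    (summandBound_mixed (by omega) hz) zero_le_one, div_eq_inv_mul, ← tailSum_const_mul]
  exact tailSum_congr (fun m hm => mixed_succ_succ a b hz hm) n

theorem comb_singleton {l : Letter} (hl : l.Top) : Comb 1 fun z n => tailSum (l.val z) n :=
  (Comb.word [l] hl le_rfl).congr fun _ _ _ => rfl

/-- In last position 1/m and 1/(m + z) are not summable separately; their difference has to be kept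
together, which is the purpose of the letter `D`. -/
theorem tailSum_mixed_one {z : ℝ} (hz : 0 < z) (n : ℕ) :
    tailSum (mixed 1 1 z) n = tailSum (D.val z) n / z := by
  rw [div_eq_inv_mul, ← tailSum_const_mul]
  refine tailSum_congr (fun m hm => ?_) n
  have hm1 : (0 : ℝ) < m := by exact_mod_cast hm
  simp only [mixed, val, xp, yp]
  field_simp
  ring

theorem comb_mixed_top (c : ℕ) : ∀ a b : ℕ, a + b = c + 2 →
    Comb 1 fun z n => tailSum (mixed a b z) n := by
  have h0 : ∀ b, Comb 1 fun z n => tailSum (mixed 0 (b + 2) z) n := fun b => by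
    refine (comb_singleton (l := .Y (b + 1)) (by simp [Letter.Top])).congr fun z _ n => ?_
    exact tailSum_congr (fun m _ => by simp [mixed, val, xp, yp]) n
  have h1 : ∀ a, Comb 1 fun z n => tailSum (mixed (a + 2) 0 z) n := fun a => by
    refine (comb_singleton (l := .X (a + 1)) (by simp [Letter.Top])).congr fun z _ n => ?_
    exact tailSum_congr (fun m _ => by simp [mixed, val, xp, yp]) n
  induction c with
  | zero =>
    intro a b hab
    obtain ⟨rfl, rfl⟩ | ⟨rfl, rfl⟩ | ⟨rfl, rfl⟩ :
        (a = 0 ∧ b = 2) ∨ (a = 1 ∧ b = 1) ∨ (a = 2 ∧ b = 0) := by omega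
    · exact h0 0
    · exact (comb_singleton (l := .D) trivial).div.congr fun z hz n => tailSum_mixed_one hz n
    · exact h1 0
  | succ c ih =>
    intro a b hab
    match a, b, hab with
    | 0, b + 2, _ => exact h0 b
    | a + 2, 0, _ => exact h1 a
    | a + 1, b + 1, hab =>
      exact (((ih (a + 1) b (by omega)).sub (ih a (b + 1) (by omega))).div).congr
        fun z hz n => tailSum_mixed_top (by omega) hz n

theorem divComb_mixed_top (a b : ℕ) : DivComb 1 fun z n => tailSum (mixed (a + 1) (b + 1) z) n := by
  rcases Nat.eq_zero_or_pos (a + b) with h | h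
  · obtain rfl : a = 0 := by omega
    obtain rfl : b = 0 := by omega
    exact ⟨_, comb_singleton (l := .D) trivial, fun z hz n => tailSum_mixed_one hz n⟩
  · exact ⟨_, (comb_mixed_top (a + b - 1) (a + 1) b (by omega)).sub
      (comb_mixed_top (a + b - 1) a (b + 1) (by omega)),
      fun z hz n => tailSum_mixed_top (by omega) hz n⟩

/-- The mergers are mixed letters. -/
def MergeMixed (μ : Letter → Letter → ℝ → ℕ → ℝ) : Prop :=
  ∀ l l', l.Inner → ∃ (c : ℝ) (a b : ℕ), ∀ z m, μ l l' z m = c * mixed (a + 1) (b + 1) z m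

theorem mergeMixed_mergeXY : MergeMixed mergeXY := by
  intro l l' hl
  cases l with
  | X a =>
    cases l' with
    | X b => exact ⟨0, 0, 0, fun z m => by simp [mergeXY, yp]⟩
    | Y b =>
      exact ⟨1, a, b, fun z m => by
        simp only [mergeXY, xp, yp, mixed, ← one_div_mul_one_div]
        ring⟩
    | D =>
      exact ⟨-1, a, 0, fun z m => by
        simp only [mergeXY, xp, yp, mixed, ← one_div_mul_one_div, zero_add, pow_one]
        ring⟩
  | Y b => exact ⟨0, 0, 0, fun z m => by simp [mergeXY, xp]⟩
  | D => exact hl.elim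

theorem mergeMixed_mergeYX : MergeMixed mergeYX := by
  intro l l' hl
  cases l with
  | Y b =>
    cases l' with
    | Y b => exact ⟨0, 0, 0, fun z m => by simp [mergeYX, xp]⟩
    | X a =>
      exact ⟨1, a, b, fun z m => by
        simp only [mergeYX, xp, yp, mixed, ← one_div_mul_one_div]
        ring⟩
    | D =>
      exact ⟨1, 0, b, fun z m => by
        simp only [mergeYX, xp, yp, mixed, ← one_div_mul_one_div, zero_add, pow_one]
        ring⟩
  | X b => exact ⟨0, 0, 0, fun z m => by simp [mergeYX, yp]⟩
  | D => exact hl.elim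

theorem DivComb.smul {N : ℕ} (c : ℝ) {φ : ℝ → ℕ → ℝ} (hφ : DivComb N φ) :
    DivComb N fun z n => c * φ z n := by
  obtain ⟨ψ, hψ, h⟩ := hφ
  exact ⟨_, hψ.smul c, fun z hz n => by simp only [h z hz]; ring⟩

/-- Each merger replaces two letters by one mixed letter, which splits into pure letters (or `D`) at
the gain of 1/z. So the correction consists of words shorter by at least one, with coefficients
divisible by 1/z. -/
theorem nestedSum_sub_plainSum_aux {μ : Letter → Letter → ℝ → ℕ → ℝ} (hμ : MergeBound μ)
    (hμ' : MergeMixed μ) (N : ℕ) : ∀ (l : Letter) (w : List Letter), w.length ≤ N → Good (l :: w) →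
      DivComb w.length fun z n => nestedSum μ (l :: w) z n - plainSum (l :: w) z n := by
  induction N with
  | zero =>
    intro l w hw hg
    obtain rfl := List.length_eq_zero_iff.1 (Nat.le_zero.1 hw)
    exact (DivComb.zero _).congr fun z _ n => by simp [plainSum, nestedSum]
  | succ N ih =>
    intro l w hw hg
    rcases w with _ | ⟨l', w⟩
    · exact ih l [] (by simp) hg
    have h1 := (ih l' w (by simpa using hw) hg.2).step hg.1
    have h2 : DivComb (w.length + 1) fun z n =>
        tailSum (fun m => μ l l' z m * nestedSum μ w z m) n := by
      obtain ⟨c, a, b, e⟩ := hμ' l l' hg.1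
      rcases w with _ | ⟨l'', w⟩
      · refine ((divComb_mixed_top a b).smul c).congr fun z _ n => ?_
        rw [← tailSum_const_mul]
        exact tailSum_congr (fun m _ => by simp [nestedSum, e]) n
      · have h3 : Comb (w.length + 1) (nestedSum μ (l'' :: w)) :=
          (((ih l'' w (by simp at hw ⊢; omega) hg.2.2).comb.mono (Nat.le_succ _)).add
            (.word (l'' :: w) hg.2.2 (by simp))).congr fun z _ n => by ring
        refine ((h3.divComb_mixed a b).smul c).congr fun z _ n => ?_
        rw [← tailSum_const_mul]
        exact tailSum_congr (fun m _ => by rw [e]; ring) n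
    refine (h1.add h2).congr fun z hz n => ?_
    obtain ⟨C, hC, h⟩ := summandBound_head hμ hz hg
    obtain ⟨C', hC', h'⟩ := summandBound_head mergeBound_noMerge hz hg
    rw [nestedSum_eq hμ hz hg, plainSum_cons, add_sub_right_comm]
    congr 1
    rw [plainSum, ← tailSum_sub h hC h' hC']
    exact tailSum_congr (fun m _ => by ring) n

theorem divComb_nestedSum_sub_plainSum {μ : Letter → Letter → ℝ → ℕ → ℝ} (hμ : MergeBound μ)
    (hμ' : MergeMixed μ) {l : Letter} {w : List Letter} (hg : Good (l :: w)) :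
    DivComb w.length fun z n => nestedSum μ (l :: w) z n - plainSum (l :: w) z n :=
  nestedSum_sub_plainSum_aux hμ hμ' w.length l w le_rfl hg

end Ohno

namespace Ohno

open Filter Asymptotics

/-! ### Asymptotic expansions in powers of `1 / z` and `log z` -/

/-- The functions `log z ^ b / z ^ a`. -/
noncomputable def logPow (a b : ℕ) (z : ℝ) : ℝ := Real.log z ^ b / z ^ a

/-- The span of the functions `log z ^ b / z ^ a` with `a ≥ p`. -/
noncomputable def logPowSpan (p : ℕ) : Submodule ℝ (ℝ → ℝ) :=
  Submodule.span ℝ {g | ∃ a b, p ≤ a ∧ g = logPow a b}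

/-- `f` has a complete asymptotic expansion at infinity in terms of `log z ^ b / z ^ a`, `a ≥ p`. -/
def HasExpansion (p : ℕ) (f : ℝ → ℝ) : Prop :=
  ∀ K : ℕ, ∃ e ∈ logPowSpan p, (fun z => f z - e z) =O[atTop] fun z => (z ^ K)⁻¹

theorem logPow_mem {p a : ℕ} (h : p ≤ a) (b : ℕ) : logPow a b ∈ logPowSpan p :=
  Submodule.subset_span ⟨a, b, h, rfl⟩

theorem logPowSpan_mono {p q : ℕ} (h : q ≤ p) : logPowSpan p ≤ logPowSpan q :=
  Submodule.span_mono fun _ ⟨a, b, ha, e⟩ => ⟨a, b, h.trans ha, e⟩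

theorem mul_mem_logPowSpan {p q : ℕ} {e e' : ℝ → ℝ} (he : e ∈ logPowSpan p)
    (he' : e' ∈ logPowSpan q) : e * e' ∈ logPowSpan (p + q) := by
  have h : logPowSpan p * logPowSpan q ≤ logPowSpan (p + q) := by
    rw [logPowSpan, logPowSpan, Submodule.span_mul_span]
    refine Submodule.span_mono ?_
    rintro _ ⟨_, ⟨a, b, ha, rfl⟩, _, ⟨a', b', ha', rfl⟩, rfl⟩
    refine ⟨a + a', b + b', add_le_add ha ha', ?_⟩
    ext z
    simp only [Pi.mul_apply, logPow, pow_add]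
    rw [div_mul_div_comm]
  exact h (Submodule.mul_mem_mul he he')

theorem isBigO_pow_inv_mono {K L : ℕ} (h : K ≤ L) :
    (fun z : ℝ => (z ^ L)⁻¹) =O[atTop] fun z => (z ^ K)⁻¹ := by
  refine IsBigO.of_bound 1 ?_
  filter_upwards [eventually_ge_atTop (1 : ℝ)] with z hz
  rw [one_mul, Real.norm_of_nonneg (by positivity), Real.norm_of_nonneg (by positivity)]
  exact inv_anti₀ (by positivity) (pow_le_pow_right₀ hz h)

/-- `log z ^ b / z ^ a = O(z ^ (1 - a))`. -/
theorem logPow_isBigO (a b : ℕ) : (fun z => logPow (a + 1) b z) =O[atTop] fun z => (z ^ a)⁻¹ := by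
  have h1 : (fun z : ℝ => Real.log z ^ b) =O[atTop] fun z : ℝ => z :=
    Real.isLittleO_pow_log_id_atTop.isBigO
  have h2 := h1.mul (isBigO_refl (fun z : ℝ => (z ^ (a + 1))⁻¹) atTop)
  refine h2.congr' (Eventually.of_forall fun z => by simp [logPow, div_eq_mul_inv]) ?_
  filter_upwards [eventually_gt_atTop (0 : ℝ)] with z hz
  field_simp
  ring

theorem logPow_zero_isBigO (a b : ℕ) : (fun z => logPow a b z) =O[atTop] fun z : ℝ => z := by
  have h := (logPow_isBigO a b).mul (isBigO_refl (fun z : ℝ => z) atTop)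
  have h' : (fun z : ℝ => (z ^ a)⁻¹ * z) =O[atTop] fun z : ℝ => z := by
    have := (isBigO_pow_inv_mono (Nat.zero_le a)).mul (isBigO_refl (fun z : ℝ => z) atTop)
    simpa using this
  refine (h.congr' ?_ EventuallyEq.rfl).trans h'
  filter_upwards [eventually_gt_atTop (0 : ℝ)] with z hz
  simp only [logPow]
  field_simp
  ring

theorem isBigO_of_mem {p : ℕ} {e : ℝ → ℝ} (he : e ∈ logPowSpan p) :
    e =O[atTop] fun z : ℝ => z := by
  induction he using Submodule.span_induction with
  | mem x h =>
    obtain ⟨a, b, -, rfl⟩ := h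
    exact logPow_zero_isBigO a b
  | zero => exact isBigO_zero _ _
  | add x y _ _ h1 h2 => exact h1.add h2
  | smul c x _ h => exact h.const_mul_left c

theorem isBigO_of_mem_succ {p : ℕ} {e : ℝ → ℝ} (he : e ∈ logPowSpan (p + 1)) :
    e =O[atTop] fun z : ℝ => (z ^ p)⁻¹ := by
  induction he using Submodule.span_induction with
  | mem x h =>
    obtain ⟨a, b, ha, rfl⟩ := h
    obtain ⟨a, rfl⟩ : ∃ c, a = c + 1 := ⟨a - 1, by omega⟩
    exact (logPow_isBigO a b).trans (isBigO_pow_inv_mono (by omega))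
  | zero => exact isBigO_zero _ _
  | add x y _ _ h1 h2 => exact h1.add h2
  | smul c x _ h => exact h.const_mul_left c

theorem tendsto_logPow {a : ℕ} (ha : 1 ≤ a) (b : ℕ) : Tendsto (logPow a b) atTop (nhds 0) := by
  obtain ⟨a, rfl⟩ : ∃ c, a = c + 1 := ⟨a - 1, by omega⟩
  have h1 : (fun z : ℝ => Real.log z ^ b) =o[atTop] fun z : ℝ => z :=
    Real.isLittleO_pow_log_id_atTop
  have h2 : (logPow (a + 1) b) =O[atTop] fun z => Real.log z ^ b / z := by
    refine IsBigO.of_bound 1 ?_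
    filter_upwards [eventually_ge_atTop (1 : ℝ)] with z hz
    rw [one_mul, logPow, norm_div, norm_div, Real.norm_of_nonneg (show 0 ≤ z ^ (a + 1) by positivity),
      Real.norm_of_nonneg (show 0 ≤ z by positivity)]
    refine div_le_div_of_nonneg_left (norm_nonneg _) (by positivity) ?_
    exact le_self_pow₀ hz (by omega)
  exact h2.trans_tendsto h1.tendsto_div_nhds_zero

theorem tendsto_of_mem {e : ℝ → ℝ} (he : e ∈ logPowSpan 1) : Tendsto e atTop (nhds 0) := by
  induction he using Submodule.span_induction with
  | mem x h =>
    obtain ⟨a, b, ha, rfl⟩ := h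
    exact tendsto_logPow ha b
  | zero => exact tendsto_const_nhds
  | add x y _ _ h1 h2 =>
    have := h1.add h2
    rwa [add_zero] at this
  | smul c x _ h =>
    have := h.const_mul c
    rwa [mul_zero] at this

namespace HasExpansion

variable {p q : ℕ} {f g : ℝ → ℝ}

theorem of_mem (h : f ∈ logPowSpan p) : HasExpansion p f := fun K =>
  ⟨f, h, by simpa using isBigO_zero _ _⟩

theorem mono (h : q ≤ p) (hf : HasExpansion p f) : HasExpansion q f := fun K =>
  let ⟨e, he, h'⟩ := hf K
  ⟨e, logPowSpan_mono h he, h'⟩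

theorem add (hf : HasExpansion p f) (hg : HasExpansion p g) :
    HasExpansion p fun z => f z + g z := fun K => by
  obtain ⟨e, he, h⟩ := hf K
  obtain ⟨e', he', h'⟩ := hg K
  refine ⟨e + e', Submodule.add_mem _ he he', (h.add h').congr_left fun z => ?_⟩
  simp only [Pi.add_apply]
  ring

theorem const_mul (c : ℝ) (hf : HasExpansion p f) : HasExpansion p fun z => c * f z := fun K => by
  obtain ⟨e, he, h⟩ := hf K
  refine ⟨c • e, Submodule.smul_mem _ c he, (h.const_mul_left c).congr_left fun z => ?_⟩
  simp only [Pi.smul_apply, smul_eq_mul]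
  ring

theorem sub (hf : HasExpansion p f) (hg : HasExpansion p g) :
    HasExpansion p fun z => f z - g z := by
  have := hf.add (hg.const_mul (-1))
  simpa [sub_eq_add_neg] using this

theorem congr (hf : HasExpansion p f) (h : ∀ᶠ z in atTop, g z = f z) : HasExpansion p g :=
  fun K => by
    obtain ⟨e, he, h'⟩ := hf K
    refine ⟨e, he, h'.congr' ?_ EventuallyEq.rfl⟩
    filter_upwards [h] with z hz
    rw [hz]

theorem zero : HasExpansion p fun _ => 0 := of_mem (Submodule.zero_mem _)

theorem const (c : ℝ) : HasExpansion 0 fun _ => c := by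
  have h : (fun _ => c) = c • logPow 0 0 := by
    ext z
    simp [logPow]
  rw [h]
  exact of_mem (Submodule.smul_mem _ _ (logPow_mem le_rfl 0))

theorem isBigO (hf : HasExpansion p f) : f =O[atTop] fun z : ℝ => z := by
  obtain ⟨e, he, h⟩ := hf 0
  have h1 : (fun z => f z - e z) =O[atTop] fun z : ℝ => z := by
    refine h.trans ?_
    refine IsBigO.of_bound 1 ?_
    filter_upwards [eventually_ge_atTop (1 : ℝ)] with z hz
    simp only [pow_zero, inv_one, norm_one, one_mul]
    exact hz.trans (le_abs_self z)
  exact (h1.add (isBigO_of_mem he)).congr_left fun z => by ring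

theorem tendsto (hf : HasExpansion 1 f) : Tendsto f atTop (nhds 0) := by
  obtain ⟨e, he, h⟩ := hf 1
  have h1 : Tendsto (fun z => f z - e z) atTop (nhds 0) :=
    h.trans_tendsto (by simpa using tendsto_inv_atTop_zero)
  simpa using h1.add (tendsto_of_mem he)

theorem mul (hf : HasExpansion p f) (hg : HasExpansion q g) :
    HasExpansion (p + q) fun z => f z * g z := fun K => by
  -- The other factor may grow, but at most like O(z); one extra power absorbs this.
  obtain ⟨e, he, h⟩ := hf (K + 1)
  obtain ⟨e', he', h'⟩ := hg (K + 1)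
  refine ⟨e * e', mul_mem_logPowSpan he he', ?_⟩
  have h1 := (h.mul hg.isBigO).add ((isBigO_of_mem he).mul h' |>.congr_right fun z => mul_comm _ _)
  refine h1.congr' (Eventually.of_forall fun z => ?_) ?_
  · simp only [Pi.mul_apply]
    ring
  · filter_upwards [eventually_gt_atTop (0 : ℝ)] with z hz
    field_simp
    ring

theorem pow (hf : HasExpansion p f) (n : ℕ) : HasExpansion (n * p) fun z => f z ^ n := by
  induction n with
  | zero => simpa using const 1
  | succ n ih =>
    have := ih.mul hf
    rw [Nat.succ_mul]
    simpa [pow_succ] using this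

theorem logPow (h : p ≤ q) (b : ℕ) : HasExpansion p (logPow q b) := of_mem (logPow_mem h b)

theorem inv_pow (h : p ≤ q) : HasExpansion p fun z => 1 / z ^ q := by
  have : (fun z : ℝ => 1 / z ^ q) = Ohno.logPow q 0 := by
    ext z
    simp [Ohno.logPow]
  rw [this]
  exact logPow h 0

theorem div (hf : HasExpansion p f) : HasExpansion (p + 1) fun z => f z / z := by
  have := hf.mul (inv_pow (le_refl 1))
  simpa [div_eq_mul_inv] using this

end HasExpansion

/-- Geometric series with exact remainder (-θ)^N/(z^N (z + θ)). Subtracting the first M terms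
records the order of the rest, which is needed for M = 0, 1, 2. -/
theorem HasExpansion.inv_add (θ : ℝ) (hθ : 0 ≤ θ) (M : ℕ) :
    HasExpansion (M + 1)
      fun z => 1 / (z + θ) - ∑ l ∈ Finset.range M, (-θ) ^ l * (1 / z ^ (l + 1)) := by
  intro K
  refine ⟨fun z => ∑ l ∈ Finset.range K, (-θ) ^ (M + l) * (1 / z ^ (M + l + 1)), ?_, ?_⟩
  · have : (fun z : ℝ => ∑ l ∈ Finset.range K, (-θ) ^ (M + l) * (1 / z ^ (M + l + 1))) =
        ∑ l ∈ Finset.range K, (-θ) ^ (M + l) • Ohno.logPow (M + l + 1) 0 := by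
      ext z
      simp [Ohno.logPow, Finset.sum_apply]
    rw [this]
    exact Submodule.sum_mem _ fun l _ => Submodule.smul_mem _ _ (logPow_mem (by omega) 0)
  · have key : ∀ N : ℕ, ∀ z : ℝ, 0 < z →
        1 / (z + θ) - ∑ l ∈ Finset.range N, (-θ) ^ l * (1 / z ^ (l + 1)) =
        (-θ) ^ N / (z ^ N * (z + θ)) := by
      intro N z hz
      induction N with
      | zero => simp
      | succ N ih =>
        rw [Finset.sum_range_succ, ← sub_sub, ih]
        have : z + θ ≠ 0 := by positivity
        field_simp
        ring
    refine IsBigO.of_bound (|θ| ^ (M + K)) ?_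
    filter_upwards [eventually_ge_atTop (1 : ℝ)] with z hz
    have hz0 : 0 < z := by linarith
    rw [sub_sub, ← Finset.sum_range_add (fun l => (-θ) ^ l * (1 / z ^ (l + 1))) M K, key _ z hz0,
      norm_div, norm_pow, norm_neg, Real.norm_eq_abs θ,
      Real.norm_of_nonneg (by positivity), Real.norm_of_nonneg (by positivity), div_eq_mul_inv]
    refine mul_le_mul_of_nonneg_left (inv_anti₀ (by positivity) ?_) (by positivity)
    have h1 : z ^ K ≤ z ^ (M + K) := pow_le_pow_right₀ hz (by omega)
    have h2 : z ^ (M + K) * 1 ≤ z ^ (M + K) * (z + θ) :=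
      mul_le_mul_of_nonneg_left (by linarith) (by positivity)
    linarith

theorem HasExpansion.log_one_add (θ : ℝ) (hθ : 0 ≤ θ) (M : ℕ) :
    HasExpansion (M + 1)
      fun z => Real.log (1 + θ / z) +
        ∑ l ∈ Finset.range M, (-θ) ^ (l + 1) / (l + 1 : ℕ) * (1 / z ^ (l + 1)) := by
  intro K
  refine ⟨fun z => -∑ l ∈ Finset.range K,
    (-θ) ^ (M + l + 1) / (M + l + 1 : ℕ) * (1 / z ^ (M + l + 1)), ?_, ?_⟩
  · have : (fun z : ℝ => -∑ l ∈ Finset.range K,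
        (-θ) ^ (M + l + 1) / (M + l + 1 : ℕ) * (1 / z ^ (M + l + 1))) =
        -∑ l ∈ Finset.range K, ((-θ) ^ (M + l + 1) / (M + l + 1 : ℕ)) • Ohno.logPow (M + l + 1) 0 := by
      ext z
      simp [Ohno.logPow, Finset.sum_apply]
    rw [this]
    exact Submodule.neg_mem _
      (Submodule.sum_mem _ fun l _ => Submodule.smul_mem _ _ (logPow_mem (by omega) 0))
  -- For z ≥ 2θ the argument θ/z is at most 1/2, so the denominator 1 - θ/z in the remainder of the
  -- logarithmic series costs a factor 2.
  · refine IsBigO.of_bound (2 * θ ^ (M + K + 1)) ?_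
    filter_upwards [eventually_ge_atTop (1 : ℝ), eventually_ge_atTop (2 * θ)] with z hz hz2
    have hz0 : 0 < z := by linarith
    rw [sub_neg_eq_add, add_assoc, ← Finset.sum_range_add
      (fun l => (-θ) ^ (l + 1) / (l + 1 : ℕ) * (1 / z ^ (l + 1))) M K]
    have hx : |-(θ / z)| ≤ 1 / 2 := by
      rw [abs_neg, abs_of_nonneg (by positivity), div_le_iff₀ hz0]
      linarith
    have h := Real.abs_log_sub_add_sum_range_le (x := -(θ / z)) (by linarith) (M + K)
    have e : Real.log (1 + θ / z) + ∑ l ∈ Finset.range (M + K),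
        (-θ) ^ (l + 1) / (l + 1 : ℕ) * (1 / z ^ (l + 1)) =
        ∑ i ∈ Finset.range (M + K), (-(θ / z)) ^ (i + 1) / (i + 1) + Real.log (1 - -(θ / z)) := by
      rw [add_comm, sub_neg_eq_add]
      congr 1
      refine Finset.sum_congr rfl fun i _ => ?_
      rw [← neg_div, div_pow]
      push_cast
      field_simp
    rw [e, Real.norm_eq_abs]
    refine h.trans ?_
    rw [div_le_iff₀ (by linarith), abs_neg, abs_of_nonneg (show 0 ≤ θ / z by positivity),
      Real.norm_of_nonneg (by positivity), div_pow]
    rw [abs_neg, abs_of_nonneg (show 0 ≤ θ / z by positivity)] at hx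
    have h1 : z ^ K ≤ z ^ (M + K + 1) := pow_le_pow_right₀ hz (by omega)
    have h2 : θ ^ (M + K + 1) / z ^ (M + K + 1) ≤ θ ^ (M + K + 1) * (z ^ K)⁻¹ := by
      rw [div_eq_mul_inv]
      exact mul_le_mul_of_nonneg_left (inv_anti₀ (by positivity) h1) (by positivity)
    have h3 : 0 ≤ θ ^ (M + K + 1) * (z ^ K)⁻¹ := by positivity
    nlinarith

theorem log_add_eq {z θ : ℝ} (hz : 0 < z) (hθ : 0 ≤ θ) :
    Real.log (z + θ) = Real.log z + Real.log (1 + θ / z) := by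
  rw [← Real.log_mul hz.ne' (by positivity)]
  congr 1
  field_simp

theorem HasExpansion.log : HasExpansion 0 Real.log := by
  have h := HasExpansion.logPow (le_refl 0) 1
  exact h.congr (Eventually.of_forall fun z => by simp [Ohno.logPow])

theorem HasExpansion.logPow_shift (θ : ℝ) (hθ : 0 ≤ θ) (a b : ℕ) :
    HasExpansion a fun z => Ohno.logPow a b (z + θ) := by
  have h1 : HasExpansion 1 fun z => 1 / (z + θ) := by
    simpa using HasExpansion.inv_add θ hθ 0
  have h2 : HasExpansion 0 fun z => Real.log z + Real.log (1 + θ / z) :=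
    HasExpansion.log.add ((HasExpansion.log_one_add θ hθ 0).mono (Nat.zero_le _) |>.congr
      (Eventually.of_forall fun z => by simp))
  have h3 := (h2.pow b).mul (h1.pow a)
  simp only [mul_zero, zero_add, mul_one] at h3
  refine h3.congr ?_
  filter_upwards [eventually_gt_atTop (0 : ℝ)] with z hz
  rw [← log_add_eq hz hθ, Ohno.logPow, one_div, _root_.inv_pow, div_eq_mul_inv]

theorem HasExpansion.shift_of_mem {p : ℕ} {e : ℝ → ℝ} (he : e ∈ logPowSpan p) (θ : ℝ)
    (hθ : 0 ≤ θ) : HasExpansion p fun z => e (z + θ) := by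
  induction he using Submodule.span_induction with
  | mem x h =>
    obtain ⟨a, b, ha, rfl⟩ := h
    exact (HasExpansion.logPow_shift θ hθ a b).mono ha
  | zero => exact HasExpansion.zero
  | add x y _ _ h1 h2 => exact h1.add h2
  | smul c x _ h => exact h.const_mul c

theorem HasExpansion.shift {p : ℕ} {f : ℝ → ℝ} (hf : HasExpansion p f) (θ : ℝ) (hθ : 0 ≤ θ) :
    HasExpansion p fun z => f (z + θ) := by
  intro K
  obtain ⟨e, he, h⟩ := hf K
  obtain ⟨e', he', h'⟩ := HasExpansion.shift_of_mem he θ hθ K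
  refine ⟨e', he', ?_⟩
  have h1 : (fun z => f (z + θ) - e (z + θ)) =O[atTop] fun z : ℝ => ((z + θ) ^ K)⁻¹ :=
    h.comp_tendsto (tendsto_atTop_add_const_right _ θ tendsto_id)
  have h2 : (fun z : ℝ => ((z + θ) ^ K)⁻¹) =O[atTop] fun z : ℝ => (z ^ K)⁻¹ := by
    refine IsBigO.of_bound 1 ?_
    filter_upwards [eventually_gt_atTop (0 : ℝ)] with z hz
    rw [one_mul, Real.norm_of_nonneg (by positivity), Real.norm_of_nonneg (by positivity)]
    exact inv_anti₀ (by positivity) (pow_le_pow_left₀ hz.le (by linarith) _)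
  exact ((h1.trans h2).add h').congr_left fun z => by ring

end Ohno

/-! ### Summing expansions: the difference equation e(z) - e(z + 1) = g(z) -/

namespace Ohno

open Filter Asymptotics

theorem HasExpansion.log_add_one_pow (b : ℕ) :
    HasExpansion 2 fun z => (Real.log z + Real.log (1 + 1 / z)) ^ b - Real.log z ^ b -
      b * (Real.log z ^ (b - 1) * (1 / z)) := by
  have hv : HasExpansion 1 fun z => Real.log (1 + 1 / z) := by
    simpa using HasExpansion.log_one_add 1 zero_le_one 0
  have hv2 : HasExpansion 2 fun z => Real.log (1 + 1 / z) - 1 / z := by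
    have := HasExpansion.log_one_add 1 zero_le_one 1
    simpa [sub_eq_add_neg] using this
  have hLv : HasExpansion 0 fun z => Real.log z + Real.log (1 + 1 / z) :=
    HasExpansion.log.add (hv.mono (Nat.zero_le _))
  -- With v = log(1 + 1/z), the quantity P_b = (L + v)^b - L^b - b L^(b-1) v satisfies P_{b+1} = (L
  -- + v) P_b + b L^(b-1) v², and v² has order 2.
  have key : HasExpansion 2 fun z => (Real.log z + Real.log (1 + 1 / z)) ^ b - Real.log z ^ b -
      b * (Real.log z ^ (b - 1) * Real.log (1 + 1 / z)) := by
    induction b with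
    | zero => simpa using HasExpansion.zero
    | succ b ih =>
      have h1 := hLv.mul ih
      have h2 := (((HasExpansion.log.pow (b - 1)).mul (hv.mul hv)).const_mul (b : ℝ))
      simp only [mul_zero, zero_add] at h1 h2
      refine (h1.add h2).congr (Eventually.of_forall fun z => ?_)
      rcases b with _ | b
      · simp
      · simp only [Nat.add_sub_cancel]
        push_cast
        ring
  have h3 := ((HasExpansion.log.pow (b - 1)).mul hv2).const_mul (b : ℝ)
  simp only [mul_zero, zero_add] at h3
  exact (key.add h3).congr (Eventually.of_forall fun z => by ring)

theorem HasExpansion.inv_add_one_pow (a : ℕ) :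
    HasExpansion (a + 2) fun z => (1 / (z + 1)) ^ a - 1 / z ^ a + a * (1 / z ^ (a + 1)) := by
  have hw : HasExpansion 1 fun z : ℝ => 1 / (z + 1) := by
    simpa using HasExpansion.inv_add 1 zero_le_one 0
  have hw2 : HasExpansion 2 fun z : ℝ => 1 / (z + 1) - 1 / z := by
    simpa using HasExpansion.inv_add 1 zero_le_one 1
  have hw3 : HasExpansion 3 fun z : ℝ => 1 / (z + 1) - 1 / z + 1 / z ^ 2 := by
    have := HasExpansion.inv_add 1 zero_le_one 2
    refine this.congr (Eventually.of_forall fun z => ?_)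
    simp only [Finset.sum_range_succ, Finset.sum_range_zero]
    ring
  induction a with
  | zero => simpa using HasExpansion.zero
  | succ a ih =>
    have h1 := hw.mul ih
    have h2 := hw3.mul (HasExpansion.inv_pow (le_refl a))
    have h3 := (hw2.mul (HasExpansion.inv_pow (le_refl (a + 1)))).const_mul (-(a : ℝ))
    have h1' := h1.mono (q := a + 1 + 2) (by omega)
    have h2' := h2.mono (q := a + 1 + 2) (by omega)
    have h3' := h3.mono (q := a + 1 + 2) (by omega)
    refine ((h1'.add h2').add h3').congr ?_
    filter_upwards [eventually_gt_atTop (0 : ℝ)] with z hz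
    generalize 1 / (z + 1) = w
    push_cast
    field_simp
    ring

/-- To leading order the difference is the derivative of log(z)^b / z^a; the error gains one more
power of 1/z. For b = 0 the truncated `b - 1` is harmless, as its coefficient vanishes. -/
theorem HasExpansion.logPow_diff (a b : ℕ) :
    HasExpansion (a + 2) fun z => Ohno.logPow a b (z + 1) - Ohno.logPow a b z -
      (b * Ohno.logPow (a + 1) (b - 1) z - a * Ohno.logPow (a + 1) b z) := by
  have h1 := HasExpansion.log_add_one_pow b
  have h2 := HasExpansion.inv_add_one_pow a
  have hz1 : HasExpansion a fun z : ℝ => (1 / (z + 1)) ^ a := by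
    have hw : HasExpansion 1 fun z : ℝ => 1 / (z + 1) := by
      simpa using HasExpansion.inv_add 1 zero_le_one 0
    simpa using hw.pow a
  have hL := HasExpansion.log.pow b
  have hL' := HasExpansion.log.pow (b - 1)
  simp only [mul_zero] at hL hL'
  have hd : HasExpansion (a + 1) fun z : ℝ => (1 / (z + 1)) ^ a - 1 / z ^ a := by
    have := (h2.mono (q := a + 1) (by omega)).sub
      ((HasExpansion.inv_pow (p := a + 1) (le_refl (a + 1))).const_mul (a : ℝ))
    exact this.congr (Eventually.of_forall fun z => by ring)
  have t1 := (h1.mul hz1).mono (q := a + 2) (by omega)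
  have t2 := (hL.mul h2).mono (q := a + 2) (by omega)
  have t3 := ((hL'.mul ((HasExpansion.inv_pow (p := 1) (le_refl 1)).mul hd)).const_mul (b : ℝ)).mono
    (q := a + 2) (by omega)
  refine ((t1.add t2).add t3).congr ?_
  filter_upwards [eventually_gt_atTop (0 : ℝ)] with z hz
  simp only [Ohno.logPow]
  rw [log_add_eq hz zero_le_one, pow_one, div_eq_mul_one_div (_ ^ b) ((z + 1) ^ a),
    ← one_div_pow]
  field_simp
  ring

/-- `g` is, up to `O(z ^ (-K))`, the difference `e z - e (z + 1)` for some `e` in the span. -/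
def IsDifference (K : ℕ) (g : ℝ → ℝ) : Prop :=
  ∃ e ∈ logPowSpan 0, (fun z => e z - e (z + 1) - g z) =O[atTop] fun z => (z ^ K)⁻¹

theorem IsDifference.add {K : ℕ} {f g : ℝ → ℝ} (hf : IsDifference K f) (hg : IsDifference K g) :
    IsDifference K fun z => f z + g z := by
  obtain ⟨e, he, h⟩ := hf
  obtain ⟨e', he', h'⟩ := hg
  refine ⟨e + e', Submodule.add_mem _ he he', (h.add h').congr_left fun z => ?_⟩
  simp only [Pi.add_apply]
  ring

theorem IsDifference.const_mul {K : ℕ} (c : ℝ) {f : ℝ → ℝ} (hf : IsDifference K f) :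
    IsDifference K fun z => c * f z := by
  obtain ⟨e, he, h⟩ := hf
  refine ⟨c • e, Submodule.smul_mem _ _ he, (h.const_mul_left c).congr_left fun z => ?_⟩
  simp only [Pi.smul_apply, smul_eq_mul]
  ring

theorem IsDifference.congr {K : ℕ} {f g : ℝ → ℝ} (hf : IsDifference K f)
    (h : (fun z => g z - f z) =O[atTop] fun z => (z ^ K)⁻¹) : IsDifference K g := by
  obtain ⟨e, he, h'⟩ := hf
  exact ⟨e, he, (h'.sub h).congr_left fun z => by ring⟩

theorem IsDifference.zero (K : ℕ) : IsDifference K fun _ => 0 :=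
  ⟨0, Submodule.zero_mem _, by simpa using isBigO_zero _ _⟩

theorem IsDifference.of_mem {K p : ℕ} (h : ∀ a b, p ≤ a → IsDifference K (logPow a b))
    {g : ℝ → ℝ} (hg : g ∈ logPowSpan p) : IsDifference K g := by
  induction hg using Submodule.span_induction with
  | mem x hx =>
    obtain ⟨a, b, ha, rfl⟩ := hx
    exact h a b ha
  | zero => exact IsDifference.zero K
  | add x y _ _ h1 h2 => exact h1.add h2
  | smul c x _ h => exact h.const_mul c

/-- Descending induction on a, with d counting the powers left until the term is O(z^(-K)) and can
be dropped. Otherwise the term is a difference up to terms with larger a, by integrating it formally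
through `logPow_diff`. -/
theorem isDifference_logPow (K d : ℕ) :
    ∀ a b : ℕ, 1 ≤ a → K + 1 ≤ a + d → IsDifference K (logPow a b) := by
  induction d with
  | zero =>
    intro a b ha hK
    refine (IsDifference.zero K).congr ?_
    simpa using isBigO_of_mem_succ (logPow_mem (p := K + 1) hK b)
  | succ d ih =>
    intro a b ha hK
    have hrest : ∀ {g : ℝ → ℝ}, HasExpansion (a + 1) g → IsDifference K g := fun hg => by
      obtain ⟨e, he, h⟩ := hg K
      exact (IsDifference.of_mem (p := a + 1) (fun a' b' ha' => ih a' b' (by omega) (by omega))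
        he).congr h
    obtain ⟨a, rfl⟩ : ∃ c, a = c + 1 := ⟨a - 1, by omega⟩
    have hdiff : ∀ b : ℕ, IsDifference K fun z =>
        (b : ℝ) * logPow (a + 1) (b - 1) z - a * logPow (a + 1) b z := fun b => by
      have h1 := hrest (HasExpansion.logPow_diff a b)
      have h2 : IsDifference K fun z => logPow a b (z + 1) - logPow a b z :=
        ⟨-logPow a b, Submodule.neg_mem _ (logPow_mem (Nat.zero_le _) b), by
          refine (isBigO_zero _ _).congr_left fun z => ?_
          simp only [Pi.neg_apply]
          ring⟩
      refine (h2.add (h1.const_mul (-1))).congr ?_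
      refine (isBigO_zero _ _).congr_left fun z => ?_
      ring
    -- For log(z)^b / z the antiderivative is log(z)^(b+1)/(b+1): here the power of the logarithm
    -- goes up.
    rcases Nat.eq_zero_or_pos a with rfl | hpos
    · refine ((hdiff (b + 1)).const_mul (1 / (b + 1 : ℝ))).congr ?_
      refine (isBigO_zero _ _).congr_left fun z => ?_
      have : (b + 1 : ℝ) ≠ 0 := by positivity
      simp only [Nat.add_sub_cancel]
      push_cast
      field_simp
      ring
    -- The derivative of log(z)^b / z^a is -a log(z)^b / z^(a+1) up to a lower power of the
    -- logarithm, hence the induction on b.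
    · have ha0 : (a : ℝ) ≠ 0 := by exact_mod_cast hpos.ne'
      induction b with
      | zero =>
        refine ((hdiff 0).const_mul (-(1 / a : ℝ))).congr ?_
        refine (isBigO_zero _ _).congr_left fun z => ?_
        push_cast
        field_simp
        ring
      | succ b ihb =>
        refine (((hdiff (b + 1)).const_mul (-(1 / a : ℝ))).add
          (ihb.const_mul ((b + 1 : ℝ) / a))).congr ?_
        refine (isBigO_zero _ _).congr_left fun z => ?_
        simp only [Nat.add_sub_cancel]
        push_cast
        field_simp
        ring

theorem HasExpansion.exists_isDifference {g : ℝ → ℝ} (hg : HasExpansion 1 g) (K : ℕ) :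
    IsDifference K g := by
  obtain ⟨e, he, h⟩ := hg K
  exact (IsDifference.of_mem (p := 1)
    (fun a b ha => isDifference_logPow K (K + 1) a b ha (by omega)) he).congr h

/-- Terms with a ≥ 1 tend to 0 by themselves; for pure powers of log z the difference is a
combination of terms containing log(1 + θ/z). -/
theorem tendsto_shift_sub_of_mem {e : ℝ → ℝ} (he : e ∈ logPowSpan 0) (θ : ℝ) (hθ : 0 ≤ θ) :
    Tendsto (fun z => e (z + θ) - e z) atTop (nhds 0) := by
  induction he using Submodule.span_induction with
  | mem x h =>
    obtain ⟨a, b, -, rfl⟩ := h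
    rcases Nat.eq_zero_or_pos a with rfl | ha
    · have hv : HasExpansion 1 fun z => Real.log (1 + θ / z) := by
        simpa using HasExpansion.log_one_add θ hθ 0
      have hLv : HasExpansion 0 fun z => Real.log z + Real.log (1 + θ / z) :=
        HasExpansion.log.add (hv.mono (Nat.zero_le _))
      have h : HasExpansion 1
          fun z => (Real.log z + Real.log (1 + θ / z)) ^ b - Real.log z ^ b := by
        induction b with
        | zero => simpa using HasExpansion.zero
        | succ b ih =>
          have h1 := hLv.mul ih
          have h2 := (HasExpansion.log.pow b).mul hv
          simp only [mul_zero, zero_add] at h1 h2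
          exact (h1.add h2).congr (Eventually.of_forall fun z => by ring)
      refine h.tendsto.congr' ?_
      filter_upwards [eventually_gt_atTop (0 : ℝ)] with z hz
      simp [logPow, log_add_eq hz hθ]
    · have h1 := tendsto_logPow ha b
      have h2 := h1.comp (tendsto_atTop_add_const_right atTop θ tendsto_id)
      simpa using h2.sub h1
  | zero => simp
  | add x y _ _ h1 h2 =>
    have := h1.add h2
    rw [add_zero] at this
    exact this.congr fun z => by simp only [Pi.add_apply]; ring
  | smul c x _ h =>
    have := h.const_mul c
    rw [mul_zero] at this
    exact this.congr fun z => by simp only [Pi.smul_apply, smul_eq_mul]; ring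

theorem hasSum_inv_telescope {z : ℝ} (hz : 0 < z) :
    HasSum (fun j : ℕ => 1 / (z + j) - 1 / (z + (j + 1 : ℕ))) (1 / z) := by
  rw [hasSum_iff_tendsto_nat_of_nonneg]
  · have h : Tendsto (fun N : ℕ => 1 / (z + (N : ℝ))) atTop (nhds 0) :=
      Tendsto.div_atTop tendsto_const_nhds
        (tendsto_atTop_add_const_left _ z tendsto_natCast_atTop_atTop)
    have e : ∀ N : ℕ, ∑ j ∈ Finset.range N, (1 / (z + j) - 1 / (z + (j + 1 : ℕ))) =
        1 / z - 1 / (z + N) := fun N => by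
      rw [Finset.sum_range_sub' fun j : ℕ => 1 / (z + (j : ℝ))]
      simp
    simp only [e]
    simpa using h.const_sub (1 / z)
  · intro j
    rw [sub_nonneg]
    refine one_div_le_one_div_of_le (by positivity) ?_
    push_cast
    linarith

/-- A function with rapidly decreasing differences converges along `z + ℕ`, at a fast rate. -/
theorem exists_limit_of_difference {φ : ℝ → ℝ} {K : ℕ}
    (h : (fun z => φ z - φ (z + 1)) =O[atTop] fun z => (z ^ (K + 2))⁻¹) :
    ∃ C Z : ℝ, 0 < Z ∧ ∀ z, Z ≤ z → ∃ l, Tendsto (fun J : ℕ => φ (z + J)) atTop (nhds l) ∧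
      |φ z - l| ≤ C * (z ^ K)⁻¹ := by
  obtain ⟨C, hC, hb⟩ := h.exists_nonneg
  obtain ⟨Z, hZ⟩ := eventually_atTop.1 hb.bound
  refine ⟨2 * C, max Z 1, by positivity, fun z hz => ?_⟩
  have hz1 : 1 ≤ z := (le_max_right _ _).trans hz
  have hz0 : 0 < z := by linarith
  have hbound : ∀ j : ℕ, ‖φ (z + (j + 1 : ℕ)) - φ (z + j)‖ ≤
      2 * C * (z ^ K)⁻¹ * (1 / (z + j) - 1 / (z + (j + 1 : ℕ))) := by
    intro j
    have hj : (0 : ℝ) ≤ j := Nat.cast_nonneg j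
    have h1 := hZ (z + j) (by linarith [(le_max_left Z 1).trans hz])
    have e : z + ((j + 1 : ℕ) : ℝ) = z + j + 1 := by push_cast; ring
    rw [e, norm_sub_rev]
    refine h1.trans ?_
    rw [Real.norm_of_nonneg (by positivity), pow_add, mul_inv]
    have h2 : ((z + j) ^ K)⁻¹ ≤ (z ^ K)⁻¹ :=
      inv_anti₀ (by positivity) (pow_le_pow_left₀ hz0.le (by linarith) _)
    -- Two of the K + 2 powers are spent on summability: 1/t² ≤ 2/(t(t + 1)) for t ≥ 1, which
    -- telescopes.
    have h3 : ((z + j) ^ 2)⁻¹ ≤ 2 * (1 / (z + j) - 1 / (z + j + 1)) := by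
      rw [div_sub_div _ _ (by positivity) (by positivity), inv_eq_one_div, mul_div_assoc',
        div_le_div_iff₀ (by positivity) (by positivity)]
      nlinarith
    calc C * (((z + j) ^ K)⁻¹ * ((z + j) ^ 2)⁻¹)
        ≤ C * ((z ^ K)⁻¹ * (2 * (1 / (z + j) - 1 / (z + j + 1)))) := by
          refine mul_le_mul_of_nonneg_left ?_ hC
          exact mul_le_mul h2 h3 (by positivity) (by positivity)
      _ = _ := by ring
  have hs := (hasSum_inv_telescope hz0).mul_left (2 * C * (z ^ K)⁻¹)
  have hsum : Summable fun j : ℕ => φ (z + (j + 1 : ℕ)) - φ (z + j) :=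
    Summable.of_norm_bounded hs.summable hbound
  refine ⟨φ z + ∑' j : ℕ, (φ (z + (j + 1 : ℕ)) - φ (z + j)), ?_, ?_⟩
  · have ht := hsum.hasSum.tendsto_sum_nat.const_add (φ z)
    refine ht.congr fun N => ?_
    rw [Finset.sum_range_sub fun j : ℕ => φ (z + (j : ℝ))]
    simp
  · rw [sub_add_cancel_left, abs_neg, ← Real.norm_eq_abs]
    refine (tsum_of_norm_bounded hs hbound).trans ?_
    have : 1 / z ≤ 1 := by rw [div_le_one hz0]; exact hz1
    exact mul_le_of_le_one_right (by positivity) this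

/-- Removing a formal solution e of the difference equation leaves φ with rapidly decreasing
differences, so φ converges fast along z + ℕ. The limit could be any 1-periodic function of z; slow
variation of f forces it to be a constant. -/
theorem HasExpansion.of_difference {f : ℝ → ℝ}
    (hd : HasExpansion 1 fun z => f z - f (z + 1))
    (hs : ∀ θ : ℝ, 0 ≤ θ → θ ≤ 1 → Tendsto (fun z => f (z + θ) - f z) atTop (nhds 0)) :
    HasExpansion 0 f := by
  intro K
  obtain ⟨e, he, h⟩ := hd.exists_isDifference (K + 2)
  set φ : ℝ → ℝ := fun z => f z - e z with hφ
  have h1 : (fun z => φ z - φ (z + 1)) =O[atTop] fun z => (z ^ (K + 2))⁻¹ :=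
    h.neg_left.congr_left fun z => by simp only [hφ]; ring
  obtain ⟨C, Z, hZ, hl⟩ := exists_limit_of_difference h1
  have hslow : ∀ θ : ℝ, 0 ≤ θ → θ ≤ 1 →
      Tendsto (fun z => φ (z + θ) - φ z) atTop (nhds 0) := fun θ h0 h1 => by
    have := (hs θ h0 h1).sub (tendsto_shift_sub_of_mem he θ h0)
    rw [sub_zero] at this
    exact this.congr fun z => by simp only [hφ]; ring
  obtain ⟨c, hc, -⟩ := hl Z le_rfl
  have step : ∀ z θ : ℝ, 0 ≤ θ → θ ≤ 1 → Tendsto (fun J : ℕ => φ (z + J)) atTop (nhds c) →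
      Tendsto (fun J : ℕ => φ (z + θ + J)) atTop (nhds c) := fun z θ h0 h1 hz => by
    have h2 := (hslow θ h0 h1).comp
      (tendsto_atTop_add_const_left atTop z tendsto_natCast_atTop_atTop)
    have h3 := h2.add hz
    rw [zero_add] at h3
    refine h3.congr fun J => ?_
    simp only [Function.comp_apply, sub_add_cancel]
    congr 1
    ring
  have all : ∀ n : ℕ, Tendsto (fun J : ℕ => φ (Z + n + J)) atTop (nhds c) := fun n => by
    induction n with
    | zero => simpa using hc
    | succ n ih =>
      have := step (Z + n) 1 zero_le_one le_rfl ih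
      refine this.congr fun J => ?_
      push_cast
      congr 1
      ring
  -- The point z is reached from Z by integer steps followed by one step of fractional length.
  have hlim : ∀ z, Z ≤ z → Tendsto (fun J : ℕ => φ (z + J)) atTop (nhds c) := fun z hz => by
    have h0 : 0 ≤ z - Z := by linarith
    have h2 := Nat.floor_le h0
    have h3 := Nat.lt_floor_add_one (z - Z)
    have := step (Z + (⌊z - Z⌋₊ : ℕ)) (z - Z - (⌊z - Z⌋₊ : ℕ)) (by linarith) (by linarith)
      (all ⌊z - Z⌋₊)
    refine this.congr fun J => ?_
    congr 1
    ring
  refine ⟨e + c • Ohno.logPow 0 0, Submodule.add_mem _ he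
    (Submodule.smul_mem _ _ (logPow_mem le_rfl 0)), ?_⟩
  refine IsBigO.of_bound C ?_
  filter_upwards [eventually_ge_atTop Z] with z hz
  obtain ⟨l, hl1, hl2⟩ := hl z hz
  rw [tendsto_nhds_unique hl1 (hlim z hz)] at hl2
  have hz0 : 0 < z := by linarith
  rw [Real.norm_of_nonneg (show 0 ≤ (z ^ K)⁻¹ by positivity), Real.norm_eq_abs]
  refine le_trans (le_of_eq ?_) hl2
  congr 1
  simp only [hφ, Pi.add_apply, Pi.smul_apply, Ohno.logPow, smul_eq_mul, pow_zero, div_one, mul_one]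
  ring

end Ohno

/-! ### Slow variation and expansions of nested sums -/

namespace Ohno

open Filter Asymptotics Letter

theorem one_div_pow_sub_le {t θ : ℝ} (ht : 1 ≤ t) (h0 : 0 ≤ θ) (h1 : θ ≤ 1) (b : ℕ) :
    |1 / (t + θ) ^ (b + 1) - 1 / t ^ (b + 1)| ≤ (b + 1) * (1 / t ^ 2) := by
  have ht0 : 0 < t := by linarith
  have hle : 1 / (t + θ) ^ (b + 1) ≤ 1 / t ^ (b + 1) :=
    one_div_le_one_div_of_le (by positivity) (pow_le_pow_left₀ ht0.le (by linarith) _)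
  rw [abs_sub_comm, abs_of_nonneg (by linarith)]
  have hb : 1 - (b + 1) * (1 / t) ≤ (t / (t + θ)) ^ (b + 1) := by
    -- Bernoulli's inequality for (1 - θ/(t + θ))^(b+1).
    have h2 := one_add_mul_le_pow (a := -(θ / (t + θ))) (by
      have : θ / (t + θ) ≤ 1 := by rw [div_le_one (by positivity)]; linarith
      linarith) (b + 1)
    have e : 1 + -(θ / (t + θ)) = t / (t + θ) := by field_simp; ring
    rw [e] at h2
    refine le_trans ?_ h2
    have h3 : θ / (t + θ) ≤ 1 / t := by
      rw [div_le_div_iff₀ (by positivity) ht0]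
      nlinarith
    have h4 : (b + 1 : ℝ) * (θ / (t + θ)) ≤ (b + 1) * (1 / t) :=
      mul_le_mul_of_nonneg_left h3 (by positivity)
    push_cast
    linarith
  have e2 : 1 / (t + θ) ^ (b + 1) = 1 / t ^ (b + 1) * (t / (t + θ)) ^ (b + 1) := by
    rw [div_pow]
    field_simp
  have h5 : 1 / t ^ (b + 1) ≤ 1 / t := by
    simpa using one_div_pow_le ht (show 1 ≤ b + 1 by omega)
  rw [e2]
  calc 1 / t ^ (b + 1) - 1 / t ^ (b + 1) * (t / (t + θ)) ^ (b + 1)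
      = 1 / t ^ (b + 1) * (1 - (t / (t + θ)) ^ (b + 1)) := by ring
    _ ≤ 1 / t ^ (b + 1) * ((b + 1) * (1 / t)) :=
        mul_le_mul_of_nonneg_left (by linarith) (by positivity)
    _ ≤ 1 / t * ((b + 1) * (1 / t)) := mul_le_mul_of_nonneg_right h5 (by positivity)
    _ = _ := by field_simp

theorem yp_sub_le (l : Letter) : ∃ c : ℝ, 0 ≤ c ∧ ∀ t θ : ℝ, 1 ≤ t → 0 ≤ θ → θ ≤ 1 →
    |l.yp (t + θ) - l.yp t| ≤ c * (1 / t ^ 2) := by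
  cases l with
  | X a => exact ⟨0, le_rfl, fun t θ _ _ _ => by simp [yp]⟩
  | Y b => exact ⟨b + 1, by positivity, fun t θ h h0 h1 => one_div_pow_sub_le h h0 h1 b⟩
  | D =>
    refine ⟨1, zero_le_one, fun t θ h h0 h1 => ?_⟩
    have := one_div_pow_sub_le h h0 h1 0
    simp only [yp]
    rw [neg_sub_neg, abs_sub_comm]
    simpa using this

theorem val_sub_eq (l : Letter) (z θ : ℝ) (m : ℕ) :
    l.val (z + θ) m - l.val z m = l.yp (m + z + θ) - l.yp (m + z) := by
  simp only [val, ← add_assoc]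
  ring

/-- Bounds for nested sums and their variation that are uniform in `z`. -/
theorem plainSum_uniform (l : Letter) (w : List Letter) (hg : Good (l :: w)) :
    ∃ C : ℝ, 0 ≤ C ∧ (∀ z, 1 ≤ z → TailBound (C * √z) (plainSum (l :: w) z)) ∧
      ∀ z θ, 1 ≤ z → 0 ≤ θ → θ ≤ 1 →
        TailBound (C * (1 / √z)) fun n => plainSum (l :: w) (z + θ) n - plainSum (l :: w) z n := by
  induction w generalizing l with
  | nil =>
    obtain ⟨c, hc, hb⟩ := yp_sub_le l
    refine ⟨8 + 4 * c, by positivity, fun z hz => ?_, fun z θ hz h0 h1 => ?_⟩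
    · have hs : 1 ≤ √z := Real.one_le_sqrt.2 hz
      have h := SummandBound.tailBound (C := 1 + √z) (φ := l.val z)
        (fun m hm => abs_val_le_of_top hg (by linarith) hm) (by positivity)
      intro n
      refine (h n).trans (mul_le_mul_of_nonneg_right ?_ (by positivity))
      nlinarith
    · have hz0 : 0 < z := by linarith
      have hs := Real.sqrt_pos.2 hz0
      have hb1 : SummandBound (c * (1 / √z)) fun m => l.val (z + θ) m - l.val z m := by
        intro m hm
        have hm1 : (1 : ℝ) ≤ m := by exact_mod_cast hm
        have hsm := Real.sqrt_pos.2 (show (0 : ℝ) < m by linarith)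
        simp only [val_sub_eq]
        refine (hb _ θ (by linarith) h0 h1).trans ?_
        rw [mul_assoc]
        refine mul_le_mul_of_nonneg_left ?_ hc
        rw [one_div_mul_one_div]
        refine one_div_le_one_div_of_le (by positivity) ?_
        -- One factor m + z is bounded below by m, the other by √z √m: this keeps summability in m
        -- and still gains z^(-1/2).
        have h3 := sqrt_mul_sqrt_le_add (show (0 : ℝ) ≤ m by linarith) hz0.le
        calc √z * (m * √(m : ℝ)) = m * (√z * √(m : ℝ)) := by ring
          _ ≤ (m + z) * (m + z) := mul_le_mul (by linarith) h3 (by positivity) (by positivity)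
          _ = _ := by ring
      have h := hb1.tailBound (by positivity)
      have e : tailSum (fun m => l.val (z + θ) m - l.val z m) =
          fun n => plainSum [l] (z + θ) n - plainSum [l] z n := by
        ext n
        exact tailSum_sub (C := 1 + √(z + θ)) (C' := 1 + √z)
          (fun m hm => abs_val_le_of_top hg (by linarith) hm) (by positivity)
          (fun m hm => abs_val_le_of_top hg hz0 hm) (by positivity) n
      rw [e] at h
      intro n
      refine (h n).trans (mul_le_mul_of_nonneg_right ?_ (by positivity))
      rw [← mul_assoc]
      exact mul_le_mul_of_nonneg_right (by linarith) (by positivity)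
  | cons l' w ih =>
    obtain ⟨C, hC, ha, hb⟩ := ih l' hg.2
    obtain ⟨c, hc, hy⟩ := yp_sub_le l
    refine ⟨4 * C + 4 * (2 * c * C + C), by positivity, fun z hz => ?_, fun z θ hz h0 h1 => ?_⟩
    · have h := ((ha z hz).mul (by positivity) zero_le_one
        fun m hm => abs_val_le_of_inner hg.1 (by linarith) hm).tailBound (by positivity)
      intro n
      rw [plainSum_cons]
      refine (h n).trans (mul_le_mul_of_nonneg_right ?_ (by positivity))
      have : 0 ≤ 4 * (2 * c * C + C) * √z := by positivity
      linarith
    · have hz0 : 0 < z := by linarith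
      have hs := Real.sqrt_pos.2 hz0
      have hs2 : √(z + θ) ≤ 2 * √z := by
        rw [Real.sqrt_le_left (by positivity), mul_pow, Real.sq_sqrt hz0.le]
        linarith
      have hv : ∀ m : ℕ, 1 ≤ m → |l.val (z + θ) m - l.val z m| ≤ c * (1 / z) * (1 / m) := by
        intro m hm
        have hm1 : (1 : ℝ) ≤ m := by exact_mod_cast hm
        rw [val_sub_eq]
        refine (hy _ θ (by linarith) h0 h1).trans ?_
        rw [mul_assoc]
        refine mul_le_mul_of_nonneg_left ?_ hc
        rw [one_div_mul_one_div]
        exact one_div_le_one_div_of_le (by positivity) (by nlinarith)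
      have b1 := (ha (z + θ) (by linarith)).mul (by positivity) (by positivity) hv
      have b2 := (hb z θ hz h0 h1).mul (by positivity) zero_le_one
        fun m hm => abs_val_le_of_inner hg.1 hz0 hm
      have b3 := (ha (z + θ) (by linarith)).mul (by positivity) zero_le_one
        fun m hm => abs_val_le_of_inner hg.1 (show 0 < z + θ by linarith) hm
      have b4 := (ha z hz).mul (by positivity) zero_le_one
        fun m hm => abs_val_le_of_inner hg.1 hz0 hm
      -- Product rule for differences. A varying first letter gains 1/z against the size √z of the
      -- inner sum; otherwise the variation of the inner sum is already O(1/√z).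
      have e : ∀ n, plainSum (l :: l' :: w) (z + θ) n - plainSum (l :: l' :: w) z n =
          tailSum (fun m => (l.val (z + θ) m - l.val z m) * plainSum (l' :: w) (z + θ) m) n +
          tailSum (fun m => l.val z m *
            (plainSum (l' :: w) (z + θ) m - plainSum (l' :: w) z m)) n := by
        intro n
        rw [plainSum_cons, plainSum_cons, ← tailSum_sub b3 (by positivity) b4 (by positivity),
          ← tailSum_add b1 (by positivity) b2 (by positivity)]
        exact tailSum_congr (fun m _ => by ring) n
      intro n
      simp only [e]
      refine (abs_add_le _ _).trans ?_
      have t1 := b1.tailBound (by positivity) n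
      have t2 := b2.tailBound (by positivity) n
      refine (add_le_add t1 t2).trans ?_
      rw [← add_mul]
      refine mul_le_mul_of_nonneg_right ?_ (by positivity)
      have e1 : 1 / z * √z = 1 / √z := by
        have h := Real.mul_self_sqrt hz0.le
        field_simp
        rw [sq, h]
      have e2 : c * (1 / z) * (C * √(z + θ)) ≤ 2 * c * C * (1 / √z) := by
        calc c * (1 / z) * (C * √(z + θ)) ≤ c * (1 / z) * (C * (2 * √z)) := by gcongr
          _ = 2 * c * C * (1 / z * √z) := by ring
          _ = _ := by rw [e1]
      have e3 : 0 ≤ 4 * C * (1 / √z) := by positivity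
      nlinarith

theorem plainSum_slow (l : Letter) (w : List Letter) (hg : Good (l :: w)) (θ : ℝ) (h0 : 0 ≤ θ)
    (h1 : θ ≤ 1) :
    Tendsto (fun z => plainSum (l :: w) (z + θ) 0 - plainSum (l :: w) z 0) atTop (nhds 0) := by
  obtain ⟨C, hC, -, hb⟩ := plainSum_uniform l w hg
  refine squeeze_zero_norm' (a := fun z => C * (1 / √z)) ?_ ?_
  · filter_upwards [eventually_ge_atTop (1 : ℝ)] with z hz
    simpa using hb z θ hz h0 h1 0
  · have : Tendsto (fun z : ℝ => 1 / √z) atTop (nhds 0) :=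
      Tendsto.div_atTop tendsto_const_nhds Real.tendsto_sqrt_atTop
    simpa using this.const_mul C

theorem Comb.hasExpansion_of_words {N : ℕ}
    (h : ∀ w, Good w → w.length ≤ N → HasExpansion 0 fun z => plainSum w z 0)
    {φ : ℝ → ℕ → ℝ} (hφ : Comb N φ) : HasExpansion 0 fun z => φ z 0 := by
  induction hφ with
  | word w hg hw => exact h w hg hw
  | zero => exact HasExpansion.zero
  | add _ _ i1 i2 => exact i1.add i2
  | smul c _ i => exact i.const_mul c
  | div _ i => exact i.div.mono (Nat.zero_le _)
  | congr _ h i =>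
    refine i.congr ?_
    filter_upwards [eventually_gt_atTop (0 : ℝ)] with z hz
    rw [h z hz]

theorem DivComb.hasExpansion_of_words {N : ℕ}
    (h : ∀ w, Good w → w.length ≤ N → HasExpansion 0 fun z => plainSum w z 0)
    {φ : ℝ → ℕ → ℝ} (hφ : DivComb N φ) : HasExpansion 1 fun z => φ z 0 := by
  obtain ⟨ψ, hψ, e⟩ := hφ
  refine (hψ.hasExpansion_of_words h).div.congr ?_
  filter_upwards [eventually_gt_atTop (0 : ℝ)] with z hz
  rw [e z hz]

theorem hasExpansion_yp (l : Letter) : HasExpansion 1 fun z => l.yp ((0 + 1 : ℕ) + z) := by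
  have hw : HasExpansion 1 fun z : ℝ => 1 / (z + 1) := by
    simpa using HasExpansion.inv_add 1 zero_le_one 0
  cases l with
  | X a => exact HasExpansion.zero.congr (Eventually.of_forall fun z => by simp [yp])
  | Y b =>
    refine ((hw.pow (b + 1)).mono (q := 1) (by omega)).congr (Eventually.of_forall fun z => ?_)
    simp [yp, add_comm]
  | D =>
    refine (hw.const_mul (-1)).congr (Eventually.of_forall fun z => ?_)
    simp [yp, add_comm]

/-- Induction on the length through `nestedSum_shift`: S(z) - S(z+1) consists of the merger
corrections and of the contribution of the first Y. The former are shorter and divisible by 1/z, the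
latter is a shorter sum times a factor of order 1. -/
theorem hasExpansion_plainSum (N : ℕ) :
    ∀ w, Good w → w.length ≤ N → HasExpansion 0 fun z => plainSum w z 0 := by
  induction N with
  | zero =>
    intro w hg hw
    rw [List.length_eq_zero_iff.1 (Nat.le_zero.1 hw)] at hg
    exact hg.elim
  | succ N ih =>
    intro w hg hw
    rcases w with _ | ⟨l, w⟩
    · exact hg.elim
    have hN : w.length ≤ N := by simpa using hw
    refine HasExpansion.of_difference ?_ fun θ h0 h1 => plainSum_slow l w hg θ h0 h1
    have hA := ((divComb_nestedSum_sub_plainSum mergeBound_mergeXY mergeMixed_mergeXY hg).mono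
      hN).hasExpansion_of_words ih
    have hB := ((divComb_nestedSum_sub_plainSum mergeBound_mergeYX mergeMixed_mergeYX hg).mono
      hN).hasExpansion_of_words ih
    have hw' : HasExpansion 0 fun z => nestedSum mergeXY w z 0 := by
      rcases w with _ | ⟨l', w⟩
      · exact HasExpansion.const 1
      · have hg' : Good (l' :: w) := hg.2
        have h1 := ((divComb_nestedSum_sub_plainSum mergeBound_mergeXY mergeMixed_mergeXY
          hg').mono (show w.length ≤ N by simp at hN; omega)).hasExpansion_of_words ih
        exact ((h1.mono (Nat.zero_le _)).add (ih _ hg' hN)).congr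
          (Eventually.of_forall fun z => by ring)
    have h1 := (hA.shift 1 zero_le_one)
    have h2 := (hasExpansion_yp l).mul (hw'.shift 1 zero_le_one)
    refine ((h2.add h1).sub hB).congr ?_
    filter_upwards [eventually_gt_atTop (0 : ℝ)] with z hz
    rw [nestedSum_shift hz hg 0]
    ring

theorem DivComb.hasExpansion {N : ℕ} {φ : ℝ → ℕ → ℝ} (hφ : DivComb N φ) :
    HasExpansion 1 fun z => φ z 0 :=
  hφ.hasExpansion_of_words (hasExpansion_plainSum N)

end Ohno

/-! ### The function `shiftedSum`: iterated form, duality, expansion -/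

namespace Ohno

open scoped ENNReal
open Letter

/-- The tuples `n < n_1 < ⋯ < n_r` of natural numbers. -/
abbrev TupleAbove (r n : ℕ) : Type :=
  {t : Fin r → ℕ // (∀ j, n < t j) ∧ StrictMono t}

theorem strictMono_cons {r n : ℕ} {a : ℕ} (ha : n < a) {t : Fin r → ℕ} (ht : ∀ j, a < t j)
    (hm : StrictMono t) :
    (∀ j, n < (Fin.cons a t : Fin (r + 1) → ℕ) j) ∧ StrictMono (Fin.cons a t : Fin (r + 1) → ℕ) := by
  refine ⟨fun j => ?_, fun i j hij => ?_⟩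
  · refine Fin.cases ?_ (fun j => ?_) j
    · simpa using ha
    · simpa using ha.trans (ht j)
  · induction j using Fin.cases with
    | zero => exact absurd hij (Fin.not_lt_zero i)
    | succ j =>
      induction i using Fin.cases with
      | zero => simpa using ht j
      | succ i => simpa using hm (Fin.succ_lt_succ_iff.1 hij)

/-- Splitting off the first entry of a tuple. -/
def tupleEquiv (r n : ℕ) : (Σ i : ℕ, TupleAbove r (n + 1 + i)) ≃ TupleAbove (r + 1) n where
  toFun p := ⟨Fin.cons (n + 1 + p.1) p.2.1,
    strictMono_cons (by omega) p.2.2.1 p.2.2.2⟩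
  invFun t := ⟨t.1 0 - (n + 1), fun j => t.1 j.succ, fun j => by
      have h1 := t.2.1 0
      have h2 : t.1 0 < t.1 j.succ := t.2.2 (Fin.succ_pos j)
      show n + 1 + (t.1 0 - (n + 1)) < t.1 j.succ
      omega, fun i j h => t.2.2 (Fin.succ_lt_succ_iff.2 h)⟩
  left_inv p := by
    obtain ⟨i, t, h1, h2⟩ := p
    refine Sigma.subtype_ext ?_ ?_
    · simp
    · ext j
      simp
  right_inv t := by
    refine Subtype.ext ?_
    have h1 := t.2.1 0
    ext j
    refine Fin.cases ?_ (fun j => ?_) j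
    · simp only [Fin.cons_zero]
      omega
    · simp

/-- The summand `∏ 1 / (n_j ^ (k_j - 1) (n_j + y))`. -/
noncomputable def shiftedTerm {r : ℕ} (k : Fin r → ℕ) (y : ℝ) (n : Fin r → ℕ) : ℝ :=
  ∏ j, mixed (k j - 1) 1 y (n j)

theorem mixed_nonneg (a b : ℕ) {y : ℝ} (hy : 0 < y) (m : ℕ) : 0 ≤ mixed a b y m := by
  unfold mixed
  positivity

theorem shiftedTerm_nonneg {r : ℕ} (k : Fin r → ℕ) {y : ℝ} (hy : 0 < y) (n : Fin r → ℕ) :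
    0 ≤ shiftedTerm k y n :=
  Finset.prod_nonneg fun _ _ => mixed_nonneg _ _ hy _

theorem wordOp_replicate_false (y : ℝ) (c : ℕ) (f : ℕ → ℝ≥0∞) (m : ℕ) :
    wordOp y (List.replicate c false) f m = f m * ENNReal.ofReal (1 / (m : ℝ) ^ c) := by
  induction c with
  | zero => simp [wordOp]
  | succ c ih =>
    rw [List.replicate_succ, wordOp, letterOp, ih, mul_assoc,
      ← ENNReal.ofReal_mul (by positivity), pow_succ]
    congr 2
    rw [one_div_mul_one_div]

theorem wordOp_indexWord_cons (y : ℝ) (x : ℕ) (k : List ℕ) (f : ℕ → ℝ≥0∞) (n : ℕ) :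
    wordOp y (indexWord (x :: k)) f n =
      ∑' i : ℕ, ENNReal.ofReal (mixed (x - 1) 1 y (n + 1 + i)) *
        wordOp y (indexWord k) f (n + 1 + i) := by
  have e : indexWord (x :: k) = true :: (List.replicate (x - 1) false ++ indexWord k) := by
    simp [indexWord]
  rw [e, wordOp, letterOp]
  refine tsum_congr fun i => ?_
  rw [wordOp_append, wordOp_replicate_false, mul_assoc, ← ENNReal.ofReal_mul (by positivity),
    mul_comm]
  congr 2
  rw [one_div_mul_one_div, mixed, pow_one]

theorem tsum_shiftedTerm {y : ℝ} (hy : 0 < y) (k : List ℕ) (n : ℕ) :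
    ∑' t : TupleAbove k.length n, ENNReal.ofReal (shiftedTerm k.get y t.1) =
      wordOp y (indexWord k) (fun _ => 1) n := by
  induction k generalizing n with
  | nil =>
    have : Unique (TupleAbove ([] : List ℕ).length n) :=
      { default := ⟨fun j => j.elim0, fun j => j.elim0, fun j => j.elim0⟩
        uniq := fun _ => Subtype.ext (funext fun j => j.elim0) }
    rw [tsum_eq_single default fun t ht => absurd (this.uniq t) ht]
    simp [shiftedTerm, wordOp, indexWord]
  | cons x k ih =>
    rw [wordOp_indexWord_cons]
    have h := (tupleEquiv k.length n).tsum_eq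
      fun t => ENNReal.ofReal (shiftedTerm (x :: k).get y t.1)
    refine h.symm.trans ?_
    refine (ENNReal.tsum_sigma' _).trans ?_
    refine tsum_congr fun i => ?_
    rw [← ih, ← ENNReal.tsum_mul_left]
    refine tsum_congr fun t => ?_
    rw [← ENNReal.ofReal_mul (mixed_nonneg _ _ hy _)]
    congr 1
    unfold shiftedTerm
    exact Fin.prod_univ_succ _

/-- The series `∑ ∏ 1 / (n_j ^ (k_j - 1) (n_j + y))` over the tuples above `n`, as an iterated
series. -/
noncomputable def iteratedSum : List ℕ → ℝ → ℕ → ℝ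
  | [], _, _ => 1
  | x :: k, y, n => tailSum (fun m => mixed (x - 1) 1 y m * iteratedSum k y m) n

theorem Admissible.of_cons {x x' : ℕ} {k : List ℕ} (h : Admissible (x :: x' :: k)) :
    Admissible (x' :: k) := by
  obtain ⟨h1, h2, h3⟩ := h
  exact ⟨fun y hy => h1 y (by simp only [List.mem_cons] at hy ⊢; exact Or.inr hy),
    by simp, by simpa using h3⟩

/-- The last entry is at least 2, so its letter 1/(m^(x-1) (m + z)) is mixed and yields a factor
1/z, which survives all outer summations. This is why the expansion starts at a = 1. -/
theorem divComb_iteratedSum (k : List ℕ) (hk : Admissible k) :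
    DivComb k.length (iteratedSum k) := by
  induction k with
  | nil => exact absurd rfl hk.2.1
  | cons x k ih =>
    rcases k with _ | ⟨x', k⟩
    · have hx : 2 ≤ x := by simpa using hk.2.2
      refine (divComb_mixed_top (x - 2) 0).congr fun z _ n => ?_
      exact tailSum_congr (fun m _ => by
        simp only [iteratedSum, mul_one]; congr 1; omega) n
    · have ih := ih hk.of_cons
      have hx : 1 ≤ x := hk.1 x (by simp)
      rcases Nat.eq_or_lt_of_le hx with h | h
      · refine (ih.step (l := .Y 0) trivial).congr fun z _ n => ?_
        exact tailSum_congr (fun m _ => by simp [← h, mixed, val, xp, yp]) n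
      · refine (ih.comb.divComb_mixed (x - 2) 0).congr fun z _ n => ?_
        exact tailSum_congr (fun m _ => by congr 2; omega) n

/-- Finiteness lets the duality obtained in `ℝ≥0∞` descend to real numbers. -/
theorem wordOp_eq_iteratedSum {y : ℝ} (hy : 0 < y) (k : List ℕ) (hk : Admissible k) (n : ℕ) :
    0 ≤ iteratedSum k y n ∧
      wordOp y (indexWord k) (fun _ => 1) n = ENNReal.ofReal (iteratedSum k y n) := by
  induction k generalizing n with
  | nil => exact absurd rfl hk.2.1
  | cons x k ih =>
    have hx : 1 ≤ x := hk.1 x (by simp)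
    have key : (∀ m, 0 ≤ iteratedSum k y m ∧
          wordOp y (indexWord k) (fun _ => 1) m = ENNReal.ofReal (iteratedSum k y m)) ∧
        ∃ C, 0 ≤ C ∧ SummandBound C fun m => mixed (x - 1) 1 y m * iteratedSum k y m := by
      rcases k with _ | ⟨x', k⟩
      · have hx : 2 ≤ x := by simpa using hk.2.2
        refine ⟨fun m => ⟨by simp [iteratedSum], by simp [iteratedSum, indexWord, wordOp]⟩, 1,
          zero_le_one, ?_⟩
        simpa [iteratedSum] using summandBound_mixed (show 2 ≤ x - 1 + 1 by omega) hy
      · refine ⟨ih hk.of_cons, ?_⟩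
        exact (divComb_iteratedSum _ hk.of_cons).comb.summandBound hy fun m hm => by
          simpa using abs_mixed_le (a := x - 1) (b := 1) hy hm 1 (by omega)
    obtain ⟨hi, C, hC, hs⟩ := key
    have hnn : ∀ m, 0 ≤ mixed (x - 1) 1 y m * iteratedSum k y m := fun m =>
      mul_nonneg (mixed_nonneg _ _ hy m) (hi m).1
    refine ⟨tsum_nonneg fun j => hnn _, ?_⟩
    rw [wordOp_indexWord_cons, iteratedSum, tailSum,
      ENNReal.ofReal_tsum_of_nonneg (fun j => hnn _) (hs.summable hC n)]
    refine tsum_congr fun j => ?_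
    rw [(hi _).2, ← ENNReal.ofReal_mul (mixed_nonneg _ _ hy _)]

/-- The function `∑ ∏ 1 / (n_j ^ (k_j - 1) (n_j + y))` of `y`. -/
noncomputable def shiftedSum (k : List ℕ) (y : ℝ) : ℝ := iteratedSum k y 0

theorem hasSum_shiftedSum {y : ℝ} (hy : 0 < y) (k : List ℕ) (hk : Admissible k) :
    HasSum (fun t : IncTuple k.length => shiftedTerm k.get y t.1) (shiftedSum k y) := by
  have h1 := tsum_shiftedTerm hy k 0
  rw [(wordOp_eq_iteratedSum hy k hk 0).2] at h1
  have h2 := ENNReal.hasSum_toReal (h1.trans_ne ENNReal.ofReal_ne_top)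
  rw [← ENNReal.tsum_toReal_eq fun t => ENNReal.ofReal_ne_top, h1,
    ENNReal.toReal_ofReal (wordOp_eq_iteratedSum hy k hk 0).1] at h2
  refine h2.congr_fun fun t => ?_
  rw [ENNReal.toReal_ofReal (shiftedTerm_nonneg _ hy _)]

theorem shiftedSum_dual {y : ℝ} (hy : 0 < y) {k : List ℕ} (hk : Admissible k) :
    shiftedSum k y = shiftedSum (dual k) y := by
  have h := wordOp_indexWord_dual hy hk
  rw [(wordOp_eq_iteratedSum hy k hk 0).2, (wordOp_eq_iteratedSum hy _ hk.dual 0).2] at h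
  exact (ENNReal.ofReal_eq_ofReal_iff (wordOp_eq_iteratedSum hy k hk 0).1
    (wordOp_eq_iteratedSum hy _ hk.dual 0).1).1 h

theorem hasExpansion_shiftedSum {k : List ℕ} (hk : Admissible k) :
    HasExpansion 1 (shiftedSum k) :=
  (divComb_iteratedSum k hk).hasExpansion

end Ohno

namespace Ohno

open Finset

/-! ### Partial fractions -/

section Lagrange

variable {F : Type*} [Field F] {r : ℕ}

theorem sum_lagrange [NeZero r] {v : Fin r → F} (hv : Function.Injective v) :
    ∑ i, ∏ j ∈ univ.erase i,
      (Polynomial.C (v i - v j)⁻¹ * (Polynomial.X - Polynomial.C (v j))) = 1 := by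
  have h := Lagrange.sum_basis (s := (univ : Finset (Fin r))) (v := v) hv.injOn
    univ_nonempty
  simpa only [Lagrange.basis, Lagrange.basisDivisor] using h

theorem sum_prod_div_sub [NeZero r] {v : Fin r → F} (hv : Function.Injective v) (x : F) :
    ∑ i, ∏ j ∈ univ.erase i, (v j - x) / (v j - v i) = 1 := by
  have h := congrArg (Polynomial.eval x) (sum_lagrange hv)
  simp only [Polynomial.eval_finsetSum, Polynomial.eval_prod, Polynomial.eval_mul,
    Polynomial.eval_C, Polynomial.eval_sub, Polynomial.eval_X, Polynomial.eval_one] at h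
  rw [← h]
  refine sum_congr rfl fun i _ => prod_congr rfl fun j _ => ?_
  rw [← neg_sub x, ← neg_sub (v i), neg_div_neg_eq, div_eq_inv_mul]

/-- Partial fractions for `∏ 1 / (v_j + y)`. -/
theorem prod_one_div_add [NeZero r] {v : Fin r → F} (hv : Function.Injective v) {y : F}
    (hy : ∀ j, v j + y ≠ 0) :
    ∏ j, 1 / (v j + y) = ∑ i, (∏ j ∈ univ.erase i, 1 / (v j - v i)) * (1 / (v i + y)) := by
  -- At x = -y the numerators are v_j + y and cancel against the product, leaving one factor for
  -- each i.
  have h := sum_prod_div_sub hv (-y)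
  have h' := congrArg (fun x => (∏ j, 1 / (v j + y)) * x) h
  simp only [mul_one, mul_sum] at h'
  rw [← h']
  refine sum_congr rfl fun i _ => ?_
  rw [← mul_prod_erase univ _ (mem_univ i), mul_assoc, ← prod_mul_distrib, mul_comm]
  congr 1
  refine prod_congr rfl fun j _ => ?_
  have := hy j
  rw [sub_neg_eq_add]
  field_simp

theorem one_sub_mul_geometric (a : F) :
    (1 - PowerSeries.C a * PowerSeries.X) * PowerSeries.mk (fun n => a ^ n) = 1 := by
  ext n
  rw [sub_mul, one_mul, mul_assoc]
  cases n with
  | zero => simp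
  | succ n => simp [PowerSeries.coeff_succ_X_mul, pow_succ', PowerSeries.coeff_one]

/-- The complete homogeneous symmetric functions in `1 / v_j`. -/
theorem sum_piAntidiag_prod_pow [NeZero r] {v : Fin r → F} (hv : Function.Injective v)
    (h0 : ∀ j, v j ≠ 0) (m : ℕ) :
    ∑ e ∈ piAntidiag univ m, ∏ j, (1 / v j) ^ e j =
      ∑ i, (1 / v i) ^ m * ∏ j ∈ univ.erase i, v j / (v j - v i) := by
  have h := congrArg (Polynomial.coeToPowerSeries.ringHom (R := F)) (sum_lagrange hv)
  simp only [map_sum, map_prod, map_mul, map_sub, map_one,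
    Polynomial.coeToPowerSeries.ringHom_apply, Polynomial.coe_C, Polynomial.coe_X] at h
  -- Each Lagrange factor is v_j/(v_j - v_i) · (1 - X/v_j) and cancels the geometric series of
  -- 1/v_j; only the series of 1/v_i remains.
  have h1 : ∀ i, (∏ j ∈ univ.erase i, (PowerSeries.C (v i - v j)⁻¹ *
      (PowerSeries.X - PowerSeries.C (v j)))) * ∏ j, PowerSeries.mk (fun n => (1 / v j) ^ n) =
      PowerSeries.C (∏ j ∈ univ.erase i, v j / (v j - v i)) *
        PowerSeries.mk (fun n => (1 / v i) ^ n) := by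
    intro i
    rw [← prod_erase_mul univ _ (mem_univ i), ← mul_assoc, ← prod_mul_distrib, map_prod]
    congr 1
    refine prod_congr rfl fun j _ => ?_
    have e : (PowerSeries.C (v i - v j)⁻¹ * (PowerSeries.X - PowerSeries.C (v j)) :
        PowerSeries F) = PowerSeries.C (v j / (v j - v i)) *
          (1 - PowerSeries.C (1 / v j) * PowerSeries.X) := by
      have e1 : v j / (v j - v i) = (v i - v j)⁻¹ * (- v j) := by
        rw [← neg_sub (v i), div_eq_inv_mul, inv_neg]
        ring
      have e2 : (PowerSeries.C (-v j) * PowerSeries.C (1 / v j) : PowerSeries F) = -1 := by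
        rw [← map_mul, neg_mul, mul_one_div_cancel (h0 j), map_neg, map_one]
      rw [e1, map_mul, mul_assoc, mul_sub (PowerSeries.C (-v j)), ← mul_assoc (PowerSeries.C (-v j)), e2, map_neg]
      ring
    rw [e, mul_assoc, one_sub_mul_geometric, mul_one]
  have h2 : ∏ j, PowerSeries.mk (fun n => (1 / v j) ^ n) =
      ∑ i, PowerSeries.C (∏ j ∈ univ.erase i, v j / (v j - v i)) *
        PowerSeries.mk (fun n => (1 / v i) ^ n) := by
    rw [← one_mul (∏ j, _), ← h, sum_mul]
    exact sum_congr rfl fun i _ => h1 i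
  have h3 := congrArg (PowerSeries.coeff m) h2
  rw [PowerSeries.coeff_prod, map_sum] at h3
  simp only [PowerSeries.coeff_mk, PowerSeries.coeff_C_mul] at h3
  refine Eq.trans ?_ (h3.trans (sum_congr rfl fun i _ => mul_comm _ _))
  symm
  refine sum_bij (fun f _ => (f : Fin r → ℕ)) (fun f hf => ?_) (fun f _ g _ hfg => ?_)
    (fun f hf => ?_) fun f _ => rfl
  · rw [mem_finsuppAntidiag] at hf
    simpa using hf.1
  · exact DFunLike.coe_injective hfg
  · refine ⟨Finsupp.equivFunOnFinite.symm f, ?_, by simp⟩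
    simpa using hf

end Lagrange

/-- The coefficient of `1 / (n_i + y)` in the partial fraction decomposition of
`∏ 1 / (n_j ^ (k_j - 1) (n_j + y))`. -/
noncomputable def coef {r : ℕ} (k : Fin r → ℕ) (i : Fin r) (n : Fin r → ℕ) : ℝ :=
  (∏ j, 1 / (n j : ℝ) ^ (k j - 1)) * ∏ j ∈ univ.erase i, 1 / ((n j : ℝ) - n i)

theorem IncTuple.cast_injective {r : ℕ} (n : IncTuple r) (R : Type*) [AddMonoidWithOne R]
    [CharZero R] : Function.Injective fun j => (n.1 j : R) :=
  Nat.cast_injective.comp n.2.2.injective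

/-- Separates the dependence on s: the summands of I_k(s) and the partial fractions of `shiftedTerm`
share their coefficients. -/
theorem term_eq_coef {r : ℕ} {k : Fin r → ℕ} (hk : ∀ j, 1 ≤ k j) (s : ℂ) (i : Fin r)
    (n : IncTuple r) : term k s i n = (coef k i n.1 : ℂ) * (n.1 i : ℂ) ^ (-(s + 1)) := by
  have h0 : ∀ j, (n.1 j : ℂ) ≠ 0 := fun j => Nat.cast_ne_zero.2 (n.2.1 j).ne'
  have e1 : (∏ j, (n.1 j : ℂ) ^ k j) =
      (∏ j, (n.1 j : ℂ) ^ (k j - 1)) * ((n.1 i : ℂ) * ∏ j ∈ univ.erase i, (n.1 j : ℂ)) := by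
    rw [mul_prod_erase univ (fun j => (n.1 j : ℂ)) (mem_univ i), ← prod_mul_distrib]
    refine prod_congr rfl fun j _ => ?_
    rw [← pow_succ, Nat.sub_add_cancel (hk j)]
  have h1 : ∏ j ∈ univ.erase i, (n.1 j : ℂ) ≠ 0 := prod_ne_zero_iff.2 fun j _ => h0 j
  have h2 : (n.1 i : ℂ) ^ s ≠ 0 := by simp [Complex.cpow_eq_zero_iff, h0 i]
  rw [term, e1, coef, Complex.cpow_neg, Complex.cpow_add _ _ (h0 i), Complex.cpow_one]
  push_cast
  simp only [prod_div_distrib, prod_const_one]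
  have h3 : ∏ j, (n.1 j : ℂ) ^ (k j - 1) ≠ 0 := prod_ne_zero_iff.2 fun j _ => pow_ne_zero _ (h0 j)
  have := h0 i
  field_simp

theorem shiftedTerm_eq_sum {r : ℕ} [NeZero r] (k : Fin r → ℕ) {y : ℝ} (hy : 0 < y)
    (n : IncTuple r) :
    shiftedTerm k y n.1 = ∑ i, coef k i n.1 * (1 / (n.1 i + y)) := by
  simp only [shiftedTerm, mixed, pow_one, ← one_div_mul_one_div, prod_mul_distrib]
  rw [prod_one_div_add (n.cast_injective ℝ) fun j => by positivity, mul_sum]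
  exact sum_congr rfl fun i _ => by rw [coef, mul_assoc]

theorem sum_mzvTerm {r : ℕ} [NeZero r] (k : Fin r → ℕ) (m : ℕ) (n : IncTuple r) :
    ∑ e ∈ piAntidiag univ m, mzvTerm (k + e) n = ∑ i, term k m i n := by
  have h0 : ∀ j, (n.1 j : ℂ) ≠ 0 := fun j => Nat.cast_ne_zero.2 (n.2.1 j).ne'
  have h := congrArg (fun x => mzvTerm k n * x)
    (sum_piAntidiag_prod_pow (n.cast_injective ℂ) h0 m)
  simp only [mul_sum] at h
  refine Eq.trans (sum_congr rfl fun e _ => ?_) (h.trans (sum_congr rfl fun i _ => ?_))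
  · simp only [mzvTerm, Pi.add_apply, pow_add, prod_mul_distrib, one_div, inv_pow, prod_inv_distrib,
      mul_inv]
  · rw [term, mzvTerm, Complex.cpow_natCast, one_div_pow, ← mul_assoc]

end Ohno

namespace Ohno

open Finset

/-! ### Absolute convergence -/

theorem summable_prod_apply {r : ℕ} {f : ℕ → ℝ} (h0 : ∀ m, 0 ≤ f m) (hf : Summable f) :
    Summable fun x : Fin r → ℕ => ∏ j, f (x j) := by
  classical
  refine summable_of_sum_le (c := ∏ _j : Fin r, ∑' m, f m)
    (fun x => prod_nonneg fun j _ => h0 _) fun u => ?_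
  calc ∑ x ∈ u, ∏ j, f (x j)
      ≤ ∑ x ∈ Fintype.piFinset fun j => u.image fun x => x j, ∏ j, f (x j) := by
        refine sum_le_sum_of_subset_of_nonneg (fun x hx => ?_)
          fun x _ _ => prod_nonneg fun j _ => h0 _
        exact Fintype.mem_piFinset.2 fun j => mem_image_of_mem _ hx
    _ = ∏ j, ∑ m ∈ u.image fun x => x j, f m := by rw [prod_univ_sum]
    _ ≤ _ := prod_le_prod (fun j _ => sum_nonneg fun m _ => h0 m)
        fun j _ => hf.sum_le_tsum _ fun m _ => h0 m

/-- The entry `n_i` of a tuple and the distances of the other entries from it. -/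
def distances {r : ℕ} (i : Fin r) (n : Fin r → ℕ) (j : Fin r) : ℕ :=
  if j = i then n i else if j < i then n i - n j else n j - n i

theorem distances_injective {r : ℕ} (i : Fin r) :
    Function.Injective fun n : IncTuple r => distances i n.1 := by
  intro n n' h
  have hj := fun j => congrFun h j
  have hi : n.1 i = n'.1 i := by simpa [distances] using hj i
  refine Subtype.ext (funext fun j => ?_)
  rcases lt_trichotomy j i with h1 | rfl | h1
  · have := hj j
    simp only [distances, if_neg h1.ne, if_pos h1] at this
    have h2 := n.2.2 h1
    have h3 := n'.2.2 h1
    omega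
  · exact hi
  · have := hj j
    simp only [distances, if_neg h1.ne', if_neg h1.not_gt] at this
    have h2 := n.2.2 h1
    have h3 := n'.2.2 h1
    omega

theorem distances_pos {r : ℕ} (i : Fin r) (n : IncTuple r) (j : Fin r) :
    0 < distances i n.1 j := by
  rcases lt_trichotomy j i with h1 | rfl | h1
  · have h2 := n.2.2 h1
    simp only [distances, if_neg h1.ne, if_pos h1]
    omega
  · simpa [distances] using n.2.1 j
  · have h2 := n.2.2 h1
    simp only [distances, if_neg h1.ne', if_neg h1.not_gt]
    omega

theorem distances_le {r : ℕ} (i : Fin r) (n : IncTuple r) {L : Fin r} (hL : ∀ j, j ≤ L)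
    (j : Fin r) : distances i n.1 j ≤ n.1 L := by
  have h1 := n.2.2.monotone (hL i)
  have h2 := n.2.2.monotone (hL j)
  unfold distances
  split_ifs <;> omega

theorem abs_sub_eq_distances {r : ℕ} (i : Fin r) (n : IncTuple r) {j : Fin r} (hj : j ≠ i) :
    |(n.1 j : ℝ) - n.1 i| = distances i n.1 j := by
  rcases lt_or_gt_of_ne hj with h1 | h1
  · have h2 := n.2.2 h1
    rw [distances, if_neg hj, if_pos h1, Nat.cast_sub h2.le, abs_sub_comm, abs_of_nonneg]
    simpa using h2.le
  · have h2 := n.2.2 h1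
    rw [distances, if_neg hj, if_neg h1.not_gt, Nat.cast_sub h2.le, abs_of_nonneg]
    simpa using h2.le

/-- Of all the powers in the denominator only one factor of the entry n_L is kept, available since
k_L ≥ 2. -/
theorem abs_coef_le {r : ℕ} {k : Fin r → ℕ} {L : Fin r} (hL : 2 ≤ k L) (i : Fin r)
    (n : IncTuple r) :
    |coef k i n.1| ≤ 1 / (n.1 L : ℝ) * ∏ j ∈ univ.erase i, 1 / (distances i n.1 j : ℝ) := by
  have hn : ∀ j, (1 : ℝ) ≤ n.1 j := fun j => by exact_mod_cast n.2.1 j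
  rw [coef, abs_mul, abs_prod (univ.erase i)]
  refine mul_le_mul ?_ (le_of_eq ?_) (prod_nonneg fun _ _ => abs_nonneg _) (by positivity)
  · rw [abs_of_nonneg (by positivity), ← mul_prod_erase univ _ (mem_univ L)]
    refine (mul_le_mul (one_div_le_one_div_of_le (by linarith [hn L]) ?_)
      (prod_le_one (fun j _ => by positivity) fun j _ => ?_)
      (by positivity) (by positivity)).trans_eq (mul_one _)
    · exact le_self_pow₀ (hn L) (by omega)
    · exact div_le_one_of_le₀ (one_le_pow₀ (hn j)) (by positivity)
  · refine prod_congr rfl fun j hj => ?_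
    rw [abs_div, abs_one, abs_sub_eq_distances i n (ne_of_mem_erase hj)]

/-- When L is the last position, n_L dominates n_i and every distance, so 1/n_L together with
n_i^(-ε) can be distributed over all of them to push each exponent below -1. -/
theorem abs_coef_mul_rpow_le {r : ℕ} [NeZero r] {k : Fin r → ℕ} {L : Fin r}
    (hL : 2 ≤ k L) (hmax : ∀ j, j ≤ L) {ε : ℝ} (h0 : 0 < ε) (h1 : ε ≤ 1) (i : Fin r)
    (n : IncTuple r) :
    |coef k i n.1| * (n.1 i : ℝ) ^ (-ε) ≤ ∏ j, (distances i n.1 j : ℝ) ^ (-(1 + ε / r)) := by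
  have hr : (0 : ℝ) < r := by exact_mod_cast Nat.pos_of_ne_zero (NeZero.ne r)
  set η := ε / r with hη
  have hη0 : 0 < η := by positivity
  have hφ : ∀ j, (0 : ℝ) < distances i n.1 j := fun j => by exact_mod_cast distances_pos i n j
  have hφL : ∀ j, (distances i n.1 j : ℝ) ≤ n.1 L := fun j => by
    exact_mod_cast distances_le i n hmax j
  have hni : (0 : ℝ) < n.1 i := by exact_mod_cast n.2.1 i
  have hnL : (0 : ℝ) < n.1 L := by exact_mod_cast n.2.1 L
  have hii : (distances i n.1 i : ℝ) = n.1 i := by simp [distances]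
  -- Bounding every base by n_L gives the total exponent 1 + η - ε + (r - 1)η = 1, as rη = ε. The
  -- exponent of n_i is nonnegative because ε ≤ 1.
  have key : (n.1 i : ℝ) ^ (1 + η - ε) * ∏ j ∈ univ.erase i, (distances i n.1 j : ℝ) ^ η ≤
      n.1 L := by
    have e1 : (n.1 i : ℝ) ^ (1 + η - ε) ≤ (n.1 L : ℝ) ^ (1 + η - ε) :=
      Real.rpow_le_rpow hni.le (hii ▸ hφL i) (by linarith)
    have e2 : ∏ j ∈ univ.erase i, (distances i n.1 j : ℝ) ^ η ≤
        ∏ j ∈ univ.erase i, (n.1 L : ℝ) ^ η :=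
      prod_le_prod (fun j _ => by positivity) fun j _ =>
        Real.rpow_le_rpow (hφ j).le (hφL j) hη0.le
    refine (mul_le_mul e1 e2 (by positivity) (by positivity)).trans_eq ?_
    rw [prod_const, card_erase_of_mem (mem_univ i), card_fin, ← Real.rpow_mul_natCast hnL.le,
      ← Real.rpow_add hnL, Nat.cast_sub (Nat.pos_of_ne_zero (NeZero.ne r))]
    have : 1 + η - ε + η * ((r : ℝ) - (1 : ℕ)) = 1 := by
      rw [hη]
      field_simp
      push_cast
      ring
    rw [this, Real.rpow_one]
  refine (mul_le_mul_of_nonneg_right (abs_coef_le hL i n) (by positivity)).trans ?_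
  rw [← mul_prod_erase univ (fun j => (distances i n.1 j : ℝ) ^ (-(1 + η))) (mem_univ i), hii]
  have e3 : ∏ j ∈ univ.erase i, (distances i n.1 j : ℝ) ^ (-(1 + η)) =
      (∏ j ∈ univ.erase i, 1 / (distances i n.1 j : ℝ)) *
        (∏ j ∈ univ.erase i, (distances i n.1 j : ℝ) ^ η)⁻¹ := by
    rw [← prod_inv_distrib, ← prod_mul_distrib]
    refine prod_congr rfl fun j _ => ?_
    rw [Real.rpow_neg (hφ j).le, Real.rpow_add (hφ j), Real.rpow_one, mul_inv, one_div]
  have e4 : (n.1 i : ℝ) ^ (-(1 + η)) = (n.1 i : ℝ) ^ (-ε) * ((n.1 i : ℝ) ^ (1 + η - ε))⁻¹ := by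
    rw [← Real.rpow_neg hni.le, ← Real.rpow_add hni]
    congr 1
    ring
  rw [e3, e4]
  have e5 := inv_anti₀ (mul_pos (Real.rpow_pos_of_pos hni _)
    (prod_pos fun j _ => Real.rpow_pos_of_pos (hφ j) _)) key
  rw [mul_inv] at e5
  have hP : 0 ≤ (∏ j ∈ univ.erase i, 1 / (distances i n.1 j : ℝ)) * (n.1 i : ℝ) ^ (-ε) := by
    positivity
  have := mul_le_mul_of_nonneg_left e5 hP
  rw [one_div]
  linarith

theorem summable_abs_coef_mul_rpow {r : ℕ} [NeZero r] {k : Fin r → ℕ} {L : Fin r}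
    (hL : 2 ≤ k L) (hmax : ∀ j, j ≤ L) {ε : ℝ} (h0 : 0 < ε) (i : Fin r) :
    Summable fun n : IncTuple r => |coef k i n.1| * (n.1 i : ℝ) ^ (-ε) := by
  have hr : (0 : ℝ) < r := by exact_mod_cast Nat.pos_of_ne_zero (NeZero.ne r)
  -- The bound requires ε ≤ 1; a larger ε only makes the terms smaller, since n_i ≥ 1.
  have h0' : 0 < min ε 1 := lt_min h0 one_pos
  have hs : Summable fun m : ℕ => (m : ℝ) ^ (-(1 + min ε 1 / r)) := by
    rw [Real.summable_nat_rpow]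
    have : 0 < min ε 1 / r := by positivity
    linarith
  refine Summable.of_nonneg_of_le (fun n => by positivity) (fun n => ?_)
    ((summable_prod_apply (fun m => by positivity) hs).comp_injective (distances_injective i))
  refine le_trans ?_ (abs_coef_mul_rpow_le hL hmax h0' (min_le_right _ _) i n)
  refine mul_le_mul_of_nonneg_left ?_ (abs_nonneg _)
  exact Real.rpow_le_rpow_of_exponent_le (by exact_mod_cast n.2.1 i)
    (neg_le_neg (min_le_left _ _))

theorem Admissible.exists_last {k : List ℕ} (hk : Admissible k) :
    ∃ L : Fin k.length, 2 ≤ k.get L ∧ ∀ j, j ≤ L := by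
  obtain ⟨-, hne, h⟩ := hk
  have := List.length_pos_of_ne_nil hne
  refine ⟨⟨k.length - 1, by omega⟩, ?_, fun j => ?_⟩
  · rwa [List.getLast_eq_getElem] at h
  · rw [Fin.le_def]
    have := j.2
    show (j : ℕ) ≤ k.length - 1
    omega

theorem Admissible.neZero_length {k : List ℕ} (hk : Admissible k) : NeZero k.length :=
  ⟨(List.length_pos_of_ne_nil hk.2.1).ne'⟩

theorem Admissible.one_le_get {k : List ℕ} (hk : Admissible k) (j : Fin k.length) :
    1 ≤ k.get j := hk.1 _ (List.get_mem k j)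

theorem Admissible.summable_coef {k : List ℕ} (hk : Admissible k) {ε : ℝ} (h0 : 0 < ε)
    (i : Fin k.length) :
    Summable fun n : IncTuple k.length => |coef k.get i n.1| * (n.1 i : ℝ) ^ (-ε) := by
  obtain ⟨L, hL, hmax⟩ := hk.exists_last
  have := hk.neZero_length
  exact summable_abs_coef_mul_rpow hL hmax h0 i

theorem norm_term {r : ℕ} {k : Fin r → ℕ} (hk : ∀ j, 1 ≤ k j) (s : ℂ) (i : Fin r)
    (n : IncTuple r) : ‖term k s i n‖ = |coef k i n.1| * (n.1 i : ℝ) ^ (-(s.re + 1)) := by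
  rw [term_eq_coef hk, norm_mul, Complex.norm_real, Real.norm_eq_abs,
    Complex.norm_natCast_cpow_of_pos (n.2.1 i)]
  simp

theorem Admissible.convergesAbsolutely {k : List ℕ} (hk : Admissible k) {s : ℂ}
    (hs : -1 < s.re) : ConvergesAbsolutely k s := fun i => by
  simp only [norm_term hk.one_le_get]
  exact hk.summable_coef (by linarith) i

/-- On Re s > σ > -1 the terms are dominated by their norms at real part σ, so the series converges
locally uniformly. -/
theorem Admissible.differentiableOn_I {k : List ℕ} (hk : Admissible k) :
    DifferentiableOn ℂ (I k) {s | -1 < s.re} := by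
  refine DifferentiableOn.fun_sum fun i _ s (hs : -1 < s.re) => ?_
  obtain ⟨σ, h1, h2⟩ := exists_between hs
  have ho : IsOpen {s : ℂ | σ < s.re} := isOpen_lt continuous_const Complex.continuous_re
  have hsum := hk.summable_coef (ε := σ + 1) (by linarith) i
  have := Complex.differentiableOn_tsum_of_summable_norm (F := fun n s => term k.get s i n) hsum
    (fun n z hz => ?_) ho fun n z hz => ?_
  · exact (this.differentiableAt (ho.mem_nhds h2)).differentiableWithinAt
  · simp only [term_eq_coef hk.one_le_get]
    have h0 : (n.1 i : ℂ) ≠ 0 := Nat.cast_ne_zero.2 (n.2.1 i).ne'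
    refine DifferentiableAt.differentiableWithinAt ?_
    exact (DifferentiableAt.const_cpow (by fun_prop) (Or.inl h0)).const_mul _
  · rw [norm_term hk.one_le_get]
    refine mul_le_mul_of_nonneg_left ?_ (abs_nonneg _)
    exact Real.rpow_le_rpow_of_exponent_le (by exact_mod_cast n.2.1 i)
      (by have : σ < z.re := hz; linarith)

/-- Since 1/n ≤ 2/(n + 1), a summand is at most 2^r times `shiftedTerm` at y = 1, and increasing the
exponents only helps. -/
theorem Admissible.summable_mzvTerm {k : List ℕ} (hk : Admissible k) (e : Fin k.length → ℕ) :
    Summable (mzvTerm (k.get + e)) := by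
  have := hk.neZero_length
  have hs := (hasSum_shiftedSum one_pos k hk).summable.mul_left ((2 : ℝ) ^ k.length)
  refine Summable.of_norm_bounded hs fun n => ?_
  have h1 : ∀ j, (1 : ℝ) ≤ n.1 j := fun j => by exact_mod_cast n.2.1 j
  rw [mzvTerm, norm_div, norm_one, norm_prod, shiftedTerm]
  have e2 : (2 : ℝ) ^ k.length = ∏ _j : Fin k.length, (2 : ℝ) := by simp
  rw [e2, ← prod_mul_distrib, one_div, ← prod_inv_distrib]
  refine prod_le_prod (fun j _ => by positivity) fun j _ => ?_
  have h := h1 j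
  have hx : (0 : ℝ) < n.1 j := by linarith
  rw [norm_pow, Complex.norm_natCast, mixed, pow_one, Pi.add_apply]
  have hkj : k.get j = k.get j - 1 + 1 := (Nat.sub_add_cancel (hk.one_le_get j)).symm
  rw [← one_div]
  calc 1 / (n.1 j : ℝ) ^ (k.get j + e j) ≤ 1 / (n.1 j : ℝ) ^ (k.get j) :=
        one_div_le_one_div_of_le (by positivity) (pow_le_pow_right₀ h (Nat.le_add_right _ _))
    _ = 1 / ((n.1 j : ℝ) ^ (k.get j - 1) * n.1 j) := by rw [← pow_succ, ← hkj]
    _ = 2 * (1 / ((n.1 j : ℝ) ^ (k.get j - 1) * (n.1 j + n.1 j))) := by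
        field_simp
        norm_num
    _ ≤ _ := by gcongr

theorem Admissible.I_natCast {k : List ℕ} (hk : Admissible k) (m : ℕ) :
    I k m = ohnoSum k m := by
  have := hk.neZero_length
  have hs : ∀ i, Summable fun n : IncTuple k.length => term k.get m i n := fun i =>
    (hk.convergesAbsolutely (s := m) (by
      have : (0 : ℝ) ≤ m := m.cast_nonneg
      simp only [Complex.natCast_re]
      linarith) i).of_norm
  rw [I, ← Summable.tsum_finsetSum fun i _ => hs i, ohnoSum]
  simp only [mzv]
  rw [← Summable.tsum_finsetSum fun e _ => hk.summable_mzvTerm e]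
  exact tsum_congr fun n => (sum_mzvTerm k.get m n).symm

end Ohno

namespace Ohno

open MeasureTheory Set Filter Asymptotics

/-! ### The Mellin transform of `shiftedSum` -/

theorem continuousOn_one_div_add {c : ℝ} (hc : 0 < c) :
    ContinuousOn (fun y : ℝ => (1 / (c + y : ℂ))) (Ioi 0) := by
  refine ContinuousOn.div (by fun_prop) (by fun_prop) fun y hy => ?_
  have : (0 : ℝ) < c + y := add_pos hc hy
  exact_mod_cast this.ne'

theorem mellinConvergent_one_div_add {c : ℝ} (hc : 0 < c) {w : ℂ} (h0 : 0 < w.re)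
    (h1 : w.re < 1) : MellinConvergent (fun y : ℝ => 1 / (c + y : ℂ)) w := by
  refine mellinConvergent_of_isBigO_rpow (a := 1) (b := 0)
    ((continuousOn_one_div_add hc).locallyIntegrableOn measurableSet_Ioi) ?_ h1 ?_ h0
  · refine IsBigO.of_bound 1 ?_
    filter_upwards [eventually_gt_atTop (0 : ℝ)] with y hy
    have e : (c + y : ℂ) = ((c + y : ℝ) : ℂ) := by push_cast; rfl
    rw [e, norm_div, Complex.norm_real, norm_one, Real.rpow_neg hy.le, Real.rpow_one, one_mul,
      Real.norm_of_nonneg (by positivity), Real.norm_of_nonneg (by positivity), one_div]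
    exact inv_anti₀ hy (by linarith)
  · refine IsBigO.of_bound (1 / c) ?_
    filter_upwards [self_mem_nhdsWithin] with y hy
    have hy : 0 < y := hy
    have e : (c + y : ℂ) = ((c + y : ℝ) : ℂ) := by push_cast; rfl
    rw [e, norm_div, Complex.norm_real, norm_one, neg_zero, Real.rpow_zero, norm_one, mul_one,
      Real.norm_of_nonneg (by positivity)]
    exact one_div_le_one_div_of_le hc (by linarith)

theorem image_div_one_add : (fun y : ℝ => y / (1 + y)) '' Ioi 0 = Ioo 0 1 := by
  ext x
  constructor
  · rintro ⟨y, hy, rfl⟩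
    have hy : 0 < y := hy
    exact ⟨by positivity, (div_lt_one (by positivity)).2 (by linarith)⟩
  · rintro ⟨h0, h1⟩
    have h2 : 0 < 1 - x := by linarith
    refine ⟨x / (1 - x), div_pos h0 h2, ?_⟩
    field_simp
    ring

/-- The substitution x = y/(1 + y) turns the integral into the beta integral B(w, 1 - w). -/
theorem mellin_one_div_one_add {w : ℂ} (h0 : 0 < w.re) (h1 : w.re < 1) :
    mellin (fun y : ℝ => 1 / (1 + y : ℂ)) w = Complex.Gamma w * Complex.Gamma (1 - w) := by
  have hb := Complex.Gamma_mul_Gamma_eq_betaIntegral h0 (t := 1 - w) (by simpa using h1)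
  rw [add_sub_cancel, Complex.Gamma_one, one_mul] at hb
  rw [hb, Complex.betaIntegral, intervalIntegral.integral_of_le zero_le_one,
    integral_Ioc_eq_integral_Ioo, ← image_div_one_add,
    integral_image_eq_integral_abs_deriv_smul measurableSet_Ioi
      (f' := fun y => 1 / (1 + y) ^ 2)]
  · refine setIntegral_congr_fun measurableSet_Ioi fun y (hy : 0 < y) => ?_
    have h2 : 0 < 1 + y := by linarith
    have h3 : ((1 + y : ℝ) : ℂ) ≠ 0 := by exact_mod_cast h2.ne'
    have e1 : (1 : ℂ) - ((y / (1 + y) : ℝ) : ℂ) = ((1 + y : ℝ) : ℂ)⁻¹ := by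
      push_cast at h3 ⊢
      field_simp
      ring
    have e2 : (((1 + y : ℝ) : ℂ)⁻¹) ^ (1 - w - 1) = ((1 + y : ℝ) : ℂ) ^ w := by
      rw [Complex.inv_cpow _ _ (by rw [Complex.arg_ofReal_of_nonneg h2.le]; exact Real.pi_pos.ne),
        ← Complex.cpow_neg]
      congr 1
      ring
    have e3 : (((y / (1 + y) : ℝ) : ℂ)) ^ (w - 1) =
        (y : ℂ) ^ (w - 1) * (((1 + y : ℝ) : ℂ) * (((1 + y : ℝ) : ℂ) ^ w)⁻¹) := by
      rw [Complex.ofReal_div, div_eq_mul_inv, ← Complex.ofReal_inv,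
        Complex.mul_cpow_ofReal_nonneg hy.le (by positivity), Complex.ofReal_inv,
        Complex.inv_cpow _ _ (by rw [Complex.arg_ofReal_of_nonneg h2.le]; exact Real.pi_pos.ne),
        ← Complex.cpow_neg, neg_sub, Complex.cpow_sub _ _ h3, Complex.cpow_one, div_eq_mul_inv]
    have h4 : ((1 + y : ℝ) : ℂ) ^ w ≠ 0 := by
      rw [Ne, Complex.cpow_eq_zero_iff]
      exact fun h => h3 h.1
    show (y : ℂ) ^ (w - 1) • (1 / (1 + y : ℂ)) = |1 / (1 + y) ^ 2| •
      ((((y / (1 + y) : ℝ) : ℂ)) ^ (w - 1) * (1 - ((y / (1 + y) : ℝ) : ℂ)) ^ (1 - w - 1))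
    rw [e1, e2, e3, abs_of_nonneg (by positivity), Complex.real_smul, smul_eq_mul]
    have e4 : (1 + y : ℂ) = ((1 + y : ℝ) : ℂ) := by push_cast; rfl
    rw [e4, Complex.ofReal_div, Complex.ofReal_pow, Complex.ofReal_one]
    field_simp
  · intro y hy
    have h2 : (1 + y : ℝ) ≠ 0 := by
      have hy : 0 < y := hy
      positivity
    have := (hasDerivAt_id y).div ((hasDerivAt_id y).const_add 1) h2
    refine (this.congr_deriv ?_).hasDerivWithinAt
    simp
  · intro x hx y hy h
    have hx : 0 < x := hx
    have hy : 0 < y := hy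
    have h : x / (1 + x) = y / (1 + y) := h
    rw [div_eq_div_iff (by positivity) (by positivity)] at h
    linarith

theorem mellin_one_div_add {c : ℝ} (hc : 0 < c) (w : ℂ) :
    mellin (fun y : ℝ => 1 / (c + y : ℂ)) w =
      (c : ℂ) ^ (w - 1) * mellin (fun y : ℝ => 1 / (1 + y : ℂ)) w := by
  have hc' : (c : ℂ) ≠ 0 := by exact_mod_cast hc.ne'
  have e : (fun y : ℝ => 1 / (c + y : ℂ)) =
      fun y : ℝ => (c : ℂ)⁻¹ • (fun y : ℝ => 1 / (1 + y : ℂ)) (c⁻¹ * y) := by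
    funext y
    simp only [smul_eq_mul]
    push_cast
    rw [inv_mul_eq_div, div_div, add_mul, one_mul, mul_right_comm, inv_mul_cancel₀ hc', one_mul]
  rw [e, mellin_const_smul,
    mellin_comp_mul_left (fun y : ℝ => 1 / (1 + y : ℂ)) w (inv_pos.2 hc), smul_eq_mul, smul_eq_mul,
    ← mul_assoc, Complex.ofReal_inv,
    Complex.inv_cpow _ _ (by rw [Complex.arg_ofReal_of_nonneg hc.le]; exact Real.pi_pos.ne),
    ← Complex.cpow_neg, neg_neg, Complex.cpow_sub _ _ hc', Complex.cpow_one]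
  congr 1
  rw [div_eq_inv_mul]

theorem Admissible.summable_coef_prod {k : List ℕ} (hk : Admissible k) {ε : ℝ} (h0 : 0 < ε) :
    Summable fun p : Fin k.length × IncTuple k.length =>
      |coef k.get p.1 p.2.1| * (p.2.1 p.1 : ℝ) ^ (-ε) := by
  rw [summable_prod_of_nonneg fun p => by positivity]
  exact ⟨fun i => hk.summable_coef h0 i, (hasSum_fintype _).summable⟩

theorem abs_coef_mul_le {r : ℕ} (k : Fin r → ℕ) (i : Fin r) (n : IncTuple r) {y : ℝ}
    (hy : 0 < y) : |coef k i n.1 * (1 / (n.1 i + y))| ≤ |coef k i n.1| * (n.1 i : ℝ) ^ (-1 : ℝ) := by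
  have h : (0 : ℝ) < n.1 i := by exact_mod_cast n.2.1 i
  rw [abs_mul, abs_of_nonneg (a := 1 / (n.1 i + y)) (by positivity), Real.rpow_neg h.le,
    Real.rpow_one, ← one_div]
  exact mul_le_mul_of_nonneg_left (one_div_le_one_div_of_le h (by linarith)) (abs_nonneg _)

/-- The family over pairs (i, n) is dominated by |c_i(n)|/n_i, so it may be summed over i first,
which reassembles `shiftedTerm`. -/
theorem Admissible.hasSum_coef {k : List ℕ} (hk : Admissible k) {y : ℝ} (hy : 0 < y) :
    HasSum (fun p : Fin k.length × IncTuple k.length =>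
      coef k.get p.1 p.2.1 * (1 / (p.2.1 p.1 + y))) (shiftedSum k y) := by
  have := hk.neZero_length
  have hs : Summable fun p : Fin k.length × IncTuple k.length =>
      coef k.get p.1 p.2.1 * (1 / (p.2.1 p.1 + y)) :=
    Summable.of_norm_bounded (hk.summable_coef_prod one_pos) fun p => abs_coef_mul_le _ _ _ hy
  have h1 := ((Equiv.prodComm _ _).hasSum_iff (f := fun p : Fin k.length × IncTuple k.length =>
      coef k.get p.1 p.2.1 * (1 / (p.2.1 p.1 + y)))).2 hs.hasSum
  have h2 := h1.prod_fiberwise fun n => hasSum_fintype _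
  have h3 := h2.unique (((hasSum_shiftedSum hy k hk).congr_fun fun n => ?_))
  · rw [← h3]
    exact hs.hasSum
  · exact (shiftedTerm_eq_sum k.get hy n).symm

theorem Admissible.continuousOn_shiftedSum {k : List ℕ} (hk : Admissible k) :
    ContinuousOn (shiftedSum k) (Ioi 0) := by
  have h := continuousOn_tsum (s := Ioi (0 : ℝ))
    (f := fun (p : Fin k.length × IncTuple k.length) (y : ℝ) =>
      coef k.get p.1 p.2.1 * (1 / (p.2.1 p.1 + y))) (fun p => ?_)
    (hk.summable_coef_prod one_pos) fun p y hy => abs_coef_mul_le _ _ _ hy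
  · exact h.congr fun y hy => (hk.hasSum_coef hy).tsum_eq.symm
  · refine continuousOn_const.mul (ContinuousOn.div (by fun_prop) (by fun_prop) fun y hy => ?_)
    have hy : 0 < y := hy
    positivity

theorem Admissible.exists_abs_shiftedSum_le {k : List ℕ} (hk : Admissible k) :
    ∃ C, ∀ y, 0 < y → |shiftedSum k y| ≤ C :=
  ⟨_, fun _ hy => (hk.hasSum_coef hy).norm_le_of_bounded (hk.summable_coef_prod one_pos).hasSum
    fun _ => abs_coef_mul_le _ _ _ hy⟩

/-- Taking norms replaces w by Re w and leaves a nonnegative integrand, so the L¹ norm is again an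
explicit Mellin transform. It justifies the termwise integration. -/
theorem integral_norm_cpow_div {c : ℝ} (hc : 0 < c) (w : ℂ) :
    ∫ y in Ioi (0 : ℝ), ‖(y : ℂ) ^ (w - 1) • (1 / (c + y : ℂ))‖ =
      c ^ (w.re - 1) * ‖mellin (fun y : ℝ => 1 / (1 + y : ℂ)) w.re‖ := by
  have h := congrArg norm (mellin_one_div_add hc w.re)
  rw [norm_mul, Complex.norm_cpow_eq_rpow_re_of_pos hc, Complex.sub_re, Complex.ofReal_re,
    Complex.one_re] at h
  rw [← h, mellin]
  have e : ∫ y in Ioi (0 : ℝ), (y : ℂ) ^ ((w.re : ℂ) - 1) • (1 / (c + y : ℂ)) =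
      ∫ y in Ioi (0 : ℝ), ((‖(y : ℂ) ^ (w - 1) • (1 / (c + y : ℂ))‖ : ℝ) : ℂ) := by
    refine setIntegral_congr_fun measurableSet_Ioi fun y (hy : 0 < y) => ?_
    have e1 : (c + y : ℂ) = ((c + y : ℝ) : ℂ) := by push_cast; rfl
    have h1 : 0 ≤ c + y := by positivity
    simp only [smul_eq_mul, norm_mul, norm_div, norm_one, Complex.norm_cpow_eq_rpow_re_of_pos hy,
      Complex.sub_re, Complex.one_re, e1, Complex.norm_real, Real.norm_of_nonneg h1]
    push_cast
    rw [Complex.ofReal_cpow hy.le]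
    push_cast
    rfl
  rw [e, integral_complex_ofReal, Complex.norm_real, Real.norm_of_nonneg]
  exact integral_nonneg fun y => norm_nonneg _

/-- The Mellin transform of `shiftedSum k` is `I_k(-w)` up to a gamma factor. -/
theorem Admissible.mellin_shiftedSum {k : List ℕ} (hk : Admissible k) {w : ℂ} (h0 : 0 < w.re)
    (h1 : w.re < 1) :
    mellin (fun y => (shiftedSum k y : ℂ)) w =
      I k (-w) * (Complex.Gamma w * Complex.Gamma (1 - w)) := by
  set κ := mellin (fun y : ℝ => 1 / (1 + y : ℂ)) with hκ
  have hpos : ∀ p : Fin k.length × IncTuple k.length, (0 : ℝ) < p.2.1 p.1 := fun p => by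
    exact_mod_cast p.2.2.1 p.1
  let F : Fin k.length × IncTuple k.length → ℝ → ℂ := fun p y =>
    (coef k.get p.1 p.2.1 : ℂ) * ((y : ℂ) ^ (w - 1) • (1 / (((p.2.1 p.1 : ℝ) : ℂ) + y)))
  have hint : ∀ p, IntegrableOn (F p) (Ioi 0) := fun p =>
    (mellinConvergent_one_div_add (hpos p) h0 h1).const_mul _
  have hsum : Summable fun p => ∫ y in Ioi (0 : ℝ), ‖F p y‖ := by
    refine ((hk.summable_coef_prod (ε := 1 - w.re) (by linarith)).mul_right ‖κ w.re‖).congr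
      fun p => ?_
    simp only [F, norm_mul (coef k.get p.1 p.2.1 : ℂ)]
    rw [integral_const_mul, integral_norm_cpow_div (hpos p), Complex.norm_real, Real.norm_eq_abs,
      neg_sub, mul_assoc]
  have h2 := hasSum_integral_of_summable_integral_norm hint hsum
  have h3 : ∀ p, ∫ y in Ioi (0 : ℝ), F p y = term k.get (-w) p.1 p.2 * κ w := by
    intro p
    rw [term_eq_coef hk.one_le_get, mul_assoc]
    simp only [F]
    rw [integral_const_mul]
    congr 1
    refine (mellin_one_div_add (hpos p) w).trans ?_
    rw [neg_add, neg_neg, ← sub_eq_add_neg, Complex.ofReal_natCast]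
  have h4 : ∫ y in Ioi (0 : ℝ), ∑' p, F p y = mellin (fun y => (shiftedSum k y : ℂ)) w := by
    refine setIntegral_congr_fun measurableSet_Ioi fun y (hy : 0 < y) => ?_
    have := ((Complex.hasSum_ofReal.2 (hk.hasSum_coef hy)).mul_left ((y : ℂ) ^ (w - 1))).tsum_eq
    refine Eq.trans (tsum_congr fun p => ?_) this
    simp only [F, smul_eq_mul]
    push_cast
    ring
  rw [h4] at h2
  simp only [h3] at h2
  have hsm : Summable fun p : Fin k.length × IncTuple k.length => term k.get (-w) p.1 p.2 := by
    refine Summable.of_norm ((hk.summable_coef_prod (ε := 1 - w.re) (by linarith)).congr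
      fun p => ?_)
    rw [norm_term hk.one_le_get]
    congr 2
    simp
    ring
  have h5 : ∑' p : Fin k.length × IncTuple k.length, term k.get (-w) p.1 p.2 = I k (-w) := by
    rw [hsm.tsum_prod, tsum_fintype, I]
  rw [← mellin_one_div_one_add h0 h1, ← hκ, ← h5, ← tsum_mul_right, h2.tsum_eq]

theorem Gamma_mul_Gamma_one_sub_mul_sin {w : ℂ} (h0 : 0 < w.re) (h1 : w.re < 1) :
    Complex.Gamma w * Complex.Gamma (1 - w) * (Complex.sin (Real.pi * w) / Real.pi) = 1 := by
  have hne : Complex.Gamma w * Complex.Gamma (1 - w) ≠ 0 :=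
    mul_ne_zero (Complex.Gamma_ne_zero_of_re_pos h0)
      (Complex.Gamma_ne_zero_of_re_pos (by simpa using h1))
  have e := Complex.Gamma_mul_Gamma_one_sub w
  have hs : Complex.sin (Real.pi * w) ≠ 0 := fun h => hne (by rw [e, h, div_zero])
  have hp : (Real.pi : ℂ) ≠ 0 := by exact_mod_cast Real.pi_ne_zero
  rw [e]
  field_simp

theorem Admissible.I_eq_mellin {k : List ℕ} (hk : Admissible k) {s : ℂ} (h0 : -1 < s.re)
    (h1 : s.re < 0) :
    I k s = mellin (fun y => (shiftedSum k y : ℂ)) (-s) *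
      (Complex.sin (Real.pi * -s) / Real.pi) := by
  have h0' : 0 < (-s).re := by simpa using h1
  have h1' : (-s).re < 1 := by simpa using by linarith
  rw [hk.mellin_shiftedSum h0' h1', mul_assoc, Gamma_mul_Gamma_one_sub_mul_sin h0' h1', neg_neg,
    mul_one]

end Ohno

namespace Ohno

open MeasureTheory Set Filter Asymptotics

/-! ### Meromorphic continuation of Mellin transforms -/

/-- The restriction of a real function to `(1, ∞)`, with complex values. -/
noncomputable def cutoff (e : ℝ → ℝ) : ℝ → ℂ := indicator (Ioi 1) fun y => (e y : ℂ)

theorem cutoff_isBigO_zero (e : ℝ → ℝ) (a : ℝ) : cutoff e =O[nhdsWithin 0 (Ioi 0)] (· ^ a) := by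
  refine IsBigO.of_bound 0 ?_
  filter_upwards [mem_nhdsWithin_of_mem_nhds (Iio_mem_nhds one_pos)] with y hy
  rw [cutoff, indicator_of_notMem (by simpa using le_of_lt hy)]
  simp

theorem cutoff_isBigO_atTop {e : ℝ → ℝ} {g : ℝ → ℝ} (h : e =O[atTop] g) :
    cutoff e =O[atTop] g := by
  refine IsBigO.trans (IsBigO.of_bound 1 ?_) h
  filter_upwards with y
  rw [cutoff, one_mul]
  exact (norm_indicator_le_norm_self _ _).trans_eq (Complex.norm_real _)

theorem cutoff_locallyIntegrableOn {e : ℝ → ℝ} (he : ContinuousOn e (Ioi 0)) :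
    LocallyIntegrableOn (cutoff e) (Ioi 0) := by
  rw [locallyIntegrableOn_iff isOpen_Ioi.isLocallyClosed]
  intro K hK hc
  have h : ContinuousOn (fun y => (e y : ℂ)) K :=
    Complex.continuous_ofReal.comp_continuousOn (he.mono hK)
  exact (h.integrableOn_compact hc).indicator measurableSet_Ioi

theorem continuousOn_logPow (a b : ℕ) : ContinuousOn (logPow a b) (Ioi 0) := by
  have h : ∀ y ∈ Ioi (0 : ℝ), y ≠ 0 := fun y hy => ne_of_gt hy
  exact ((Real.continuousOn_log.mono h).pow b).div (by fun_prop) fun y hy => pow_ne_zero _ (h y hy)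

theorem continuousOn_of_mem {p : ℕ} {e : ℝ → ℝ} (he : e ∈ logPowSpan p) :
    ContinuousOn e (Ioi 0) := by
  induction he using Submodule.span_induction with
  | mem g hg =>
    obtain ⟨a, b, -, rfl⟩ := hg
    exact continuousOn_logPow a b
  | zero => exact continuousOn_const
  | add f g _ _ hf hg => exact hf.add hg
  | smul c f _ hf => exact hf.const_smul c

theorem logPow_isBigO_rpow (a b : ℕ) {c : ℝ} (hc : c < a) :
    logPow a b =O[atTop] fun y => y ^ (-c) := by
  have h := (isLittleO_log_rpow_rpow_atTop b (sub_pos.2 hc)).isBigO.mul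
    (isBigO_refl (fun y : ℝ => (y ^ a)⁻¹) atTop)
  refine h.congr' (Eventually.of_forall fun y => ?_) ?_
  · simp [logPow, div_eq_mul_inv]
  · filter_upwards [eventually_gt_atTop (0 : ℝ)] with y hy
    rw [← Real.rpow_natCast, ← Real.rpow_neg hy.le, ← Real.rpow_add hy]
    congr 1
    ring

theorem mellinConvergent_cutoff_logPow (a b : ℕ) {w : ℂ} (hw : w.re < a) :
    MellinConvergent (cutoff (logPow a b)) w ∧
      HasDerivAt (mellin (cutoff (logPow a b))) (mellin (cutoff (logPow a (b + 1))) w) w := by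
  have hl := cutoff_locallyIntegrableOn (continuousOn_logPow a b)
  obtain ⟨c, h1, h2⟩ := exists_between hw
  have ht := cutoff_isBigO_atTop (logPow_isBigO_rpow a b h2)
  have hb := cutoff_isBigO_zero (logPow a b) (-(w.re - 1))
  refine ⟨mellinConvergent_of_isBigO_rpow hl ht h1 hb (by linarith), ?_⟩
  have h := (mellin_hasDerivAt_of_isBigO_rpow hl ht h1 hb (by linarith)).2
  have e : (fun t : ℝ => Real.log t • cutoff (logPow a b) t) = cutoff (logPow a (b + 1)) := by
    funext t
    by_cases ht : t ∈ Ioi (1 : ℝ)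
    · simp only [cutoff, indicator_of_mem ht, logPow, Complex.real_smul]
      push_cast
      ring
    · simp [cutoff, indicator_of_notMem ht]
  rwa [e] at h

/-- For b = 0 the transform is ∫_1^∞ t^(w-1-a) dt = 1/(a - w); differentiating in w inserts one
factor log t at a time. -/
theorem exists_meromorphicOn_mellin_logPow (a b : ℕ) :
    ∃ M : ℂ → ℂ, MeromorphicOn M univ ∧
      ∀ w : ℂ, w.re < a → HasMellin (cutoff (logPow a b)) w (M w) := by
  induction b with
  | zero =>
    refine ⟨fun w => 1 / (a - w), fun w _ => by fun_prop, fun w hw =>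
      ⟨(mellinConvergent_cutoff_logPow a 0 hw).1, ?_⟩⟩
    have h1 : (w - 1 - a).re < -1 := by
      simp only [Complex.sub_re, Complex.one_re, Complex.natCast_re]
      linarith
    have h2 : mellin (cutoff (logPow a 0)) w = ∫ t in Ioi (1 : ℝ), (t : ℂ) ^ (w - 1 - a) := by
      have e : ∀ t ∈ Ioi (0 : ℝ), (t : ℂ) ^ (w - 1) • cutoff (logPow a 0) t =
          indicator (Ioi 1) (fun t : ℝ => (t : ℂ) ^ (w - 1 - a)) t := by
        intro t ht
        have ht0 : (t : ℂ) ≠ 0 := by exact_mod_cast ne_of_gt ht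
        by_cases h : t ∈ Ioi (1 : ℝ)
        · rw [cutoff, indicator_of_mem h, indicator_of_mem h, Complex.cpow_sub (w - 1) _ ht0,
            Complex.cpow_natCast, logPow, pow_zero, smul_eq_mul]
          push_cast
          rw [mul_one_div]
        · simp [cutoff, indicator_of_notMem h]
      rw [mellin, setIntegral_congr_fun measurableSet_Ioi e, setIntegral_indicator measurableSet_Ioi,
        inter_eq_self_of_subset_right (Ioi_subset_Ioi zero_le_one)]
    rw [h2, integral_Ioi_cpow_of_lt h1 one_pos, Complex.ofReal_one, Complex.one_cpow,
      neg_div, ← div_neg]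
    congr 1
    ring
  | succ b ih =>
    obtain ⟨M, hM, h⟩ := ih
    refine ⟨deriv M, hM.deriv, fun w hw => ⟨(mellinConvergent_cutoff_logPow a (b + 1) hw).1, ?_⟩⟩
    have ho : IsOpen {w : ℂ | w.re < a} := isOpen_lt Complex.continuous_re continuous_const
    have e : M =ᶠ[nhds w] mellin (cutoff (logPow a b)) := by
      filter_upwards [ho.mem_nhds hw] with z hz using (h z hz).2.symm
    rw [e.deriv_eq, (mellinConvergent_cutoff_logPow a b hw).2.deriv]

theorem exists_meromorphicOn_mellin_cutoff {e : ℝ → ℝ} (he : e ∈ logPowSpan 1) :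
    ∃ M : ℂ → ℂ, MeromorphicOn M univ ∧
      ∀ w : ℂ, w.re < 1 → HasMellin (cutoff e) w (M w) := by
  induction he using Submodule.span_induction with
  | mem g hg =>
    obtain ⟨a, b, ha, rfl⟩ := hg
    obtain ⟨M, hM, h⟩ := exists_meromorphicOn_mellin_logPow a b
    have ha' : (1 : ℝ) ≤ a := by exact_mod_cast ha
    exact ⟨M, hM, fun w hw => h w (hw.trans_le ha')⟩
  | zero =>
    refine ⟨fun _ => 0, fun w _ => by fun_prop, fun w _ => ?_⟩
    have e : cutoff 0 = fun _ => 0 := by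
      funext y
      simp [cutoff]
    rw [e]
    exact ⟨by simp [MellinConvergent], by simp [mellin]⟩
  | add f g _ _ hf hg =>
    obtain ⟨M, hM, h⟩ := hf
    obtain ⟨N, hN, h'⟩ := hg
    refine ⟨M + N, hM.add hN, fun w hw => ?_⟩
    have e : cutoff (f + g) = fun y => cutoff f y + cutoff g y := by
      funext y
      by_cases hy : y ∈ Ioi (1 : ℝ)
      · simp [cutoff, indicator_of_mem hy]
      · simp [cutoff, indicator_of_notMem hy]
    rw [e, Pi.add_apply, ← (h w hw).2, ← (h' w hw).2]
    exact hasMellin_add (h w hw).1 (h' w hw).1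
  | smul c f _ hf =>
    obtain ⟨M, hM, h⟩ := hf
    refine ⟨(fun _ => (c : ℂ)) • M, fun w hw => (MeromorphicAt.const _ _).smul (hM w hw),
      fun w hw => ?_⟩
    have e : cutoff (c • f) = fun y => (c : ℂ) • cutoff f y := by
      funext y
      by_cases hy : y ∈ Ioi (1 : ℝ)
      · simp [cutoff, indicator_of_mem hy]
      · simp [cutoff, indicator_of_notMem hy]
    rw [e, Pi.smul_apply', ← (h w hw).2]
    exact hasMellin_const_smul (h w hw).1 _

/-- The Mellin transform of a bounded continuous function with a complete asymptotic expansion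
continues meromorphically. -/
theorem HasExpansion.exists_meromorphicOn_mellin {f : ℝ → ℝ} (hf : HasExpansion 1 f)
    (hc : ContinuousOn f (Ioi 0)) {C : ℝ} (hC : ∀ y, 0 < y → |f y| ≤ C) {K : ℕ} (hK : 1 ≤ K) :
    ∃ M : ℂ → ℂ, MeromorphicOn M {w | 0 < w.re ∧ w.re < K} ∧
      ∀ w : ℂ, 0 < w.re → w.re < 1 → mellin (fun y => (f y : ℂ)) w = M w := by
  obtain ⟨e, he, hO⟩ := hf K
  obtain ⟨N, hN, hmN⟩ := exists_meromorphicOn_mellin_cutoff he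
  -- Subtracting e only on (1, ∞) keeps h bounded near 0 while h = O(y^(-K)) at infinity, so its
  -- transform is holomorphic on 0 < Re w < K.
  let h : ℝ → ℂ := fun y => (f y : ℂ) - cutoff e y
  have hl : LocallyIntegrableOn h (Ioi 0) :=
    ((Complex.continuous_ofReal.comp_continuousOn hc).locallyIntegrableOn
      measurableSet_Ioi).sub (cutoff_locallyIntegrableOn (continuousOn_of_mem he))
  have ht : h =O[atTop] fun y => y ^ (-(K : ℝ)) := by
    refine (IsBigO.of_bound 1 ?_).trans (hO.congr' EventuallyEq.rfl ?_)
    · filter_upwards [eventually_gt_atTop (1 : ℝ)] with y hy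
      simp only [h, cutoff, indicator_of_mem (mem_Ioi.2 hy), one_mul]
      rw [← Complex.ofReal_sub, Complex.norm_real]
    · filter_upwards [eventually_gt_atTop (0 : ℝ)] with y hy
      rw [Real.rpow_neg hy.le, Real.rpow_natCast]
  have hb : h =O[nhdsWithin 0 (Ioi 0)] fun y => y ^ (-(0 : ℝ)) := by
    refine IsBigO.sub (IsBigO.of_bound C ?_) (cutoff_isBigO_zero e _)
    filter_upwards [self_mem_nhdsWithin] with y hy
    simpa using hC y hy
  have hK' : (1 : ℝ) ≤ K := by exact_mod_cast hK
  have ho : IsOpen {w : ℂ | 0 < w.re ∧ w.re < K} :=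
    (isOpen_lt continuous_const Complex.continuous_re).inter
      (isOpen_lt Complex.continuous_re continuous_const)
  refine ⟨fun w => mellin h w + N w, fun w hw => ?_, fun w h0 h1 => ?_⟩
  · have hd : DifferentiableOn ℂ (mellin h) {w : ℂ | 0 < w.re ∧ w.re < K} := fun z hz =>
      (mellin_differentiableAt_of_isBigO_rpow hl ht hz.2 hb hz.1).differentiableWithinAt
    exact (hd.analyticAt (ho.mem_nhds hw)).meromorphicAt.add (hN w trivial)
  · have := hasMellin_add
      (mellinConvergent_of_isBigO_rpow hl ht (h1.trans_le hK') hb h0) (hmN w h1).1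
    show _ = mellin h w + N w
    rw [← (hmN w h1).2, ← this.2]
    simp [h]

/-! ### Gluing -/

/-- Vanishing of F - G to infinite order spreads over a preconnected set, and normal forms that
agree on a punctured neighbourhood agree at its centre. Equality thus holds at poles too. -/
theorem eqOn_of_meromorphicNFOn {U : Set ℂ} (hU : IsPreconnected U) {F G : ℂ → ℂ}
    (hF : MeromorphicNFOn F U) (hG : MeromorphicNFOn G U) {z : ℂ} (hz : z ∈ U)
    (h : F =ᶠ[nhds z] G) : EqOn F G U := by
  intro s hs
  have hm := hF.meromorphicOn.sub hG.meromorphicOn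
  have hz' : meromorphicOrderAt (F - G) z = ⊤ := by
    rw [meromorphicOrderAt_eq_top_iff]
    filter_upwards [h.filter_mono nhdsWithin_le_nhds] with x hx
    simp [hx]
  have hs' : meromorphicOrderAt (F - G) s = ⊤ := by
    by_contra hne
    exact hm.meromorphicOrderAt_ne_top_of_isPreconnected hU hs hz hne hz'
  rw [meromorphicOrderAt_eq_top_iff] at hs'
  have he : F =ᶠ[nhdsWithin s {s}ᶜ] G := by
    filter_upwards [hs'] with x hx using sub_eq_zero.1 hx
  exact (((hF hs).eventuallyEq_nhdsNE_iff_eventuallyEq_nhds (hG hs)).1 he).eq_of_nhds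

theorem isPreconnected_halfPlane (c : ℝ) : IsPreconnected {s : ℂ | c < s.re} :=
  (convex_halfSpace_re_gt c).isPreconnected

theorem isOpen_halfPlane (c : ℝ) : IsOpen {s : ℂ | c < s.re} :=
  isOpen_lt continuous_const Complex.continuous_re

/-- The two functions agree on the common strip and are glued; passing to the normal form changes no
value where the result is analytic, in particular none for Re s > -1. -/
theorem exists_meromorphicNFOn_halfPlane {g : ℂ → ℂ} (hg : DifferentiableOn ℂ g {s | -1 < s.re})
    {K : ℕ} {M : ℂ → ℂ} (hM : MeromorphicOn M {s | -(K : ℝ) < s.re ∧ s.re < 0})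
    (h : ∀ s : ℂ, -1 < s.re → s.re < 0 → M s = g s) :
    ∃ F : ℂ → ℂ, MeromorphicNFOn F {s | -(K : ℝ) < s.re} ∧
      ∀ s : ℂ, -(K : ℝ) < s.re → -1 < s.re → F s = g s := by
  classical
  let F0 : ℂ → ℂ := fun s => if -1 < s.re then g s else M s
  have e1 : ∀ s : ℂ, -1 < s.re → F0 =ᶠ[nhds s] g := fun s hs => by
    filter_upwards [(isOpen_halfPlane (-1)).mem_nhds hs] with z hz using if_pos hz
  have ha : ∀ s : ℂ, -1 < s.re → AnalyticAt ℂ F0 s := fun s hs =>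
    (hg.analyticAt ((isOpen_halfPlane (-1)).mem_nhds hs)).congr (e1 s hs).symm
  have hF0 : MeromorphicOn F0 {s | -(K : ℝ) < s.re} := by
    intro s (hs : -(K : ℝ) < s.re)
    rcases lt_or_ge (-1) s.re with h1 | h1
    · exact (ha s h1).meromorphicAt
    · have h0 : s.re < 0 := by linarith
      have ho : IsOpen {s : ℂ | s.re < 0} := isOpen_lt Complex.continuous_re continuous_const
      have e2 : M =ᶠ[nhds s] F0 := by
        filter_upwards [ho.mem_nhds h0] with z hz
        by_cases hz1 : -1 < z.re
        · simp only [F0, if_pos hz1, h z hz1 hz]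
        · simp only [F0, if_neg hz1]
      exact (hM s ⟨hs, h0⟩).congr (e2.filter_mono nhdsWithin_le_nhds)
  refine ⟨toMeromorphicNFOn F0 {s | -(K : ℝ) < s.re}, meromorphicNFOn_toMeromorphicNFOn _ _,
    fun s hs h1 => ?_⟩
  rw [toMeromorphicNFOn_eq_toMeromorphicNFAt hF0 hs,
    toMeromorphicNFAt_eq_self.2 (ha s h1).meromorphicNFAt, (e1 s h1).eq_of_nhds]

theorem exists_meromorphicNFOn_univ {g : ℂ → ℂ} (hg : DifferentiableOn ℂ g {s | -1 < s.re})
    (h : ∀ K : ℕ, 1 ≤ K → ∃ M : ℂ → ℂ, MeromorphicOn M {s | -(K : ℝ) < s.re ∧ s.re < 0} ∧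
      ∀ s : ℂ, -1 < s.re → s.re < 0 → M s = g s) :
    ∃ F : ℂ → ℂ, MeromorphicNFOn F univ ∧ ∀ s : ℂ, -1 < s.re → F s = g s := by
  have h' : ∀ K : ℕ, ∃ F : ℂ → ℂ, MeromorphicNFOn F {s | -((K + 1 : ℕ) : ℝ) < s.re} ∧
      ∀ s : ℂ, -1 < s.re → F s = g s := fun K => by
    obtain ⟨M, hM, hMg⟩ := h (K + 1) (by omega)
    obtain ⟨F, hF, hFg⟩ := exists_meromorphicNFOn_halfPlane hg hM hMg
    refine ⟨F, hF, fun s hs => hFg s ?_ hs⟩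
    have : (0 : ℝ) ≤ K := K.cast_nonneg
    push_cast
    linarith
  choose F hF hFg using h'
  have hle : ∀ K K' : ℕ, K ≤ K' → ∀ s : ℂ, -((K + 1 : ℕ) : ℝ) < s.re → F K s = F K' s := by
    intro K K' hKK' s hs
    have h0 : (0 : ℂ) ∈ {s : ℂ | -((K + 1 : ℕ) : ℝ) < s.re} := by
      show -((K + 1 : ℕ) : ℝ) < (0 : ℂ).re
      rw [Complex.zero_re, neg_lt_zero]
      positivity
    have hKK'' : ((K + 1 : ℕ) : ℝ) ≤ ((K' + 1 : ℕ) : ℝ) := by exact_mod_cast Nat.succ_le_succ hKK'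
    refine eqOn_of_meromorphicNFOn (isPreconnected_halfPlane _) (hF K)
      (fun z hz => hF K' (lt_of_le_of_lt (neg_le_neg hKK'') hz)) h0 ?_ hs
    filter_upwards [(isOpen_halfPlane (-1)).mem_nhds (show (-1 : ℝ) < (0 : ℂ).re by simp)]
      with z hz
    rw [hFg K z hz, hFg K' z hz]
  have heq : ∀ K K' : ℕ, ∀ s : ℂ, -((K + 1 : ℕ) : ℝ) < s.re → -((K' + 1 : ℕ) : ℝ) < s.re →
      F K s = F K' s := by
    intro K K' s h1 h2
    rcases le_total K K' with h | h
    · exact hle K K' h s h1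
    · exact (hle K' K h s h2).symm
  have hN : ∀ s : ℂ, -((⌊|s.re|⌋₊ + 1 : ℕ) : ℝ) < s.re := fun s => by
    have h1 := Nat.lt_floor_add_one |s.re|
    have h2 := neg_abs_le s.re
    push_cast
    linarith
  -- The index makes the half-plane Re z > -(⌊|Re s|⌋ + 1) contain s. Near s the index may change,
  -- but by `heq` the values coincide with those of a single `F K`.
  refine ⟨fun s => F ⌊|s.re|⌋₊ s, fun s _ => ?_, fun s hs => hFg _ s hs⟩
  refine (meromorphicNFAt_congr ?_).2 (hF ⌊|s.re|⌋₊ (hN s))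
  filter_upwards [(isOpen_halfPlane _).mem_nhds (hN s)] with z hz
  exact heq _ _ z (hN z) hz

end Ohno

namespace Ohno

open Set Filter

/-! ### The duality of `I_k` -/

/-- The Mellin formula is available only on the strip -1 < Re s < 0, where equality of the functions
`shiftedSum` suffices; the identity theorem carries it to Re s > -1. -/
theorem Admissible.I_dual {k : List ℕ} (hk : Admissible k) {s : ℂ} (hs : -1 < s.re) :
    I k s = I (Ohno.dual k) s := by
  have hstrip : ∀ z : ℂ, -1 < z.re → z.re < 0 → I k z = I (Ohno.dual k) z := fun z h0 h1 => by
    rw [hk.I_eq_mellin h0 h1, hk.dual.I_eq_mellin h0 h1]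
    congr 1
    refine MeasureTheory.setIntegral_congr_fun measurableSet_Ioi fun y (hy : 0 < y) => ?_
    simp only [shiftedSum_dual hy hk]
  have ho := isOpen_halfPlane (-1)
  have ho' : IsOpen {z : ℂ | z.re < 0} := isOpen_lt Complex.continuous_re continuous_const
  have hz : ((-1 / 2 : ℝ) : ℂ) ∈ {z : ℂ | -1 < z.re} := by
    show -1 < ((-1 / 2 : ℝ) : ℂ).re
    rw [Complex.ofReal_re]
    norm_num
  have hz' : ((-1 / 2 : ℝ) : ℂ) ∈ {z : ℂ | z.re < 0} := by
    show ((-1 / 2 : ℝ) : ℂ).re < 0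
    rw [Complex.ofReal_re]
    norm_num
  refine (hk.differentiableOn_I.analyticOnNhd ho).eqOn_of_preconnected_of_eventuallyEq
    (hk.dual.differentiableOn_I.analyticOnNhd ho) (isPreconnected_halfPlane _) hz ?_ hs
  filter_upwards [ho.mem_nhds hz, ho'.mem_nhds hz'] with z h0 h1 using hstrip z h0 h1

theorem Admissible.exists_continuation {k : List ℕ} (hk : Admissible k) :
    ∃ F : ℂ → ℂ, IsMeromorphicContinuation k F := by
  obtain ⟨C, hC⟩ := hk.exists_abs_shiftedSum_le
  refine exists_meromorphicNFOn_univ hk.differentiableOn_I fun K hK => ?_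
  obtain ⟨M, hM, h⟩ := (hasExpansion_shiftedSum hk).exists_meromorphicOn_mellin
    hk.continuousOn_shiftedSum hC hK
  refine ⟨fun s => M (-s) * (Complex.sin (Real.pi * -s) / Real.pi), fun s hs => ?_,
    fun s h0 h1 => ?_⟩
  · have hs' : -s ∈ {w : ℂ | 0 < w.re ∧ w.re < K} := by
      have := hs.1
      have := hs.2
      exact ⟨by rw [Complex.neg_re]; linarith, by rw [Complex.neg_re]; linarith⟩
    refine ((hM _ hs').comp_analyticAt analyticAt_id.neg).mul (AnalyticAt.meromorphicAt ?_)
    have : Differentiable ℂ fun s : ℂ => Complex.sin (Real.pi * -s) / Real.pi := by fun_prop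
    exact this.analyticAt s
  · show M (-s) * _ = _
    rw [hk.I_eq_mellin h0 h1, h (-s) (by simpa using h1) (by simpa using by linarith)]

theorem IsMeromorphicContinuation.eq_of_I_eq {k k' : List ℕ} {F G : ℂ → ℂ}
    (hF : IsMeromorphicContinuation k F) (hG : IsMeromorphicContinuation k' G)
    (h : ∀ s : ℂ, -1 < s.re → I k s = I k' s) (s : ℂ) : F s = G s := by
  refine eqOn_of_meromorphicNFOn isPreconnected_univ hF.1 hG.1 (mem_univ 0) ?_ (mem_univ s)
  filter_upwards [(isOpen_halfPlane (-1)).mem_nhds (show (-1 : ℝ) < (0 : ℂ).re by simp)] with z hz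
  rw [hF.2 z hz, hG.2 z hz, h z hz]

end Ohno

theorem theorem2 (k : List ℕ) (hk : Ohno.Admissible k) :
    -- the series converge absolutely and agree for `Re s > -1`
    (∀ s : ℂ, -1 < s.re →
      Ohno.ConvergesAbsolutely k s ∧ Ohno.ConvergesAbsolutely (Ohno.dual k) s ∧
        Ohno.I k s = Ohno.I (Ohno.dual k) s) ∧
    -- both functions continue meromorphically to `ℂ`, and the continuations agree
    (∃ F : ℂ → ℂ, Ohno.IsMeromorphicContinuation k F) ∧
    (∃ G : ℂ → ℂ, Ohno.IsMeromorphicContinuation (Ohno.dual k) G) ∧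
    (∀ F G : ℂ → ℂ, Ohno.IsMeromorphicContinuation k F →
      Ohno.IsMeromorphicContinuation (Ohno.dual k) G → ∀ s : ℂ, F s = G s) ∧
    -- at `s = m ∈ ℤ_{≥0}` the two sides are the two sides of the Ohno relation
    (∀ e : Fin k.length → ℕ, Summable (Ohno.mzvTerm (k.get + e))) ∧
    (∀ e : Fin (Ohno.dual k).length → ℕ, Summable (Ohno.mzvTerm ((Ohno.dual k).get + e))) ∧
    (∀ m : ℕ, Ohno.I k m = Ohno.ohnoSum k m ∧
      Ohno.I (Ohno.dual k) m = Ohno.ohnoSum (Ohno.dual k) m) :=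
  ⟨fun _ hs => ⟨hk.convergesAbsolutely hs, hk.dual.convergesAbsolutely hs, hk.I_dual hs⟩,
    hk.exists_continuation, hk.dual.exists_continuation,
    fun _ _ hF hG => hF.eq_of_I_eq hG fun _ hs => hk.I_dual hs,
    hk.summable_mzvTerm, hk.dual.summable_mzvTerm,
    fun m => ⟨hk.I_natCast m, hk.dual.I_natCast m⟩⟩
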